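/- Let $u\in C^4([-1,1])$ be a symmetric flow, i.e. (S): $u(-y)=u(y)$, $u'(y)>0$ for $0<y\le 1$, $u'(0)=0$, $u''(0)>0$. Let $\alpha\in\mathbb{R}\setminus\{0\}$, $c\in(u(0),u(1))$, and let $y_c\in[0,1]$ be the point with $u(y_c)=c$. A number $c\in\mathrm{Ran}\,u$ is called an embedding eigenvalue of the Rayleigh operator $\mathcal R_\alpha=-(\partial_y^2-\alpha^2)^{-1}\big(u''-u(\partial_y^2-\alpha^2)\big)$ if there is $0\ne\psi\in H_0^1(-1,1)$ (complex valued) such that for all $\varphi\in H_0^1(-1,1)$ $$\int_{-1}^1(\psi'\varphi'+\alpha^2\psi\varphi)\,dy+\mathrm{p.v.}\!\int_{-1}^1\frac{u''\psi\varphi}{u-c}\,dy+i\pi\sum_{y\in u^{-1}\{c\},\,u'(y)\neq0}\frac{(u''\psi\varphi)(y)}{|u'(y)|}=0 .$$ Then there is a real solution $\phi(\cdot,c)\in C^2([0,1])$ of the homogeneous Rayleigh equation $(u-c)(\phi''-\alpha^2\phi)-u''\phi=0$ on $[0,1]$ with $\phi(y_c,c)=0$ and $\phi'(y_c,c)=u'(y_c)$.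 For every such solution, put $\phi_1(y,c)=\phi(y,c)/(u(y)-c)$, $\rho(c)=(c-u(0))(u(1)-c)$, and $$\mathrm A_1(c)=\rho(c)\,u'(y_c)\,\partial_c\Big(\mathrm{p.v.}\!\int_0^1\frac{dy}{u(y)-c}\Big),\qquad \mathrm{II}_3(c)=\int_0^1\frac{1}{(u(y)-c)^2}\Big(\frac1{\phi_1(y,c)^2}-1\Big)dy,\qquad J(c)=\frac{u'(y_c)(u(1)-c)}{\phi_1(0,c)\,\partial_y\phi_1(0,c)},$$ $$\mathrm A(c)=\mathrm A_1(c)+u'(y_c)\rho(c)\,\mathrm{II}_3(c),\qquad \mathrm B(c)=\pi\rho(c)\frac{u''(y_c)}{u'(y_c)^2},$$ $$\mathrm A_2(c)=(u(0)-c)\mathrm A(c)+J(c),\qquad \mathrm B_2(c)=(u(0)-c)\mathrm B(c).$$ These quantities are well defined (the principal value exists on $(u(0),u(1))$ and is differentiable at $c$, the integral $\mathrm{II}_3(c)$ converges, and $\partial_y\phi_1(0,c)$ exists with $\phi_1(0,c)\,\partial_y\phi_1(0,c)\ne0$), and $c$ is an embedding eigenvalue of $\mathcal R_\alpha$ if and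 only if $$\mathrm A(c)^2+\mathrm B(c)^2=0\quad\text{or}\quad \mathrm A_2(c)^2+\mathrm B_2(c)^2=0 .$$ -/

import Mathlib

open Set Filter Topology MeasureTheory

noncomputable section

/-- The derivative `u'` of a flow profile on the channel `[-1, 1]` (one-sided at the walls). -/
def flowDeriv (u : ℝ → ℝ) (y : ℝ) : ℝ := derivWithin u (Icc (-1) 1) y

/-- The second derivative `u''` of a flow profile on the channel `[-1, 1]`. -/
def flowDeriv2 (u : ℝ → ℝ) (y : ℝ) : ℝ := iteratedDerivWithin 2 u (Icc (-1) 1) y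

/-- Symmetric flows: `u ∈ C⁴([-1, 1])` satisfying condition (S). -/
structure IsSymmetricFlow (u : ℝ → ℝ) : Prop where
  contDiffOn : ContDiffOn ℝ 4 u (Icc (-1) 1)
  even : ∀ y ∈ Icc (-1 : ℝ) 1, u (-y) = u y
  deriv_pos : ∀ y ∈ Ioc (0 : ℝ) 1, 0 < flowDeriv u y
  deriv_zero : flowDeriv u 0 = 0
  deriv2_pos : 0 < flowDeriv2 u 0

/-- `ψ` (its continuous representative) belongs to the complex Sobolev space `H₀¹(-1, 1)`, and `ψ'`
is its weak derivative: `ψ'` is square integrable, `ψ` is the primitive of `ψ'` vanishing at `-1`,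
and `ψ` vanishes at `1`. Values outside `[-1, 1]` are irrelevant. -/
structure IsH10 (ψ ψ' : ℝ → ℂ) : Prop where
  memLp : MemLp ψ' 2 (volume.restrict (Icc (-1 : ℝ) 1))
  eq_integral : ∀ y ∈ Icc (-1 : ℝ) 1, ψ y = ∫ t in (-1 : ℝ)..y, ψ' t
  right_eq_zero : ψ 1 = 0

/-- The part of `[a, b]` at distance at least `ε` from every point of `S`. -/
def pvDomain (a b : ℝ) (S : Set ℝ) (ε : ℝ) : Set ℝ :=
  {y | y ∈ Icc a b ∧ ∀ s ∈ S, ε ≤ |y - s|}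

/-- The Cauchy principal value of `∫ f` over `[a, b]`, with singular set `S`, exists and is `L`. -/
def HasPV {E : Type*} [NormedAddCommGroup E] [NormedSpace ℝ E]
    (f : ℝ → E) (a b : ℝ) (S : Set ℝ) (L : E) : Prop :=
  (∀ ε : ℝ, 0 < ε → IntegrableOn f (pvDomain a b S ε)) ∧
    Tendsto (fun ε : ℝ => ∫ y in pvDomain a b S ε, f y) (𝓝[>] 0) (𝓝 L)

/-- `c` is an embedding eigenvalue of the Rayleigh operator with wave number `α`: it lies in the
range of `u`, and some nonzero `ψ ∈ H₀¹(-1, 1)` satisfies, for all `φ ∈ H₀¹(-1, 1)`,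
`∫ (ψ'φ' + α²ψφ) + p.v. ∫ u''ψφ/(u - c) + iπ ∑_{u(y) = c, u'(y) ≠ 0} (u''ψφ)(y)/|u'(y)| = 0`. -/
def IsEmbeddingEigenvalue (u : ℝ → ℝ) (α c : ℝ) : Prop :=
  c ∈ u '' Icc (-1) 1 ∧
  ∃ ψ ψ' : ℝ → ℂ, IsH10 ψ ψ' ∧ (∃ y ∈ Icc (-1 : ℝ) 1, ψ y ≠ 0) ∧
    ∀ φ φ' : ℝ → ℂ, IsH10 φ φ' →
      ∃ P : ℂ,
        HasPV (fun y : ℝ => (flowDeriv2 u y : ℂ) * ψ y * φ y / ((u y - c : ℝ) : ℂ)) (-1) 1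
          {y | y ∈ Icc (-1 : ℝ) 1 ∧ u y = c} P ∧
        (∫ y in (-1 : ℝ)..1, (ψ' y * φ' y + (α : ℂ) ^ 2 * ψ y * φ y)) + P
          + Complex.I * (Real.pi : ℂ) *
            (∑ᶠ y ∈ {y : ℝ | y ∈ Icc (-1 : ℝ) 1 ∧ u y = c ∧ flowDeriv u y ≠ 0},
              (flowDeriv2 u y : ℂ) * ψ y * φ y / ((|flowDeriv u y| : ℝ) : ℂ)) = 0

/-- `φ` is the regular solution on `[0, 1]` of the homogeneous Rayleigh equation
`(u - c)(φ'' - α²φ) - u''φ = 0` with `φ(y_c) = 0` and `φ'(y_c) = u'(y_c)`. -/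
structure IsRegularRayleighSolution (u : ℝ → ℝ) (α c yc : ℝ) (φ : ℝ → ℝ) : Prop where
  contDiffOn : ContDiffOn ℝ 2 φ (Icc 0 1)
  equation : ∀ y ∈ Icc (0 : ℝ) 1,
    (u y - c) * (iteratedDerivWithin 2 φ (Icc 0 1) y - α ^ 2 * φ y) - flowDeriv2 u y * φ y = 0
  eq_zero : φ yc = 0
  deriv_eq : derivWithin φ (Icc 0 1) yc = flowDeriv u yc

/-- `φ₁ = φ / (u - c)`; its value at the removable singularity `y = y_c` is never used. -/
def phi1 (u : ℝ → ℝ) (c : ℝ) (φ : ℝ → ℝ) (y : ℝ) : ℝ := φ y / (u y - c)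

/-- `φ₁'(0)` (a one-sided derivative, `φ₁` being considered on `[0, 1]`). -/
def phi1Deriv0 (u : ℝ → ℝ) (c : ℝ) (φ : ℝ → ℝ) : ℝ := derivWithin (phi1 u c φ) (Icc 0 1) 0

/-- `ρ(c) = (c - u(0))(u(1) - c)`. -/
def rho (u : ℝ → ℝ) (c : ℝ) : ℝ := (c - u 0) * (u 1 - c)

/-- The critical points `{y ∈ [0, 1] : u(y) = c}`. -/
def critSet (u : ℝ → ℝ) (c : ℝ) : Set ℝ := {y | y ∈ Icc (0 : ℝ) 1 ∧ u y = c}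

/-- `p.v. ∫₀¹ dy / (u(y) - c)`. -/
def pvRecip (u : ℝ → ℝ) (c : ℝ) : ℝ :=
  limUnder (𝓝[>] (0 : ℝ)) fun ε => ∫ y in pvDomain 0 1 (critSet u c) ε, 1 / (u y - c)

/-- The integrand of `II₃(c)`. -/
def integrandII3 (u : ℝ → ℝ) (c : ℝ) (φ : ℝ → ℝ) (y : ℝ) : ℝ :=
  1 / (u y - c) ^ 2 * (1 / phi1 u c φ y ^ 2 - 1)

def quantII3 (u : ℝ → ℝ) (c : ℝ) (φ : ℝ → ℝ) : ℝ := ∫ y in (0 : ℝ)..1, integrandII3 u c φ y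

def quantJ (u : ℝ → ℝ) (c yc : ℝ) (φ : ℝ → ℝ) : ℝ :=
  flowDeriv u yc * (u 1 - c) / (phi1 u c φ 0 * phi1Deriv0 u c φ)

def quantA1 (u : ℝ → ℝ) (c yc : ℝ) : ℝ :=
  rho u c * flowDeriv u yc * deriv (fun c' => pvRecip u c') c

def quantA (u : ℝ → ℝ) (c yc : ℝ) (φ : ℝ → ℝ) : ℝ :=
  quantA1 u c yc + flowDeriv u yc * rho u c * quantII3 u c φ

def quantB (u : ℝ → ℝ) (c yc : ℝ) : ℝ :=
  Real.pi * rho u c * (flowDeriv2 u yc / flowDeriv u yc ^ 2)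

def quantA2 (u : ℝ → ℝ) (c yc : ℝ) (φ : ℝ → ℝ) : ℝ :=
  (u 0 - c) * quantA u c yc φ + quantJ u c yc φ

def quantB2 (u : ℝ → ℝ) (c yc : ℝ) : ℝ := (u 0 - c) * quantB u c yc

/-- The expressions defining `A` and `A₂` make sense: the principal value defining `A₁` exists for
every value in `(u(0), u(1))` and is differentiable at `c`, the integral `II₃` converges, and the
denominator of `J` does not vanish (with `φ₁'(0)` a genuine derivative). -/
structure QuantitiesWellDefined (u : ℝ → ℝ) (c : ℝ) (φ : ℝ → ℝ) : Prop where
  hasPV : ∀ c' ∈ Ioo (u 0) (u 1),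
    HasPV (fun y => 1 / (u y - c')) 0 1 (critSet u c') (pvRecip u c')
  differentiableAt : DifferentiableAt ℝ (fun c' => pvRecip u c') c
  integrable : IntervalIntegrable (integrandII3 u c φ) volume 0 1
  differentiableWithinAt : DifferentiableWithinAt ℝ (phi1 u c φ) (Icc 0 1) 0
  phi1_ne_zero : phi1 u c φ 0 ≠ 0
  phi1Deriv0_ne_zero : phi1Deriv0 u c φ ≠ 0

end

/-!
On the half channel `[0, 1]` the profile `u` is strictly increasing, so `y_c` is the only critical
point there, and `u` may be replaced by a jet `U 0, …, U 4` of functions on the line that agree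
with `u` and its derivatives on `[-1, 1]` (`IsProfile`); then no one-sided derivatives remain.

The regular solution `φ` comes from a Volterra equation. Writing `φ = (u - c) φ₁`, the equation
becomes `((u - c)² φ₁')' = α² (u - c)² φ₁`, so that `φ₁ (u - c)² φ₁'` is nondecreasing and vanishes
at `y_c`. This energy identity gives `φ₁² ≥ 1`, `φ'(0) ≠ 0` and `|φ₁ - 1| ≤ C (y - y_c)²`; hence
`II₃` converges and `φ` vanishes only at `y_c`.

Three integrations by parts, which use up the four derivatives of `u`, write an antiderivative of
`1 / (u - c)` with at worst a logarithm at `y_c` and coefficients independent of `c`. Its derivative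
with respect to `c` is an antiderivative of `1 / (u - c)²`, so `∂_c p.v. ∫₀¹ 1 / (u - c)` is the
finite part of `∫₀¹ 1 / (u - c)²`, and
`K = ∂_c p.v. ∫₀¹ 1 / (u - c) + II₃` is the finite part of `∫₀¹ 1 / φ²`. Elementary algebra turns
the condition on `A, B, A₂, B₂` into
`u''(y_c) = 0` together with `K = 0` or `φ(0) φ'(0) K = 1` (`IsProfile.dispersion_iff`).

Let `ψ` be an eigenfunction. Testing with its conjugate and taking imaginary parts leaves
`u''(y_c) (|ψ(y_c)|² + |ψ(-y_c)|²) = 0`. If `u''(y_c) ≠ 0`, then `ψ` vanishes at both critical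
points, on each side of which it is a multiple of `φ` (reflected on the left half); the wall
conditions and `φ'(0) ≠ 0` make these multiples zero. So `u''(y_c) = 0`, the Rayleigh
equation is a regular equation `z'' = Q z` on the whole channel, and every solution obeys the
connection formula `z(1) / φ(1) - z(0) / φ(0) = w K`, `w = φ(0) z'(0) - z(0) φ'(0)`
(`HalfSolution.connection`): there is no jump at `y_c` because `z / φ - w ∫ 1 / φ²` has a limit
there. Applied to `z` and to its reflection, this shows that an odd solution vanishes at the walls
exactly when `K = 0`, and an even one exactly when `φ(0) φ'(0) K = 1`; this gives both directions
of the equivalence.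
-/

/-! ### Extensions by primitives and a Volterra equation -/

theorem hasDerivAt_primitive {h : ℝ → ℝ} (hh : Continuous h) (p t : ℝ) :
    HasDerivAt (fun t => ∫ w in p..t, h w) (h t) t :=
  intervalIntegral.integral_hasDerivAt_right (hh.intervalIntegrable _ _)
    (hh.stronglyMeasurableAtFilter _ _) hh.continuousAt

theorem continuous_primitive_of_continuous {h : ℝ → ℝ} (hh : Continuous h) (p : ℝ) :
    Continuous (fun t => ∫ w in p..t, h w) :=
  continuous_iff_continuousAt.mpr fun t => (hasDerivAt_primitive hh p t).continuousAt

/-- A function on `[a, b]` whose one-sided derivative agrees with a continuous `g'` extends to a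
primitive of `g'` on the whole line. -/
theorem exists_hasDerivAt_extension {f f' g' : ℝ → ℝ} {a b : ℝ}
    (hg' : Continuous g') (heq : EqOn f' g' (Icc a b))
    (hf : ∀ x ∈ Icc a b, HasDerivWithinAt f (f' x) (Icc a b) x) :
    ∃ g : ℝ → ℝ, (∀ x, HasDerivAt g (g' x) x) ∧ EqOn f g (Icc a b) := by
  refine ⟨fun x => f a + ∫ t in a..x, g' t, fun x => ?_, fun x hx => ?_⟩
  · exact (hasDerivAt_primitive hg' a x).const_add _
  · have h := intervalIntegral.integral_eq_sub_of_hasDerivAt_of_le (f := f) (f' := g') hx.1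
      (fun y hy => ((hf y ⟨hy.1, hy.2.trans hx.2⟩).continuousWithinAt).mono
        (Icc_subset_Icc le_rfl hx.2))
      (fun y hy => by
        have hy' : y ∈ Icc a b := ⟨hy.1.le, hy.2.le.trans hx.2⟩
        rw [← heq hy']
        exact (hf y hy').hasDerivAt (Icc_mem_nhds hy.1 (hy.2.trans_le hx.2)))
      (hg'.intervalIntegrable _ _)
    simp only [h]; ring

/-- A `C^n` function on `[a, b]`, together with its one-sided derivatives, extends to the line: the
`n`-th derivative is extended by constants and integrated `n` times. -/
theorem ContDiffOn.exists_jet {a b : ℝ} (hab : a < b) (n : ℕ) {f : ℝ → ℝ}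
    (hf : ContDiffOn ℝ n f (Icc a b)) :
    ∃ F : ℕ → ℝ → ℝ, (∀ k < n, ∀ x, HasDerivAt (F k) (F (k + 1) x) x) ∧ Continuous (F n) ∧
      ∀ k ≤ n, EqOn (iteratedDerivWithin k f (Icc a b)) (F k) (Icc a b) := by
  induction n generalizing f with
  | zero =>
    refine ⟨fun _ => IccExtend hab.le ((Icc a b).domRestrict f), by simp, ?_, ?_⟩
    · exact (continuousOn_iff_continuous_domRestrict.mp hf.continuousOn).Icc_extend'
    · intro k hk x hx
      obtain rfl : k = 0 := by omega
      simp [IccExtend_of_mem hab.le _ hx, domRestrict]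
  | succ n ih =>
    have hu : UniqueDiffOn ℝ (Icc a b) := uniqueDiffOn_Icc hab
    have h1 : ContDiffOn ℝ n (derivWithin f (Icc a b)) (Icc a b) :=
      hf.derivWithin hu (by norm_cast)
    obtain ⟨F, hF, hc, he⟩ := ih h1
    have hc0 : Continuous (F 0) := by
      rcases Nat.eq_zero_or_pos n with h | h
      · subst h; exact hc
      · exact continuous_iff_continuousAt.mpr fun x => (hF 0 h x).continuousAt
    have hd : DifferentiableOn ℝ f (Icc a b) := hf.differentiableOn (by simp)
    obtain ⟨g, hg, hfg⟩ := exists_hasDerivAt_extension hc0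
      (f := f) (f' := derivWithin f (Icc a b))
      (fun x hx => by simpa using he 0 (Nat.zero_le _) hx)
      (fun x hx => (hd x hx).hasDerivWithinAt)
    refine ⟨fun k => Nat.casesOn k g F, ?_, hc, ?_⟩
    · rintro (_ | k) hk x
      · exact hg x
      · exact hF k (by omega) x
    · rintro (_ | k) hk x hx
      · simpa using hfg hx
      · rw [iteratedDerivWithin_succ']
        exact he k (by omega) hx

/-- The twofold primitive from `p`, rescaled to the fixed interval `[0, 1]`. The double zero at
`y = p` becomes an explicit factor, which can absorb the pole of a singular coefficient. -/
theorem integral_sq_mul_comp_eq (p y : ℝ) {h : ℝ → ℝ} (hh : Continuous h) :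
    (y - p) ^ 2 * ∫ s in (0 : ℝ)..1, (1 - s) * h (p + s * (y - p)) =
      ∫ t in p..y, ∫ w in p..t, h w := by
  have hI := hasDerivAt_primitive hh p
  have hV := hasDerivAt_primitive (continuous_primitive_of_continuous hh p) p
  have hl : ∀ s : ℝ, HasDerivAt (fun s : ℝ => p + s * (y - p)) (y - p) s := fun s => by
    simpa using ((hasDerivAt_id s).mul_const (y - p)).const_add p
  have hd : ∀ s : ℝ, HasDerivAt (fun s : ℝ => (1 - s) * ((∫ w in p..(p + s * (y - p)), h w) *
      (y - p)) + ∫ t in p..(p + s * (y - p)), ∫ w in p..t, h w)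
      ((y - p) ^ 2 * ((1 - s) * h (p + s * (y - p)))) s := by
    intro s
    have h1 := ((hI (p + s * (y - p))).comp s (hl s)).mul_const (y - p)
    have h2 := (hV (p + s * (y - p))).comp s (hl s)
    have h3 := (((hasDerivAt_id s).const_sub 1).mul h1).add h2
    refine h3.congr_deriv ?_
    simp only [Function.comp, id]
    ring
  have key := intervalIntegral.integral_eq_sub_of_hasDerivAt (a := 0) (b := 1)
    (fun s _ => hd s) (Continuous.intervalIntegrable (by fun_prop) _ _)
  rw [← intervalIntegral.integral_const_mul, key]
  simp

theorem mul_exp_neg_le_one {x : ℝ} : x * Real.exp (-x) ≤ 1 := by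
  rw [Real.exp_neg, ← div_eq_mul_inv, div_le_one (Real.exp_pos x)]
  linarith [Real.add_one_le_exp x]

/-- Solvability of a Volterra equation on the whole line, where `A` may carry the simple zero left
over after a pole has cancelled one of the two factors `y - p`. The bounded unknown is
`exp (-l |y - p|) * g y`, for which the equation is a contraction when `l` is large. -/
theorem exists_volterra_solution (p a : ℝ) {A B : ℝ → ℝ} {K : ℝ} (hA : Continuous A)
    (hAp : ∀ y, |A y| ≤ |y - p|) (hB : Continuous B) (hK : ∀ y, |B y| ≤ K) :
    ∃ g : ℝ → ℝ, Continuous g ∧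
      ∀ y, g y = a + A y * ∫ s in (0 : ℝ)..1, (1 - s) * (B (p + s * (y - p)) *
        g (p + s * (y - p))) := by
  have hK0 : 0 ≤ K := (abs_nonneg _).trans (hK 0)
  -- The weight `exp (-l |y - p|)` gains a factor `exp (-l (1 - s) |y - p|)` under the integral;
  -- `x * exp (-x) ≤ 1` then bounds the operator by `K / l ≤ 1 / 2`.
  set l : ℝ := 2 * K + 1 with hl
  have hl0 : 0 < l := by positivity
  set I : (ℝ → ℝ) → ℝ → ℝ := fun h y => A y * ∫ s in (0 : ℝ)..1, (1 - s) *
    (B (p + s * (y - p)) * (Real.exp (-(l * ((1 - s) * |y - p|))) * h (p + s * (y - p)))) with hI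
  have hIc : ∀ h : ℝ → ℝ, Continuous h → Continuous (I h) := by
    intro h hh
    refine hA.mul (intervalIntegral.continuous_parametric_intervalIntegral_of_continuous'
      (f := fun y s => (1 - s) * (B (p + s * (y - p)) *
        (Real.exp (-(l * ((1 - s) * |y - p|))) * h (p + s * (y - p))))) ?_ _ _)
    simp only [Function.uncurry_def]
    fun_prop
  have hIb : ∀ (h : ℝ → ℝ) (M : ℝ), (∀ y, |h y| ≤ M) → ∀ y, |I h y| ≤ M / 2 := by
    intro h M hM y
    have hM0 : 0 ≤ M := (abs_nonneg _).trans (hM 0)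
    have : |I h y| = ‖∫ s in (0 : ℝ)..1, A y * ((1 - s) *
      (B (p + s * (y - p)) * (Real.exp (-(l * ((1 - s) * |y - p|))) * h (p + s * (y - p)))))‖ := by
      rw [intervalIntegral.integral_const_mul, Real.norm_eq_abs]
    rw [this]
    have hb := intervalIntegral.norm_integral_le_of_norm_le_const (a := 0) (b := 1)
      (C := M / 2) (f := fun s => A y * ((1 - s) *
      (B (p + s * (y - p)) * (Real.exp (-(l * ((1 - s) * |y - p|))) * h (p + s * (y - p)))))) ?_
    · simpa using hb
    · intro s hs
      rw [uIoc_of_le zero_le_one] at hs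
      have h1s : 0 ≤ 1 - s := by linarith [hs.2]
      rw [Real.norm_eq_abs, abs_mul, abs_mul, abs_mul, abs_mul, abs_of_nonneg h1s,
        abs_of_pos (Real.exp_pos _)]
      have e1 : l * ((1 - s) * |y - p|) * Real.exp (-(l * ((1 - s) * |y - p|))) ≤ 1 :=
        mul_exp_neg_le_one
      set e := Real.exp (-(l * ((1 - s) * |y - p|))) with he
      have he0 : 0 < e := Real.exp_pos _
      calc |A y| * ((1 - s) * (|B (p + s * (y - p))| * (e * |h (p + s * (y - p))|)))
          ≤ |y - p| * ((1 - s) * (K * (e * M))) := by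
            have h1 := hAp y
            have h2 := hK (p + s * (y - p))
            have h3 := hM (p + s * (y - p))
            gcongr
        _ = (l * ((1 - s) * |y - p|) * e) * (K * M / l) := by field_simp
        _ ≤ 1 * (K * M / l) := by gcongr
        _ ≤ M / 2 := by
            rw [one_mul, div_le_div_iff₀ hl0 two_pos, hl]
            nlinarith
  set e0 : ℝ → ℝ := fun y => Real.exp (-(l * |y - p|)) * a with he0
  have he0c : Continuous e0 := by fun_prop
  have he0b : ∀ y, |e0 y| ≤ |a| := by
    intro y
    rw [he0, abs_mul, abs_of_pos (Real.exp_pos _)]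
    have : Real.exp (-(l * |y - p|)) ≤ 1 := Real.exp_le_one_iff.mpr (by
      have := mul_nonneg hl0.le (abs_nonneg (y - p)); linarith)
    nlinarith [abs_nonneg a]
  let T : BoundedContinuousFunction ℝ ℝ → BoundedContinuousFunction ℝ ℝ := fun h =>
    BoundedContinuousFunction.ofNormedAddCommGroup (fun y => e0 y + I h y)
      (he0c.add (hIc h h.continuous)) (|a| + ‖h‖ / 2) (fun y => by
        rw [Real.norm_eq_abs]
        exact (abs_add_le _ _).trans (add_le_add (he0b y)
          (hIb h ‖h‖ (fun z => h.norm_coe_le_norm z) y)))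
  have hT : ContractingWith (1 / 2) T := by
    refine ⟨by rw [div_lt_one] <;> norm_num, LipschitzWith.of_dist_le_mul fun h k => ?_⟩
    rw [BoundedContinuousFunction.dist_le (by positivity)]
    intro y
    have hsub : T h y - T k y = I (fun y => h y - k y) y := by
      change (e0 y + I h y) - (e0 y + I k y) = _
      rw [add_sub_add_left_eq_sub]
      simp only [hI]
      rw [← mul_sub, ← intervalIntegral.integral_sub]
      · congr 2; ext s; ring
      · exact Continuous.intervalIntegrable (by fun_prop) _ _
      · exact Continuous.intervalIntegrable (by fun_prop) _ _
    rw [Real.dist_eq, hsub]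
    have := hIb (fun y => h y - k y) (dist h k) (fun z => by
      rw [← Real.dist_eq]; exact BoundedContinuousFunction.dist_coe_le_dist z) y
    refine this.trans (le_of_eq ?_)
    simp; ring
  set h := hT.fixedPoint
  have hfix : T h = h := hT.fixedPoint_isFixedPt
  refine ⟨fun y => Real.exp (l * |y - p|) * h y, by fun_prop, fun y => ?_⟩
  have hy : h y = e0 y + I h y := by
    conv_lhs => rw [← hfix]
    rfl
  simp only
  simp only [hy, he0, hI]
  rw [mul_add, ← mul_assoc, ← Real.exp_add, add_neg_cancel, Real.exp_zero, one_mul,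
    mul_left_comm, ← intervalIntegral.integral_const_mul]
  congr 2
  refine intervalIntegral.integral_congr fun s hs => ?_
  rw [uIcc_of_le zero_le_one] at hs
  have : Real.exp (l * |p + s * (y - p) - p|) =
      Real.exp (l * |y - p|) * Real.exp (-(l * ((1 - s) * |y - p|))) := by
    rw [← Real.exp_add, add_sub_cancel_left, abs_mul, abs_of_nonneg hs.1]
    congr 1; ring
  rw [this]; ring

/-- Solution of the singular equation `f'' = E f / (y - p)` with `f p = 0`, `f' p = a`; the quotient
`f / (y - p)` is the continuous function `g`. -/
theorem exists_solution_vanishing_at (p a : ℝ) {E : ℝ → ℝ} {K : ℝ} (hE : Continuous E)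
    (hK : ∀ y, |E y| ≤ K) :
    ∃ f f' g : ℝ → ℝ, Continuous g ∧ (∀ y, f y = (y - p) * g y) ∧ f' p = a ∧
      (∀ y, HasDerivAt f (f' y) y) ∧ ∀ y, HasDerivAt f' (E y * g y) y := by
  obtain ⟨g, hg, hgy⟩ := exists_volterra_solution p a (A := fun y => y - p) (by fun_prop)
    (fun y => le_rfl) hE hK
  have hEg : Continuous (fun y => E y * g y) := hE.mul hg
  refine ⟨fun y => a * (y - p) + ∫ t in p..y, ∫ w in p..t, E w * g w,
    fun y => a + ∫ w in p..y, E w * g w, g, hg, fun y => ?_, by simp, fun y => ?_, fun y => ?_⟩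
  · simp only
    rw [hgy y, ← integral_sq_mul_comp_eq p y hEg]; ring
  · simpa using (((hasDerivAt_id y).sub_const p).const_mul a).fun_add
      (hasDerivAt_primitive (continuous_primitive_of_continuous hEg p) p y)
  · exact (hasDerivAt_primitive hEg p y).const_add a

/-- Solution of `f'' = Q f` with `f p = 1`, `f' p = 0`, on the unit interval around `p`. -/
theorem exists_solution_eq_one_at (p : ℝ) {Q : ℝ → ℝ} {K : ℝ} (hQ : Continuous Q)
    (hK : ∀ y, |Q y| ≤ K) :
    ∃ f f' : ℝ → ℝ, f p = 1 ∧ f' p = 0 ∧ (∀ y, HasDerivAt f (f' y) y) ∧ Continuous f' ∧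
      ∀ y, |y - p| < 1 → HasDerivAt f' (Q y * f y) y := by
  obtain ⟨g, hg, hgy⟩ := exists_volterra_solution p 1
    (A := fun y => (y - p) * max (-1) (min 1 (y - p))) (by fun_prop)
    (fun y => by
      rw [abs_mul]
      have : |max (-1) (min 1 (y - p))| ≤ 1 := abs_le.mpr ⟨le_max_left _ _,
        max_le (by norm_num) (min_le_left _ _)⟩
      nlinarith [abs_nonneg (y - p)]) hQ hK
  have hQg : Continuous (fun y => Q y * g y) := hQ.mul hg
  have hc := continuous_primitive_of_continuous hQg p
  -- The cutoff of the factor `y - p` in `A` is inactive for `|y - p| < 1`.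
  refine ⟨fun y => 1 + ∫ t in p..y, ∫ w in p..t, Q w * g w,
    fun y => ∫ w in p..y, Q w * g w, by simp, by simp, fun y => ?_, hc, fun y hy => ?_⟩
  · exact (hasDerivAt_primitive hc p y).const_add 1
  · rw [abs_lt] at hy
    have : g y = 1 + ∫ t in p..y, ∫ w in p..t, Q w * g w := by
      rw [hgy y, ← integral_sq_mul_comp_eq p y hQg, min_eq_right hy.2.le, max_eq_right hy.1.le]
      ring
    simp only [← this]
    exact hasDerivAt_primitive hQg p y

/-! ### The flow profile and the regular Rayleigh solution -/

/-- A symmetric flow profile `U 0` with its derivatives `U 1, …, U 4`, as functions on the whole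
line. Evenness and monotonicity are required on the channel only. -/
structure ProfileJet (U : ℕ → ℝ → ℝ) : Prop where
  hasDerivAt : ∀ k < 4, ∀ x, HasDerivAt (U k) (U (k + 1) x) x
  continuous_top : Continuous (U 4)
  even : ∀ y ∈ Icc (-1 : ℝ) 1, U 0 (-y) = U 0 y
  deriv_pos : ∀ y ∈ Ioc (0 : ℝ) 1, 0 < U 1 y
  deriv_zero : U 1 0 = 0

theorem IsSymmetricFlow.exists_jet {u : ℝ → ℝ} (hu : IsSymmetricFlow u) :
    ∃ U : ℕ → ℝ → ℝ, ProfileJet U ∧ EqOn u (U 0) (Icc (-1) 1) ∧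
      EqOn (flowDeriv u) (U 1) (Icc (-1) 1) ∧ EqOn (flowDeriv2 u) (U 2) (Icc (-1) 1) := by
  obtain ⟨U, hU, hc, he⟩ := ContDiffOn.exists_jet (by norm_num : (-1 : ℝ) < 1) 4 hu.contDiffOn
  have h0 : EqOn u (U 0) (Icc (-1) 1) := fun y hy => by simpa using he 0 (by norm_num) hy
  have h1 : EqOn (flowDeriv u) (U 1) (Icc (-1) 1) := fun y hy => by
    simpa [flowDeriv, iteratedDerivWithin_one] using he 1 (by norm_num) hy
  have h2 : EqOn (flowDeriv2 u) (U 2) (Icc (-1) 1) := fun y hy => he 2 (by norm_num) hy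
  refine ⟨U, ⟨hU, hc, fun y hy => ?_, fun y hy => ?_, ?_⟩, h0, h1, h2⟩
  · have hy' : -y ∈ Icc (-1 : ℝ) 1 := ⟨by linarith [hy.2], by linarith [hy.1]⟩
    rw [← h0 hy, ← h0 hy', hu.even y hy]
  · rw [← h1 ⟨by linarith [hy.1], hy.2⟩]
    exact hu.deriv_pos y hy
  · rw [← h1 ⟨by norm_num, by norm_num⟩]
    exact hu.deriv_zero

theorem continuous_dslope {f : ℝ → ℝ} {f' p : ℝ} (hf : Continuous f) (hd : HasDerivAt f f' p) :
    Continuous (dslope f p) := by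
  refine continuous_iff_continuousAt.mpr fun y => ?_
  rcases eq_or_ne y p with rfl | h
  · exact continuousAt_dslope_same.mpr hd.differentiableAt
  · exact (continuousAt_dslope_of_ne h).mpr hf.continuousAt

theorem sub_eq_mul_dslope (f : ℝ → ℝ) (p y : ℝ) : f y - f p = (y - p) * dslope f p y := by
  rw [← smul_eq_mul, sub_smul_dslope]

/-- Mean value estimate from a base point `p`, at which no derivative is needed. -/
theorem abs_sub_le_of_abs_deriv_le {f f' : ℝ → ℝ} {p C : ℝ} {k : ℕ} (hp : p ∈ Icc (0 : ℝ) 1)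
    (hC : 0 ≤ C) (hf : ContinuousOn f (Icc 0 1))
    (hd : ∀ y ∈ Ioo (0 : ℝ) 1, y ≠ p → HasDerivAt f (f' y) y)
    (hb : ∀ y ∈ Icc (0 : ℝ) 1, y ≠ p → |f' y| ≤ C * |y - p| ^ k) :
    ∀ y ∈ Icc (0 : ℝ) 1, |f y - f p| ≤ C * |y - p| ^ (k + 1) := by
  intro y hy
  rcases lt_trichotomy y p with h | h | h
  · obtain ⟨z, hz, hzs⟩ := exists_hasDerivAt_eq_slope f f' h
      (hf.mono (Icc_subset_Icc hy.1 hp.2))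
      (fun x hx => hd x ⟨hy.1.trans_lt hx.1, hx.2.trans_le hp.2⟩ hx.2.ne)
    have hb' := hb z ⟨hy.1.trans hz.1.le, hz.2.le.trans hp.2⟩ hz.2.ne
    have h1 : f y - f p = f' z * (y - p) := by
      rw [hzs]; field_simp [(sub_pos.mpr h).ne']; ring
    have h2 : |z - p| ≤ |y - p| := by
      rw [abs_of_neg (by linarith [hz.2]), abs_of_neg (by linarith)]; linarith [hz.1]
    rw [h1, abs_mul, pow_succ, ← mul_assoc]
    gcongr
    exact hb'.trans (by gcongr)
  · simp [h]
  · obtain ⟨z, hz, hzs⟩ := exists_hasDerivAt_eq_slope f f' h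
      (hf.mono (Icc_subset_Icc hp.1 hy.2))
      (fun x hx => hd x ⟨hp.1.trans_lt hx.1, hx.2.trans_le hy.2⟩ hx.1.ne')
    have hb' := hb z ⟨hp.1.trans hz.1.le, hz.2.le.trans hy.2⟩ hz.1.ne'
    have h1 : f y - f p = f' z * (y - p) := by
      rw [hzs]; field_simp [(sub_pos.mpr h).ne']
    have h2 : |z - p| ≤ |y - p| := by
      rw [abs_of_pos (by linarith [hz.1]), abs_of_pos (by linarith)]; linarith [hz.2]
    rw [h1, abs_mul, pow_succ, ← mul_assoc]
    gcongr
    exact hb'.trans (by gcongr)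

namespace ProfileJet

variable {U : ℕ → ℝ → ℝ} {yc : ℝ}

theorem continuous (H : ProfileJet U) {k : ℕ} (hk : k ≤ 4) : Continuous (U k) := by
  rcases hk.lt_or_eq with h | rfl
  · exact continuous_iff_continuousAt.mpr fun x => (H.hasDerivAt k h x).continuousAt
  · exact H.continuous_top

theorem strictMonoOn (H : ProfileJet U) : StrictMonoOn (U 0) (Icc 0 1) := by
  refine strictMonoOn_of_deriv_pos (convex_Icc 0 1) (H.continuous (by norm_num)).continuousOn ?_
  intro x hx
  rw [interior_Icc] at hx
  rw [(H.hasDerivAt 0 (by norm_num) x).deriv]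
  exact H.deriv_pos x ⟨hx.1, hx.2.le⟩

theorem injOn (H : ProfileJet U) : InjOn (U 0) (Icc 0 1) := H.strictMonoOn.injOn

theorem deriv_odd (H : ProfileJet U) {y : ℝ} (hy : y ∈ Ioo (-1 : ℝ) 1) : U 1 (-y) = - U 1 y := by
  have h1 := ((H.hasDerivAt 0 (by norm_num) (-y)).comp y (hasDerivAt_neg y))
  have h2 : HasDerivAt (U 0) (U 1 (-y) * -1) y := by
    refine h1.congr_of_eventuallyEq ?_
    filter_upwards [Icc_mem_nhds hy.1 hy.2] with z hz
    exact (H.even z hz).symm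
  have := h2.unique (H.hasDerivAt 0 (by norm_num) y)
  simp only [zero_add] at this
  linarith

theorem deriv2_even (H : ProfileJet U) {y : ℝ} (hy : y ∈ Ioo (-1 : ℝ) 1) : U 2 (-y) = U 2 y := by
  have h1 := ((H.hasDerivAt 1 (by norm_num) (-y)).comp y (hasDerivAt_neg y)).neg
  have h2 : HasDerivAt (U 1) (-(U 2 (-y) * -1)) y := by
    refine h1.congr_of_eventuallyEq ?_
    filter_upwards [Ioo_mem_nhds hy.1 hy.2] with z hz
    simp [H.deriv_odd hz]
  have := h2.unique (H.hasDerivAt 1 (by norm_num) y)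
  simpa using this

theorem dslope_pos (H : ProfileJet U) (hyc : yc ∈ Ioo (0 : ℝ) 1) {y : ℝ} (hy : y ∈ Icc (0 : ℝ) 1) :
    0 < dslope (U 0) yc y := by
  rcases eq_or_ne y yc with rfl | h
  · rw [dslope_same, (H.hasDerivAt 0 (by norm_num) y).deriv]
    exact H.deriv_pos y ⟨hyc.1, hyc.2.le⟩
  · rw [dslope_of_ne _ h]
    exact H.strictMonoOn.slope_pos ⟨hyc.1.le, hyc.2.le⟩ hy h.symm

theorem continuous_dslope (H : ProfileJet U) {k : ℕ} (hk : k < 4) (p : ℝ) :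
    Continuous (dslope (U k) p) :=
  _root_.continuous_dslope (H.continuous hk.le) (H.hasDerivAt k hk p)

theorem speed_sub_ne_zero (H : ProfileJet U) (hyc : yc ∈ Ioo (0 : ℝ) 1) {y : ℝ}
    (hy : y ∈ Icc (0 : ℝ) 1) (h : y ≠ yc) : U 0 y - U 0 yc ≠ 0 :=
  sub_ne_zero.mpr fun e => h (H.injOn hy ⟨hyc.1.le, hyc.2.le⟩ e)

theorem exists_abs_sub_bounds (H : ProfileJet U) (hyc : yc ∈ Ioo (0 : ℝ) 1) :
    ∃ m M : ℝ, 0 < m ∧ 0 < M ∧ ∀ y ∈ Icc (0 : ℝ) 1,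
      m * |y - yc| ≤ |U 0 y - U 0 yc| ∧ |U 0 y - U 0 yc| ≤ M * |y - yc| := by
  have hc := (H.continuous_dslope (k := 0) (by norm_num) yc).continuousOn (s := Icc (0 : ℝ) 1)
  have hne : (Icc (0 : ℝ) 1).Nonempty := nonempty_Icc.mpr zero_le_one
  obtain ⟨a, ha, ham⟩ := isCompact_Icc.exists_isMinOn hne hc
  obtain ⟨b, hb, hbm⟩ := isCompact_Icc.exists_isMaxOn hne hc
  refine ⟨_, _, H.dslope_pos hyc ha, H.dslope_pos hyc hb, fun y hy => ?_⟩
  rw [sub_eq_mul_dslope, abs_mul, abs_of_pos (H.dslope_pos hyc hy), mul_comm |y - yc|]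
  exact ⟨mul_le_mul_of_nonneg_right (ham hy) (abs_nonneg _),
    mul_le_mul_of_nonneg_right (hbm hy) (abs_nonneg _)⟩

end ProfileJet

/-- The regular solution of the Rayleigh equation on `[0, 1]` with its first two derivatives,
extended to the line; the equation is required on `[0, 1]` only, and `c` is written `U 0 yc`. -/
structure RegularJet (U : ℕ → ℝ → ℝ) (α yc : ℝ) (Φ Φ' Φ'' : ℝ → ℝ) : Prop where
  hasDerivAt : ∀ y, HasDerivAt Φ (Φ' y) y
  hasDerivAt' : ∀ y, HasDerivAt Φ' (Φ'' y) y
  continuous'' : Continuous Φ''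
  equation : ∀ y ∈ Icc (0 : ℝ) 1, (U 0 y - U 0 yc) * (Φ'' y - α ^ 2 * Φ y) - U 2 y * Φ y = 0
  eq_zero : Φ yc = 0
  deriv_eq : Φ' yc = U 1 yc

/-- The function `φ₁ = Φ / (U 0 - U 0 yc)`, with its removable singularity at `yc` filled in by
dividing both numerator and denominator by `y - yc`. -/
noncomputable def quotientBySpeed (U : ℕ → ℝ → ℝ) (yc : ℝ) (Φ : ℝ → ℝ) (y : ℝ) : ℝ :=
  dslope Φ yc y / dslope (U 0) yc y

namespace RegularJet

variable {U : ℕ → ℝ → ℝ} {α yc : ℝ} {Φ Φ' Φ'' : ℝ → ℝ}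

theorem continuous (R : RegularJet U α yc Φ Φ' Φ'') : Continuous Φ :=
  continuous_iff_continuousAt.mpr fun x => (R.hasDerivAt x).continuousAt

theorem continuous' (R : RegularJet U α yc Φ Φ' Φ'') : Continuous Φ' :=
  continuous_iff_continuousAt.mpr fun x => (R.hasDerivAt' x).continuousAt

theorem quotient_continuousOn (R : RegularJet U α yc Φ Φ' Φ'') (H : ProfileJet U)
    (hyc : yc ∈ Ioo (0 : ℝ) 1) : ContinuousOn (quotientBySpeed U yc Φ) (Icc 0 1) :=
  (continuous_dslope R.continuous (R.hasDerivAt yc)).continuousOn.div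
    (H.continuous_dslope (by norm_num) yc).continuousOn fun _ hy => (H.dslope_pos hyc hy).ne'

theorem eq_mul_quotient (R : RegularJet U α yc Φ Φ' Φ'') (H : ProfileJet U)
    (hyc : yc ∈ Ioo (0 : ℝ) 1) {y : ℝ} (hy : y ∈ Icc (0 : ℝ) 1) :
    Φ y = (U 0 y - U 0 yc) * quotientBySpeed U yc Φ y := by
  have h := sub_eq_mul_dslope Φ yc y
  rw [R.eq_zero, sub_zero] at h
  rw [h, sub_eq_mul_dslope, quotientBySpeed]
  field_simp [(H.dslope_pos hyc hy).ne']

theorem quotient_eq_div (R : RegularJet U α yc Φ Φ' Φ'') (H : ProfileJet U)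
    (hyc : yc ∈ Ioo (0 : ℝ) 1) {y : ℝ} (hy : y ∈ Icc (0 : ℝ) 1) (h : y ≠ yc) :
    quotientBySpeed U yc Φ y = Φ y / (U 0 y - U 0 yc) := by
  rw [R.eq_mul_quotient H hyc hy, mul_div_cancel_left₀ _ (H.speed_sub_ne_zero hyc hy h)]

theorem quotient_same (R : RegularJet U α yc Φ Φ' Φ'') (H : ProfileJet U)
    (hyc : yc ∈ Ioo (0 : ℝ) 1) : quotientBySpeed U yc Φ yc = 1 := by
  rw [quotientBySpeed, dslope_same, dslope_same, (R.hasDerivAt yc).deriv,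
    (H.hasDerivAt 0 (by norm_num) yc).deriv, R.deriv_eq]
  exact div_self (H.deriv_pos yc ⟨hyc.1, hyc.2.le⟩).ne'

/-- The function `(u - c)² φ₁'`, written without division, is a primitive of `α² (u - c) φ`. -/
theorem wronskian_hasDerivAt (R : RegularJet U α yc Φ Φ' Φ'') (H : ProfileJet U)
    {y : ℝ} (hy : y ∈ Icc (0 : ℝ) 1) :
    HasDerivAt (fun y => Φ' y * (U 0 y - U 0 yc) - Φ y * U 1 y)
      (α ^ 2 * (U 0 y - U 0 yc) * Φ y) y := by
  have h := ((R.hasDerivAt' y).fun_mul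
    ((H.hasDerivAt 0 (by norm_num) y).sub_const (U 0 yc))).fun_sub
    ((R.hasDerivAt y).fun_mul (H.hasDerivAt 1 (by norm_num) y))
  refine h.congr_deriv ?_
  have := R.equation y hy
  simp only [zero_add, one_add_one_eq_two]
  linarith

theorem quotient_hasDerivAt (R : RegularJet U α yc Φ Φ' Φ'') (H : ProfileJet U)
    (hyc : yc ∈ Ioo (0 : ℝ) 1) {y : ℝ} (hy : y ∈ Ioo (0 : ℝ) 1) (h : y ≠ yc) :
    HasDerivAt (quotientBySpeed U yc Φ)
      ((Φ' y * (U 0 y - U 0 yc) - Φ y * U 1 y) / (U 0 y - U 0 yc) ^ 2) y := by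
  have hd := (R.hasDerivAt y).fun_div ((H.hasDerivAt 0 (by norm_num) y).sub_const (U 0 yc))
    (H.speed_sub_ne_zero hyc (Ioo_subset_Icc_self hy) h)
  refine hd.congr_of_eventuallyEq ?_
  filter_upwards [Ioo_mem_nhds hy.1 hy.2, isOpen_ne.mem_nhds h] with z hz hzc
  exact R.quotient_eq_div H hyc (Ioo_subset_Icc_self hz) hzc

/-- The energy identity: `φ₁ (u - c)² φ₁'` has the nonnegative derivative `(u - c)² φ₁'² + α² φ²`.
-/
theorem energy_hasDerivAt (R : RegularJet U α yc Φ Φ' Φ'') (H : ProfileJet U)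
    (hyc : yc ∈ Ioo (0 : ℝ) 1) {y : ℝ} (hy : y ∈ Ioo (0 : ℝ) 1) (h : y ≠ yc) :
    HasDerivAt (fun y => quotientBySpeed U yc Φ y * (Φ' y * (U 0 y - U 0 yc) - Φ y * U 1 y))
      ((Φ' y * (U 0 y - U 0 yc) - Φ y * U 1 y) ^ 2 / (U 0 y - U 0 yc) ^ 2 + α ^ 2 * Φ y ^ 2) y := by
  have hd := (R.quotient_hasDerivAt H hyc hy h).fun_mul
    (R.wronskian_hasDerivAt H (Ioo_subset_Icc_self hy))
  refine hd.congr_deriv ?_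
  have := H.speed_sub_ne_zero hyc (Ioo_subset_Icc_self hy) h
  rw [R.quotient_eq_div H hyc (Ioo_subset_Icc_self hy) h]
  field_simp

theorem energy_continuousOn (R : RegularJet U α yc Φ Φ' Φ'') (H : ProfileJet U)
    (hyc : yc ∈ Ioo (0 : ℝ) 1) :
    ContinuousOn (fun y => quotientBySpeed U yc Φ y * (Φ' y * (U 0 y - U 0 yc) - Φ y * U 1 y))
      (Icc 0 1) := by
  have h0 := H.continuous (k := 0) (by norm_num)
  have h1 := H.continuous (k := 1) (by norm_num)
  have h2 := R.continuous
  have h3 := R.continuous'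
  exact (R.quotient_continuousOn H hyc).mul (Continuous.continuousOn (by fun_prop))

theorem energy_nonneg (R : RegularJet U α yc Φ Φ' Φ'') (H : ProfileJet U)
    (hyc : yc ∈ Ioo (0 : ℝ) 1) {y : ℝ} (hy : y ∈ Icc yc 1) :
    0 ≤ quotientBySpeed U yc Φ y * (Φ' y * (U 0 y - U 0 yc) - Φ y * U 1 y) := by
  have hm := monotoneOn_of_deriv_nonneg (convex_Icc yc 1)
    ((R.energy_continuousOn H hyc).mono (Icc_subset_Icc hyc.1.le le_rfl))
    (fun x hx => by
      rw [interior_Icc] at hx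
      exact (R.energy_hasDerivAt H hyc ⟨hyc.1.trans hx.1, hx.2⟩
        hx.1.ne').differentiableAt.differentiableWithinAt)
    (fun x hx => by
      rw [interior_Icc] at hx
      rw [(R.energy_hasDerivAt H hyc ⟨hyc.1.trans hx.1, hx.2⟩ hx.1.ne').deriv]
      positivity)
  simpa [R.eq_zero] using hm (left_mem_Icc.mpr hyc.2.le) hy hy.1

theorem energy_nonpos (R : RegularJet U α yc Φ Φ' Φ'') (H : ProfileJet U)
    (hyc : yc ∈ Ioo (0 : ℝ) 1) {y : ℝ} (hy : y ∈ Icc 0 yc) :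
    quotientBySpeed U yc Φ y * (Φ' y * (U 0 y - U 0 yc) - Φ y * U 1 y) ≤ 0 := by
  have hm := monotoneOn_of_deriv_nonneg (convex_Icc 0 yc)
    ((R.energy_continuousOn H hyc).mono (Icc_subset_Icc le_rfl hyc.2.le))
    (fun x hx => by
      rw [interior_Icc] at hx
      exact (R.energy_hasDerivAt H hyc ⟨hx.1, hx.2.trans hyc.2⟩
        hx.2.ne).differentiableAt.differentiableWithinAt)
    (fun x hx => by
      rw [interior_Icc] at hx
      rw [(R.energy_hasDerivAt H hyc ⟨hx.1, hx.2.trans hyc.2⟩ hx.2.ne).deriv]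
      positivity)
  simpa [R.eq_zero] using hm hy (right_mem_Icc.mpr hyc.1.le) hy.2

/-- `φ₁²` decreases up to `yc`, where it equals `1`, and increases afterwards, since
`(φ₁²)' = 2 φ₁ φ₁'` has the sign of the energy. -/
theorem one_le_quotient_sq (R : RegularJet U α yc Φ Φ' Φ'') (H : ProfileJet U)
    (hyc : yc ∈ Ioo (0 : ℝ) 1) {y : ℝ} (hy : y ∈ Icc (0 : ℝ) 1) :
    1 ≤ quotientBySpeed U yc Φ y ^ 2 := by
  have hc : ContinuousOn (fun y => quotientBySpeed U yc Φ y ^ 2) (Icc 0 1) :=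
    (R.quotient_continuousOn H hyc).pow 2
  have hd : ∀ x ∈ Ioo (0 : ℝ) 1, x ≠ yc → HasDerivAt (fun y => quotientBySpeed U yc Φ y ^ 2)
      (2 * (quotientBySpeed U yc Φ x * (Φ' x * (U 0 x - U 0 yc) - Φ x * U 1 x)) /
        (U 0 x - U 0 yc) ^ 2) x := fun x hx h => by
    refine ((R.quotient_hasDerivAt H hyc hx h).fun_pow 2).congr_deriv ?_
    push_cast; ring
  rcases le_total yc y with h | h
  · have hm := monotoneOn_of_deriv_nonneg (convex_Icc yc 1)
      (hc.mono (Icc_subset_Icc hyc.1.le le_rfl))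
      (fun x hx => by
        rw [interior_Icc] at hx
        exact (hd x ⟨hyc.1.trans hx.1, hx.2⟩
          hx.1.ne').differentiableAt.differentiableWithinAt)
      (fun x hx => by
        rw [interior_Icc] at hx
        rw [(hd x ⟨hyc.1.trans hx.1, hx.2⟩ hx.1.ne').deriv]
        have := R.energy_nonneg H hyc ⟨hx.1.le, hx.2.le⟩
        positivity)
    have := hm (left_mem_Icc.mpr hyc.2.le) ⟨h, hy.2⟩ h
    simpa [R.quotient_same H hyc] using this
  · have hm := antitoneOn_of_deriv_nonpos (convex_Icc 0 yc)
      (hc.mono (Icc_subset_Icc le_rfl hyc.2.le))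
      (fun x hx => by
        rw [interior_Icc] at hx
        exact (hd x ⟨hx.1, hx.2.trans hyc.2⟩
          hx.2.ne).differentiableAt.differentiableWithinAt)
      (fun x hx => by
        rw [interior_Icc] at hx
        rw [(hd x ⟨hx.1, hx.2.trans hyc.2⟩ hx.2.ne).deriv]
        have := R.energy_nonpos H hyc ⟨hx.1.le, hx.2.le⟩
        exact div_nonpos_of_nonpos_of_nonneg (by linarith) (by positivity))
    have := hm ⟨hy.1, h⟩ (right_mem_Icc.mpr hyc.1.le) h
    simpa [R.quotient_same H hyc] using this

theorem quotient_ne_zero (R : RegularJet U α yc Φ Φ' Φ'') (H : ProfileJet U)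
    (hyc : yc ∈ Ioo (0 : ℝ) 1) {y : ℝ} (hy : y ∈ Icc (0 : ℝ) 1) :
    quotientBySpeed U yc Φ y ≠ 0 := by
  intro h
  have := R.one_le_quotient_sq H hyc hy
  rw [h] at this
  norm_num at this

theorem ne_zero (R : RegularJet U α yc Φ Φ' Φ'') (H : ProfileJet U)
    (hyc : yc ∈ Ioo (0 : ℝ) 1) {y : ℝ} (hy : y ∈ Icc (0 : ℝ) 1) (h : y ≠ yc) : Φ y ≠ 0 := by
  rw [R.eq_mul_quotient H hyc hy]
  exact mul_ne_zero (H.speed_sub_ne_zero hyc hy h) (R.quotient_ne_zero H hyc hy)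

/-- Since `u'(0) = 0`, the energy at `0` is a multiple of `Φ' 0`; for `α ≠ 0` it is strictly
increasing up to its zero at `yc`. -/
theorem deriv_left_ne_zero (R : RegularJet U α yc Φ Φ' Φ'') (H : ProfileJet U) (hα : α ≠ 0)
    (hyc : yc ∈ Ioo (0 : ℝ) 1) : Φ' 0 ≠ 0 := by
  intro h0
  have hm := strictMonoOn_of_deriv_pos (convex_Icc 0 yc)
    ((R.energy_continuousOn H hyc).mono (Icc_subset_Icc le_rfl hyc.2.le))
    (fun x hx => by
      rw [interior_Icc] at hx
      rw [(R.energy_hasDerivAt H hyc ⟨hx.1, hx.2.trans hyc.2⟩ hx.2.ne).deriv]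
      have := R.ne_zero H hyc ⟨hx.1.le, (hx.2.trans hyc.2).le⟩ hx.2.ne
      positivity)
  have := hm (left_mem_Icc.mpr hyc.1.le) (right_mem_Icc.mpr hyc.1.le) hyc.1
  simp [R.eq_zero, h0, H.deriv_zero] at this

/-- `φ₁ - 1` vanishes to second order at `yc`, by integrating the bound
`|(u - c)² φ₁'| ≤ C |y - yc|³`. This is what makes `II₃` converge. -/
theorem exists_abs_quotient_sub_one_le (R : RegularJet U α yc Φ Φ' Φ'') (H : ProfileJet U)
    (hyc : yc ∈ Ioo (0 : ℝ) 1) :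
    ∃ C, 0 ≤ C ∧ ∀ y ∈ Icc (0 : ℝ) 1, |quotientBySpeed U yc Φ y - 1| ≤ C * |y - yc| ^ 2 := by
  obtain ⟨m, M, hm, hM, hb⟩ := H.exists_abs_sub_bounds hyc
  obtain ⟨B, hB⟩ := isCompact_Icc.exists_bound_of_continuousOn (R.quotient_continuousOn H hyc)
  have hB0 : 0 ≤ B := (norm_nonneg _).trans (hB 0 ⟨le_rfl, zero_le_one⟩)
  have hyc' : yc ∈ Icc (0 : ℝ) 1 := ⟨hyc.1.le, hyc.2.le⟩
  have hW := abs_sub_le_of_abs_deriv_le (k := 2) (C := α ^ 2 * M ^ 2 * B) hyc' (by positivity)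
    (f := fun y => Φ' y * (U 0 y - U 0 yc) - Φ y * U 1 y)
    (f' := fun y => α ^ 2 * (U 0 y - U 0 yc) * Φ y)
    (fun y hy => (R.wronskian_hasDerivAt H hy).continuousAt.continuousWithinAt)
    (fun y hy _ => R.wronskian_hasDerivAt H (Ioo_subset_Icc_self hy))
    (fun y hy _ => by
      rw [R.eq_mul_quotient H hyc hy, abs_mul, abs_mul, abs_mul, abs_of_nonneg (sq_nonneg α)]
      have h1 := (hb y hy).2
      have h2 := hB y hy
      rw [Real.norm_eq_abs] at h2
      calc α ^ 2 * |U 0 y - U 0 yc| * (|U 0 y - U 0 yc| * |quotientBySpeed U yc Φ y|)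
          ≤ α ^ 2 * (M * |y - yc|) * ((M * |y - yc|) * B) := by gcongr
        _ = α ^ 2 * M ^ 2 * B * |y - yc| ^ 2 := by ring)
  simp only [R.eq_zero, sub_self, mul_zero, zero_mul, sub_zero] at hW
  have hq := abs_sub_le_of_abs_deriv_le (k := 1) (C := α ^ 2 * M ^ 2 * B / m ^ 2) hyc'
    (by positivity) (R.quotient_continuousOn H hyc)
    (fun y hy h => R.quotient_hasDerivAt H hyc hy h)
    (fun y hy h => by
      have hpos : 0 < |y - yc| := abs_pos.mpr (sub_ne_zero.mpr h)
      rw [abs_div, abs_pow, div_le_iff₀ (by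
        have := abs_pos.mpr (H.speed_sub_ne_zero hyc hy h); positivity)]
      have h1 := (hb y hy).1
      calc _ ≤ _ := hW y hy
        _ = α ^ 2 * M ^ 2 * B / m ^ 2 * |y - yc| ^ 1 * (m * |y - yc|) ^ 2 := by
          field_simp
        _ ≤ _ := by gcongr)
  rw [R.quotient_same H hyc] at hq
  exact ⟨_, by positivity, hq⟩

end RegularJet

/-! ### Antiderivatives of the singular kernels -/

/-- Differentiation under the integral sign over a compact interval, with a continuous derivative.
-/
theorem hasDerivAt_intervalIntegral_of_continuousOn {f f' : ℝ → ℝ → ℝ} {a b c η : ℝ} (hab : a ≤ b)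
    (hη : 0 < η) (hf : ∀ x ∈ Icc (c - η) (c + η), ContinuousOn (f x) (Icc a b))
    (hf' : ContinuousOn (Function.uncurry f') (Icc (c - η) (c + η) ×ˢ Icc a b))
    (hd : ∀ x ∈ Icc (c - η) (c + η), ∀ t ∈ Icc a b, HasDerivAt (fun x => f x t) (f' x t) x) :
    HasDerivAt (fun x => ∫ t in a..b, f x t) (∫ t in a..b, f' c t) c := by
  have hs : Icc (c - η) (c + η) ∈ 𝓝 c := Icc_mem_nhds (by linarith) (by linarith)
  have hc : c ∈ Icc (c - η) (c + η) := mem_of_mem_nhds hs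
  obtain ⟨B, hB⟩ := (isCompact_Icc.prod isCompact_Icc).exists_bound_of_continuousOn hf'
  have hsub : uIoc a b ⊆ Icc a b := by rw [uIoc_of_le hab]; exact Ioc_subset_Icc_self
  refine (intervalIntegral.hasDerivAt_integral_of_dominated_loc_of_deriv_le
    (F := f) (F' := f') (bound := fun _ => B) hs ?_ ?_ ?_ ?_ ?_ ?_).2
  · filter_upwards [hs] with x hx
    exact ((hf x hx).mono hsub).aestronglyMeasurable measurableSet_uIoc
  · exact ContinuousOn.intervalIntegrable_of_Icc hab (hf c hc)
  · refine ContinuousOn.aestronglyMeasurable ?_ measurableSet_uIoc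
    exact hf'.comp (f := fun t => (c, t)) (by fun_prop) (fun t ht => ⟨hc, hsub ht⟩)
  · exact Eventually.of_forall fun t ht x hx => hB (x, t) ⟨hx, hsub ht⟩
  · exact intervalIntegrable_const
  · exact Eventually.of_forall fun t ht x hx => hd x hx t (hsub ht)

/-- The primitive `x log x - x` of the logarithm, continuous at `0`. -/
noncomputable def logPrimitive (x : ℝ) : ℝ := x * Real.log x - x

/-- The primitive of `logPrimitive`; it is differentiable at `0` as well. The product
`x * (x * log x)` is bracketed so that the continuity of `x * log x` applies. -/
noncomputable def logPrimitive₂ (x : ℝ) : ℝ := x * (x * Real.log x) / 2 - 3 * x ^ 2 / 4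

theorem continuous_logPrimitive : Continuous logPrimitive :=
  Real.continuous_mul_log.sub continuous_id

theorem continuous_logPrimitive₂ : Continuous logPrimitive₂ :=
  ((continuous_id.mul Real.continuous_mul_log).div_const 2).sub (by fun_prop)

theorem hasDerivAt_logPrimitive {x : ℝ} (hx : x ≠ 0) :
    HasDerivAt logPrimitive (Real.log x) x := by
  refine (((hasDerivAt_id x).fun_mul (Real.hasDerivAt_log hx)).fun_sub
    (hasDerivAt_id x)).congr_deriv ?_
  simp [hx]

theorem hasDerivAt_logPrimitive₂ (x : ℝ) : HasDerivAt logPrimitive₂ (logPrimitive x) x := by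
  rcases eq_or_ne x 0 with rfl | hx
  · have h1 : HasDerivAt (fun x : ℝ => x * (x * Real.log x)) 0 0 := by
      rw [hasDerivAt_iff_tendsto_slope]
      have hc := (Real.continuous_mul_log.tendsto 0).mono_left
        (nhdsWithin_le_nhds (s := {(0 : ℝ)}ᶜ))
      simp only [zero_mul] at hc
      refine hc.congr' ?_
      filter_upwards [self_mem_nhdsWithin] with y hy
      have hy' : y ≠ 0 := hy
      simp [slope_def_field, hy']
    have h2 : HasDerivAt (fun x : ℝ => 3 * x ^ 2 / 4) 0 0 := by
      simpa using (((hasDerivAt_id (0 : ℝ)).fun_pow 2).const_mul 3).div_const 4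
    exact ((h1.div_const 2).fun_sub h2).congr_deriv (by simp [logPrimitive])
  · refine ((((hasDerivAt_id x).fun_mul ((hasDerivAt_id x).fun_mul
      (Real.hasDerivAt_log hx))).div_const 2).fun_sub
      ((((hasDerivAt_id x).fun_pow 2).const_mul 3).div_const 4)).congr_deriv ?_
    simp only [id, logPrimitive]
    field_simp
    push_cast
    ring

/-- The coefficient `u'' / u'³ = -(1 / u')' / u'` left by the first integration by parts of
`1 / (u - c)`. -/
noncomputable def logCoeff₁ (U : ℕ → ℝ → ℝ) (y : ℝ) : ℝ := U 2 y / U 1 y ^ 3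

/-- The coefficient `logCoeff₁' / u'` left by the second integration by parts. -/
noncomputable def logCoeff₂ (U : ℕ → ℝ → ℝ) (y : ℝ) : ℝ :=
  U 3 y / U 1 y ^ 4 - 3 * U 2 y ^ 2 / U 1 y ^ 5

/-- The derivative of `logCoeff₂`, the coefficient of the remaining integral after the third
integration by parts. -/
noncomputable def logCoeff₃ (U : ℕ → ℝ → ℝ) (y : ℝ) : ℝ :=
  U 4 y / U 1 y ^ 4 - 10 * U 2 y * U 3 y / U 1 y ^ 5 + 15 * U 2 y ^ 3 / U 1 y ^ 6

/-- An antiderivative of `1 / (u - c)`, obtained by integrating by parts three times with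
`log (u - c)` and its successive primitives. The coefficients do not involve `c`, and the remaining
integral has an integrand that is differentiable in `c` even at `u = c`. The base point `δ > 0`
keeps away from the zero of `u'` at the centre. -/
noncomputable def recipPrimitive (U : ℕ → ℝ → ℝ) (δ c y : ℝ) : ℝ :=
  Real.log (U 0 y - c) / U 1 y + logCoeff₁ U y * logPrimitive (U 0 y - c)
    - logCoeff₂ U y * logPrimitive₂ (U 0 y - c)
    + ∫ t in δ..y, logCoeff₃ U t * logPrimitive₂ (U 0 t - c)

/-- The derivative of `recipPrimitive` with respect to `c`, which is an antiderivative of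
`1 / (u - c)²`. -/
noncomputable def recipSqPrimitive (U : ℕ → ℝ → ℝ) (δ c y : ℝ) : ℝ :=
  -(1 / ((U 0 y - c) * U 1 y)) - logCoeff₁ U y * Real.log (U 0 y - c)
    + logCoeff₂ U y * logPrimitive (U 0 y - c)
    - ∫ t in δ..y, logCoeff₃ U t * logPrimitive (U 0 t - c)

namespace ProfileJet

variable {U : ℕ → ℝ → ℝ}

theorem hasDerivAt_recip (H : ProfileJet U) {y : ℝ} (hy : U 1 y ≠ 0) :
    HasDerivAt (fun y => 1 / U 1 y) (-(U 2 y / U 1 y ^ 2)) y := by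
  refine ((hasDerivAt_const y (1 : ℝ)).fun_div (H.hasDerivAt 1 (by norm_num) y) hy).congr_deriv ?_
  ring

theorem hasDerivAt_logCoeff₁ (H : ProfileJet U) {y : ℝ} (hy : U 1 y ≠ 0) :
    HasDerivAt (logCoeff₁ U) (U 1 y * logCoeff₂ U y) y := by
  have h1 := H.hasDerivAt 1 (by norm_num) y
  refine ((H.hasDerivAt 2 (by norm_num) y).fun_div (h1.fun_pow 3) (pow_ne_zero 3 hy)).congr_deriv ?_
  simp only [logCoeff₂]
  field_simp
  push_cast
  ring

theorem hasDerivAt_logCoeff₂ (H : ProfileJet U) {y : ℝ} (hy : U 1 y ≠ 0) :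
    HasDerivAt (logCoeff₂ U) (logCoeff₃ U y) y := by
  have h1 := H.hasDerivAt 1 (by norm_num) y
  have h2 := H.hasDerivAt 2 (by norm_num) y
  refine (((H.hasDerivAt 3 (by norm_num) y).fun_div (h1.fun_pow 4) (pow_ne_zero 4 hy)).fun_sub
    (((h2.fun_pow 2).const_mul 3).fun_div (h1.fun_pow 5) (pow_ne_zero 5 hy))).congr_deriv ?_
  simp only [logCoeff₃]
  field_simp
  push_cast
  ring

theorem continuousOn_logCoeff₃ (H : ProfileJet U) : ContinuousOn (logCoeff₃ U) (Ioc 0 1) := by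
  have h1 := H.continuous (k := 1) (by norm_num)
  have h2 := H.continuous (k := 2) (by norm_num)
  have h3 := H.continuous (k := 3) (by norm_num)
  have h4 := H.continuous (k := 4) (by norm_num)
  have hne : ∀ y ∈ Ioc (0 : ℝ) 1, U 1 y ≠ 0 := fun y hy => (H.deriv_pos y hy).ne'
  have hp : ∀ {f : ℝ → ℝ}, Continuous f → ∀ n : ℕ,
      ContinuousOn (fun y => f y / U 1 y ^ n) (Ioc 0 1) := fun hf n =>
    hf.continuousOn.div (h1.pow n).continuousOn fun y hy => pow_ne_zero n (hne y hy)
  exact ((hp h4 4).sub (hp (by fun_prop) 5)).add (hp (by fun_prop) 6)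

theorem continuousOn_logCoeff₃_mul (H : ProfileJet U) {g : ℝ → ℝ} (hg : Continuous g) (c : ℝ) :
    ContinuousOn (fun t => logCoeff₃ U t * g (U 0 t - c)) (Ioc 0 1) :=
  H.continuousOn_logCoeff₃.mul
    (hg.comp ((H.continuous (k := 0) (by norm_num)).sub continuous_const)).continuousOn

theorem hasDerivAt_logCoeff₃_integral (H : ProfileJet U) {g : ℝ → ℝ} (hg : Continuous g) (c : ℝ)
    {δ y : ℝ} (hδ : δ ∈ Ioo (0 : ℝ) 1) (hy : y ∈ Ioo (0 : ℝ) 1) :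
    HasDerivAt (fun y => ∫ t in δ..y, logCoeff₃ U t * g (U 0 t - c))
      (logCoeff₃ U y * g (U 0 y - c)) y := by
  have h := H.continuousOn_logCoeff₃_mul hg c
  have hsub : uIcc δ y ⊆ Ioc 0 1 := (ordConnected_Ioc.uIcc_subset
    (Ioo_subset_Ioc_self hδ) (Ioo_subset_Ioc_self hy))
  have hI : ContinuousOn (fun t => logCoeff₃ U t * g (U 0 t - c)) (Ioo 0 1) :=
    h.mono Ioo_subset_Ioc_self
  exact intervalIntegral.integral_hasDerivAt_right (h.mono hsub).intervalIntegrable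
    (hI.stronglyMeasurableAtFilter isOpen_Ioo y hy) (hI.continuousAt (Ioo_mem_nhds hy.1 hy.2))

theorem continuousOn_logCoeff₃_integral (H : ProfileJet U) {g : ℝ → ℝ} (hg : Continuous g) (c : ℝ)
    {δ : ℝ} (hδ : δ ∈ Ioo (0 : ℝ) 1) :
    ContinuousOn (fun y => ∫ t in δ..y, logCoeff₃ U t * g (U 0 t - c)) (Icc δ 1) := by
  have h := (H.continuousOn_logCoeff₃_mul hg c).mono
    (fun y (hy : y ∈ Icc δ 1) => (⟨hδ.1.trans_le hy.1, hy.2⟩ : y ∈ Ioc (0 : ℝ) 1))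
  have := intervalIntegral.continuousOn_primitive_interval (a := δ) (b := 1) (μ := volume)
    (f := fun t => logCoeff₃ U t * g (U 0 t - c))
    (by rw [uIcc_of_le hδ.2.le]; exact h.integrableOn_compact isCompact_Icc)
  rwa [uIcc_of_le hδ.2.le] at this

theorem hasDerivAt_recipPrimitive (H : ProfileJet U) {c δ y : ℝ} (hδ : δ ∈ Ioo (0 : ℝ) 1)
    (hy : y ∈ Ioo (0 : ℝ) 1) (h : U 0 y - c ≠ 0) :
    HasDerivAt (recipPrimitive U δ c) (1 / (U 0 y - c)) y := by
  have h1 : U 1 y ≠ 0 := (H.deriv_pos y (Ioo_subset_Ioc_self hy)).ne'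
  have h0 := (H.hasDerivAt 0 (by norm_num) y).sub_const c
  have e1 := (h0.log h).fun_div (H.hasDerivAt 1 (by norm_num) y) h1
  have e2 := (H.hasDerivAt_logCoeff₁ h1).fun_mul ((hasDerivAt_logPrimitive h).comp y h0)
  have e3 := (H.hasDerivAt_logCoeff₂ h1).fun_mul ((hasDerivAt_logPrimitive₂ (U 0 y - c)).comp y h0)
  have e4 := H.hasDerivAt_logCoeff₃_integral continuous_logPrimitive₂ c hδ hy
  refine (((e1.fun_add e2).fun_sub e3).fun_add e4).congr_deriv ?_
  simp only [Function.comp, logCoeff₁, zero_add, one_add_one_eq_two]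
  field_simp
  ring

theorem hasDerivAt_recipSqPrimitive (H : ProfileJet U) {c δ y : ℝ} (hδ : δ ∈ Ioo (0 : ℝ) 1)
    (hy : y ∈ Ioo (0 : ℝ) 1) (h : U 0 y - c ≠ 0) :
    HasDerivAt (recipSqPrimitive U δ c) (1 / (U 0 y - c) ^ 2) y := by
  have h1 : U 1 y ≠ 0 := (H.deriv_pos y (Ioo_subset_Ioc_self hy)).ne'
  have h0 := (H.hasDerivAt 0 (by norm_num) y).sub_const c
  have e1 := ((hasDerivAt_const y (1 : ℝ)).fun_div
    (h0.fun_mul (H.hasDerivAt 1 (by norm_num) y)) (mul_ne_zero h h1)).fun_neg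
  have e2 := (H.hasDerivAt_logCoeff₁ h1).fun_mul (h0.log h)
  have e3 := (H.hasDerivAt_logCoeff₂ h1).fun_mul ((hasDerivAt_logPrimitive h).comp y h0)
  have e4 := H.hasDerivAt_logCoeff₃_integral continuous_logPrimitive c hδ hy
  refine (((e1.fun_sub e2).fun_add e3).fun_sub e4).congr_deriv ?_
  simp only [Function.comp, logCoeff₁, zero_add, one_add_one_eq_two]
  field_simp
  ring

theorem continuousOn_logCoeff₁ (H : ProfileJet U) : ContinuousOn (logCoeff₁ U) (Ioc 0 1) :=
  fun y hy => (H.hasDerivAt_logCoeff₁ (H.deriv_pos y hy).ne').continuousAt.continuousWithinAt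

theorem continuousOn_logCoeff₂ (H : ProfileJet U) : ContinuousOn (logCoeff₂ U) (Ioc 0 1) :=
  fun y hy => (H.hasDerivAt_logCoeff₂ (H.deriv_pos y hy).ne').continuousAt.continuousWithinAt

theorem continuousOn_recipPrimitive (H : ProfileJet U) {c δ : ℝ} (hδ : δ ∈ Ioo (0 : ℝ) 1) :
    ContinuousOn (recipPrimitive U δ c) (Icc δ 1 ∩ {y | U 0 y ≠ c}) := by
  have hs : Icc δ 1 ∩ {y | U 0 y ≠ c} ⊆ Ioc 0 1 := fun y hy => ⟨hδ.1.trans_le hy.1.1, hy.1.2⟩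
  have h0 : ContinuousOn (fun y => U 0 y - c) (Icc δ 1 ∩ {y | U 0 y ≠ c}) :=
    ((H.continuous (k := 0) (by norm_num)).sub continuous_const).continuousOn
  have h1 := (H.continuous (k := 1) (by norm_num)).continuousOn (s := Icc δ 1 ∩ {y | U 0 y ≠ c})
  refine ((((h0.log fun y hy => sub_ne_zero.mpr hy.2).div h1
    fun y hy => (H.deriv_pos y (hs hy)).ne').add ((H.continuousOn_logCoeff₁.mono hs).mul
      (continuous_logPrimitive.comp_continuousOn h0))).sub ((H.continuousOn_logCoeff₂.mono hs).mul
      (continuous_logPrimitive₂.comp_continuousOn h0))).add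
      ((H.continuousOn_logCoeff₃_integral continuous_logPrimitive₂ c hδ).mono inter_subset_left)

theorem continuousOn_recipSqPrimitive (H : ProfileJet U) {c δ : ℝ} (hδ : δ ∈ Ioo (0 : ℝ) 1) :
    ContinuousOn (recipSqPrimitive U δ c) (Icc δ 1 ∩ {y | U 0 y ≠ c}) := by
  have hs : Icc δ 1 ∩ {y | U 0 y ≠ c} ⊆ Ioc 0 1 := fun y hy => ⟨hδ.1.trans_le hy.1.1, hy.1.2⟩
  have h0 : ContinuousOn (fun y => U 0 y - c) (Icc δ 1 ∩ {y | U 0 y ≠ c}) :=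
    ((H.continuous (k := 0) (by norm_num)).sub continuous_const).continuousOn
  have h1 := (H.continuous (k := 1) (by norm_num)).continuousOn (s := Icc δ 1 ∩ {y | U 0 y ≠ c})
  refine (((continuousOn_const.div (h0.mul h1) fun y hy => mul_ne_zero (sub_ne_zero.mpr hy.2)
    (H.deriv_pos y (hs hy)).ne').neg.sub ((H.continuousOn_logCoeff₁.mono hs).mul
      (h0.log fun y hy => sub_ne_zero.mpr hy.2))).add ((H.continuousOn_logCoeff₂.mono hs).mul
      (continuous_logPrimitive.comp_continuousOn h0))).sub
      ((H.continuousOn_logCoeff₃_integral continuous_logPrimitive c hδ).mono inter_subset_left)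

theorem hasDerivAt_recipPrimitive_param (H : ProfileJet U) {c δ y : ℝ} (hδ : δ ∈ Ioo (0 : ℝ) 1)
    (hy : y ∈ Icc δ 1) (h : U 0 y - c ≠ 0) :
    HasDerivAt (fun c => recipPrimitive U δ c y) (recipSqPrimitive U δ c y) c := by
  have hy0 : y ∈ Ioc (0 : ℝ) 1 := ⟨hδ.1.trans_le hy.1, hy.2⟩
  have h1 : U 1 y ≠ 0 := (H.deriv_pos y hy0).ne'
  have h0 := (hasDerivAt_id c).const_sub (U 0 y)
  have hU := H.continuous (k := 0) (by norm_num)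
  have hsub : Icc δ y ⊆ Ioc 0 1 := fun t ht => ⟨hδ.1.trans_le ht.1, ht.2.trans hy.2⟩
  have e1 := (h0.log h).div_const (U 1 y)
  have e2 := ((hasDerivAt_logPrimitive h).comp c h0).const_mul (logCoeff₁ U y)
  have e3 := ((hasDerivAt_logPrimitive₂ (U 0 y - c)).comp c h0).const_mul (logCoeff₂ U y)
  have e4 := hasDerivAt_intervalIntegral_of_continuousOn (c := c) hy.1 one_pos
    (f := fun c t => logCoeff₃ U t * logPrimitive₂ (U 0 t - c))
    (f' := fun c t => logCoeff₃ U t * (logPrimitive (U 0 t - c) * -1))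
    (fun x _ => (H.continuousOn_logCoeff₃_mul continuous_logPrimitive₂ x).mono hsub)
    (by
      refine ContinuousOn.mul ?_ ?_
      · exact H.continuousOn_logCoeff₃.comp continuousOn_snd fun p hp => hsub hp.2
      · exact ((continuous_logPrimitive.comp ((hU.comp continuous_snd).sub
          continuous_fst)).mul continuous_const).continuousOn)
    (fun x _ t _ => ((hasDerivAt_logPrimitive₂ (U 0 t - x)).comp x
      ((hasDerivAt_id x).const_sub (U 0 t))).const_mul _)
  refine (((e1.fun_add e2).fun_sub e3).fun_add e4).congr_deriv ?_
  simp only [recipSqPrimitive, id]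
  have e5 : ∫ t in δ..y, logCoeff₃ U t * (logPrimitive (U 0 t - c) * -1) =
      -∫ t in δ..y, logCoeff₃ U t * logPrimitive (U 0 t - c) := by
    rw [← intervalIntegral.integral_neg]
    congr 1; ext t; ring
  rw [e5]
  field_simp
  ring

end ProfileJet

/-! ### The principal value and its derivative -/

theorem continuousAt_sub_mul_log (p : ℝ) :
    ContinuousAt (fun y : ℝ => (y - p) * Real.log (y - p)) p :=
  (Real.continuous_mul_log.comp (continuous_sub_right p)).continuousAt

theorem eventually_mem_Ioo_ne {yc : ℝ} (hyc : yc ∈ Ioo (0 : ℝ) 1) :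
    ∀ᶠ y in 𝓝[≠] yc, y ∈ Ioo (0 : ℝ) 1 ∧ y ≠ yc :=
  inter_mem (mem_nhdsWithin_of_mem_nhds (Ioo_mem_nhds hyc.1 hyc.2)) self_mem_nhdsWithin

namespace ProfileJet

variable {U : ℕ → ℝ → ℝ} {yc δ : ℝ}

theorem log_speed_sub (H : ProfileJet U) (hyc : yc ∈ Ioo (0 : ℝ) 1) {y : ℝ}
    (hy : y ∈ Icc (0 : ℝ) 1) (h : y ≠ yc) :
    Real.log (U 0 y - U 0 yc) = Real.log (y - yc) + Real.log (dslope (U 0) yc y) := by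
  rw [sub_eq_mul_dslope, Real.log_mul (sub_ne_zero.mpr h) (H.dslope_pos hyc hy).ne']

theorem continuousAt_speed_comp (H : ProfileJet U) {g : ℝ → ℝ} (hg : Continuous g) (c y : ℝ) :
    ContinuousAt (fun y => g (U 0 y - c)) y :=
  (hg.comp ((H.continuous (k := 0) (by norm_num)).sub continuous_const)).continuousAt

theorem continuousAt_logCoeff₁ (H : ProfileJet U) (hyc : yc ∈ Ioo (0 : ℝ) 1) :
    ContinuousAt (logCoeff₁ U) yc :=
  H.continuousOn_logCoeff₁.continuousAt (Ioc_mem_nhds hyc.1 hyc.2)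

theorem continuousAt_logCoeff₂ (H : ProfileJet U) (hyc : yc ∈ Ioo (0 : ℝ) 1) :
    ContinuousAt (logCoeff₂ U) yc :=
  H.continuousOn_logCoeff₂.continuousAt (Ioc_mem_nhds hyc.1 hyc.2)

theorem continuousAt_dslope_recip (H : ProfileJet U) (hyc : yc ∈ Ioo (0 : ℝ) 1) :
    ContinuousAt (dslope (fun y => 1 / U 1 y) yc) yc :=
  continuousAt_dslope_same.mpr
    (H.hasDerivAt_recip (H.deriv_pos yc (Ioo_subset_Ioc_self hyc)).ne').differentiableAt

theorem continuousAt_log_dslope (H : ProfileJet U) (hyc : yc ∈ Ioo (0 : ℝ) 1) :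
    ContinuousAt (fun y => Real.log (dslope (U 0) yc y)) yc :=
  (H.continuous_dslope (by norm_num) yc).continuousAt.log
    (H.dslope_pos hyc (Ioo_subset_Icc_self hyc)).ne'

/-- At `yc` the antiderivative of `1 / (u - c)` has only the even singularity
`log |y - yc| / u'(yc)`, which cancels in a symmetric principal value. -/
theorem exists_tendsto_recipPrimitive (H : ProfileJet U) (hδ : δ ∈ Ioo (0 : ℝ) 1)
    (hyc : yc ∈ Ioo (0 : ℝ) 1) :
    ∃ l, Tendsto (fun y => recipPrimitive U δ (U 0 yc) y - Real.log (y - yc) / U 1 yc)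
      (𝓝[≠] yc) (𝓝 l) := by
  have h1 : U 1 yc ≠ 0 := (H.deriv_pos yc (Ioo_subset_Ioc_self hyc)).ne'
  have hc := (((((continuousAt_sub_mul_log yc).mul (H.continuousAt_dslope_recip hyc)).add
    ((H.continuousAt_log_dslope hyc).div (H.continuous (by norm_num : 1 ≤ 4)).continuousAt h1)).add
    ((H.continuousAt_logCoeff₁ hyc).mul
      (H.continuousAt_speed_comp continuous_logPrimitive (U 0 yc) yc))).sub
    ((H.continuousAt_logCoeff₂ hyc).mul
      (H.continuousAt_speed_comp continuous_logPrimitive₂ (U 0 yc) yc))).add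
    (H.hasDerivAt_logCoeff₃_integral continuous_logPrimitive₂ (U 0 yc) hδ hyc).continuousAt
  refine ⟨_, (hc.tendsto.mono_left nhdsWithin_le_nhds).congr' ?_⟩
  filter_upwards [eventually_mem_Ioo_ne hyc] with y hy
  have hr : (y - yc) * dslope (fun y => 1 / U 1 y) yc y = 1 / U 1 y - 1 / U 1 yc :=
    (sub_eq_mul_dslope _ yc y).symm
  simp only [recipPrimitive, Pi.add_apply, Pi.sub_apply, Pi.mul_apply, Pi.div_apply,
    H.log_speed_sub hyc (Ioo_subset_Icc_self hy.1) hy.2]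
  linear_combination Real.log (y - yc) * hr

theorem tendsto_speed_mul_recipSqPrimitive (H : ProfileJet U) (hδ : δ ∈ Ioo (0 : ℝ) 1)
    (hyc : yc ∈ Ioo (0 : ℝ) 1) :
    Tendsto (fun y => (U 0 y - U 0 yc) * recipSqPrimitive U δ (U 0 yc) y)
      (𝓝[≠] yc) (𝓝 (-(1 / U 1 yc))) := by
  have h1 : U 1 yc ≠ 0 := (H.deriv_pos yc (Ioo_subset_Ioc_self hyc)).ne'
  have hc := (((continuousAt_const (y := (1 : ℝ))).div (H.continuous
    (by norm_num : 1 ≤ 4)).continuousAt h1).neg.sub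
    ((H.continuousAt_logCoeff₁ hyc).mul
      (H.continuousAt_speed_comp Real.continuous_mul_log (U 0 yc) yc))).add
    ((H.continuousAt_speed_comp continuous_id (U 0 yc) yc).mul
    (((H.continuousAt_logCoeff₂ hyc).mul
      (H.continuousAt_speed_comp continuous_logPrimitive (U 0 yc) yc)).sub
    (H.hasDerivAt_logCoeff₃_integral continuous_logPrimitive (U 0 yc) hδ hyc).continuousAt))
  have ht := hc.tendsto.mono_left (nhdsWithin_le_nhds (s := {yc}ᶜ))
  simp only [Pi.add_apply, Pi.sub_apply, Pi.mul_apply, Pi.div_apply, Pi.neg_apply, sub_self,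
    zero_mul, mul_zero, sub_zero, add_zero, id] at ht
  refine ht.congr' ?_
  filter_upwards [eventually_mem_Ioo_ne hyc] with y hy
  have h0 := H.speed_sub_ne_zero hyc (Ioo_subset_Icc_self hy.1) hy.2
  have h2 : U 1 y ≠ 0 := (H.deriv_pos y (Ioo_subset_Ioc_self hy.1)).ne'
  simp only [recipSqPrimitive, Pi.add_apply, Pi.sub_apply, Pi.mul_apply, Pi.div_apply,
    Pi.neg_apply]
  field_simp
  ring

/-- When `u''(yc) = 0` the antiderivative of `1 / (u - c)²` has no logarithmic term at `yc`, only
the pole `-1 / ((u - c) u'(yc))`. -/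
theorem exists_tendsto_recipSqPrimitive (H : ProfileJet U) (hδ : δ ∈ Ioo (0 : ℝ) 1)
    (hyc : yc ∈ Ioo (0 : ℝ) 1) (h2 : U 2 yc = 0) :
    ∃ l, Tendsto (fun y => recipSqPrimitive U δ (U 0 yc) y + 1 / ((U 0 y - U 0 yc) * U 1 yc))
      (𝓝[≠] yc) (𝓝 l) := by
  have h1 : U 1 yc ≠ 0 := (H.deriv_pos yc (Ioo_subset_Ioc_self hyc)).ne'
  have hD := H.dslope_pos hyc (Ioo_subset_Icc_self hyc)
  have hm : ContinuousAt (dslope (logCoeff₁ U) yc) yc :=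
    continuousAt_dslope_same.mpr (H.hasDerivAt_logCoeff₁ h1).differentiableAt
  have hid : ContinuousAt (fun y => y - yc) yc := (continuous_sub_right yc).continuousAt
  have hc := (((((H.continuousAt_dslope_recip hyc).div
    (H.continuous_dslope (by norm_num : 0 < 4) yc).continuousAt hD.ne').neg).sub
    (hm.mul ((continuousAt_sub_mul_log yc).add (hid.mul (H.continuousAt_log_dslope hyc))))).add
    ((H.continuousAt_logCoeff₂ hyc).mul
      (H.continuousAt_speed_comp continuous_logPrimitive (U 0 yc) yc))).sub
    (H.hasDerivAt_logCoeff₃_integral continuous_logPrimitive (U 0 yc) hδ hyc).continuousAt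
  refine ⟨_, (hc.tendsto.mono_left nhdsWithin_le_nhds).congr' ?_⟩
  filter_upwards [eventually_mem_Ioo_ne hyc] with y hy
  have hy' := Ioo_subset_Icc_self hy.1
  have hr : 1 / U 1 y - 1 / U 1 yc = (y - yc) * dslope (fun y => 1 / U 1 y) yc y :=
    sub_eq_mul_dslope (fun y => 1 / U 1 y) yc y
  have hm' : logCoeff₁ U y = (y - yc) * dslope (logCoeff₁ U) yc y := by
    rw [← sub_eq_mul_dslope, logCoeff₁, logCoeff₁, h2]; simp
  have hDy := (H.dslope_pos hyc hy').ne'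
  have hyy := sub_ne_zero.mpr hy.2
  have hU1 : U 1 y ≠ 0 := (H.deriv_pos y (Ioo_subset_Ioc_self hy.1)).ne'
  have hr' : dslope (fun y => 1 / U 1 y) yc y = (1 / U 1 y - 1 / U 1 yc) / (y - yc) := by
    rw [hr]; field_simp
  simp only [recipSqPrimitive, Pi.add_apply, Pi.sub_apply, Pi.mul_apply, Pi.div_apply,
    Pi.neg_apply, hm', H.log_speed_sub hyc hy' hy.2, hr']
  rw [sub_eq_mul_dslope (U 0) yc y]
  field_simp
  ring

theorem critSet_eq (H : ProfileJet U) (hyc : yc ∈ Icc (0 : ℝ) 1) :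
    critSet (U 0) (U 0 yc) = {yc} := by
  ext y
  simp only [critSet, mem_ofPred_eq, mem_singleton_iff]
  exact ⟨fun h => H.injOn h.1 hyc h.2, by rintro rfl; exact ⟨hyc, rfl⟩⟩

end ProfileJet

theorem isCompact_pvDomain (a b : ℝ) (S : Set ℝ) (ε : ℝ) : IsCompact (pvDomain a b S ε) := by
  have : pvDomain a b S ε = Icc a b ∩ ⋂ s ∈ S, {y | ε ≤ |y - s|} := by
    ext y; simp [pvDomain]
  rw [this]
  refine isCompact_Icc.inter_right (isClosed_biInter fun s _ => ?_)
  exact isClosed_le continuous_const (by fun_prop)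

theorem pvDomain_singleton_eq (p ε : ℝ) :
    pvDomain 0 1 {p} ε = Icc 0 (min 1 (p - ε)) ∪ Icc (max 0 (p + ε)) 1 := by
  ext y
  simp only [pvDomain, mem_ofPred_eq, mem_singleton_iff, forall_eq, mem_union, mem_Icc, le_abs,
    le_min_iff, max_le_iff]
  constructor
  · rintro ⟨⟨h0, h1⟩, h | h⟩
    · right; exact ⟨⟨h0, by linarith⟩, h1⟩
    · left; exact ⟨h0, h1, by linarith⟩
  · rintro (⟨h0, h1, h⟩ | ⟨⟨h0, h⟩, h1⟩)
    · exact ⟨⟨h0, h1⟩, Or.inr (by linarith)⟩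
    · exact ⟨⟨h0, h1⟩, Or.inl (by linarith)⟩

theorem setIntegral_pvDomain_singleton {f : ℝ → ℝ} {p ε : ℝ} (hε : 0 < ε) (h0 : ε ≤ p)
    (h1 : p + ε ≤ 1) (hf : IntegrableOn f (pvDomain 0 1 {p} ε)) :
    ∫ y in pvDomain 0 1 {p} ε, f y = (∫ y in (0 : ℝ)..(p - ε), f y) + ∫ y in (p + ε)..1, f y := by
  rw [pvDomain_singleton_eq, min_eq_right (by linarith), max_eq_right (by linarith)] at *
  rw [setIntegral_union _ measurableSet_Icc (hf.mono_set subset_union_left)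
    (hf.mono_set subset_union_right), integral_Icc_eq_integral_Ioc, integral_Icc_eq_integral_Ioc,
    intervalIntegral.integral_of_le (by linarith), intervalIntegral.integral_of_le h1]
  exact Set.disjoint_left.mpr fun y hy hy' => by linarith [hy.2, hy'.1]

namespace ProfileJet

variable {U : ℕ → ℝ → ℝ} {yc δ : ℝ}

theorem integral_recip_eq (H : ProfileJet U) (hδ : δ ∈ Ioo (0 : ℝ) 1) {c a b : ℝ} (hab : a ≤ b)
    (ha : δ ≤ a) (hb : b ≤ 1) (hne : ∀ y ∈ Icc a b, U 0 y ≠ c) :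
    ∫ y in a..b, 1 / (U 0 y - c) = recipPrimitive U δ c b - recipPrimitive U δ c a := by
  have hU := H.continuous (k := 0) (by norm_num)
  refine intervalIntegral.integral_eq_sub_of_hasDerivAt_of_le hab
    ((H.continuousOn_recipPrimitive hδ).mono fun y hy =>
      ⟨⟨ha.trans hy.1, hy.2.trans hb⟩, hne y hy⟩)
    (fun y hy => H.hasDerivAt_recipPrimitive hδ
      ⟨hδ.1.trans_le (ha.trans hy.1.le), hy.2.trans_le hb⟩
      (sub_ne_zero.mpr (hne y (Ioo_subset_Icc_self hy)))) ?_
  refine ContinuousOn.intervalIntegrable_of_Icc hab ?_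
  exact continuousOn_const.div (hU.sub continuous_const).continuousOn
    fun y hy => sub_ne_zero.mpr (hne y hy)

theorem integral_recip_sq_eq (H : ProfileJet U) (hδ : δ ∈ Ioo (0 : ℝ) 1) {c a b : ℝ} (hab : a ≤ b)
    (ha : δ ≤ a) (hb : b ≤ 1) (hne : ∀ y ∈ Icc a b, U 0 y ≠ c) :
    ∫ y in a..b, 1 / (U 0 y - c) ^ 2 = recipSqPrimitive U δ c b - recipSqPrimitive U δ c a := by
  have hU := H.continuous (k := 0) (by norm_num)
  refine intervalIntegral.integral_eq_sub_of_hasDerivAt_of_le hab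
    ((H.continuousOn_recipSqPrimitive hδ).mono fun y hy =>
      ⟨⟨ha.trans hy.1, hy.2.trans hb⟩, hne y hy⟩)
    (fun y hy => H.hasDerivAt_recipSqPrimitive hδ
      ⟨hδ.1.trans_le (ha.trans hy.1.le), hy.2.trans_le hb⟩
      (sub_ne_zero.mpr (hne y (Ioo_subset_Icc_self hy)))) ?_
  refine ContinuousOn.intervalIntegrable_of_Icc hab ?_
  exact continuousOn_const.div ((hU.sub continuous_const).pow 2).continuousOn
    fun y hy => pow_ne_zero 2 (sub_ne_zero.mpr (hne y hy))

theorem speed_ne (H : ProfileJet U) (hyc : yc ∈ Ioo (0 : ℝ) 1) {y : ℝ} (hy : y ∈ Icc (0 : ℝ) 1)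
    (h : y ≠ yc) : U 0 y ≠ U 0 yc :=
  sub_ne_zero.mp (H.speed_sub_ne_zero hyc hy h)

theorem hasPV_recip (H : ProfileJet U) (hδ : 0 < δ) (hyc : yc ∈ Ioo δ 1) :
    HasPV (fun y => 1 / (U 0 y - U 0 yc)) 0 1 (critSet (U 0) (U 0 yc))
      ((∫ y in (0 : ℝ)..δ, 1 / (U 0 y - U 0 yc)) + (recipPrimitive U δ (U 0 yc) 1
        - recipPrimitive U δ (U 0 yc) δ)) := by
  have hyc0 : yc ∈ Ioo (0 : ℝ) 1 := ⟨hδ.trans hyc.1, hyc.2⟩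
  have hδ1 : δ ∈ Ioo (0 : ℝ) 1 := ⟨hδ, hyc.1.trans hyc.2⟩
  have hU := H.continuous (k := 0) (by norm_num)
  rw [H.critSet_eq (Ioo_subset_Icc_self hyc0)]
  have hint : ∀ ε : ℝ, 0 < ε → IntegrableOn (fun y => 1 / (U 0 y - U 0 yc))
      (pvDomain 0 1 {yc} ε) := fun ε hε => by
    refine ContinuousOn.integrableOn_compact (isCompact_pvDomain _ _ _ _) ?_
    refine continuousOn_const.div (hU.sub continuous_const).continuousOn fun y hy => ?_
    refine H.speed_sub_ne_zero hyc0 hy.1 fun h => ?_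
    have := hy.2 yc rfl
    rw [h, sub_self, abs_zero] at this
    exact hε.not_ge this
  refine ⟨hint, ?_⟩
  obtain ⟨l, hl⟩ := H.exists_tendsto_recipPrimitive hδ1 hyc0
  have hplus : Tendsto (fun ε : ℝ => yc + ε) (𝓝[>] 0) (𝓝[≠] yc) := by
    refine tendsto_nhdsWithin_iff.mpr ⟨?_, ?_⟩
    · have : ContinuousAt (fun ε : ℝ => yc + ε) 0 := by fun_prop
      simpa using this.tendsto.mono_left nhdsWithin_le_nhds
    · filter_upwards [self_mem_nhdsWithin] with ε hε
      have : 0 < ε := hε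
      simp [this.ne']
  have hminus : Tendsto (fun ε : ℝ => yc - ε) (𝓝[>] 0) (𝓝[≠] yc) := by
    refine tendsto_nhdsWithin_iff.mpr ⟨?_, ?_⟩
    · have : ContinuousAt (fun ε : ℝ => yc - ε) 0 := by fun_prop
      simpa using this.tendsto.mono_left nhdsWithin_le_nhds
    · filter_upwards [self_mem_nhdsWithin] with ε hε
      have : 0 < ε := hε
      simp [this.ne']
  have hdiff := (hl.comp hminus).sub (hl.comp hplus)
  rw [sub_self] at hdiff
  have hlim := hdiff.const_add ((∫ y in (0 : ℝ)..δ, 1 / (U 0 y - U 0 yc)) +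
    (recipPrimitive U δ (U 0 yc) 1 - recipPrimitive U δ (U 0 yc) δ))
  rw [add_zero] at hlim
  refine hlim.congr' ?_
  filter_upwards [Ioo_mem_nhdsGT (lt_min (sub_pos.mpr hyc.1) (sub_pos.mpr hyc.2))] with ε hε
  have he1 : ε < yc - δ := hε.2.trans_le (min_le_left _ _)
  have he2 : ε < 1 - yc := hε.2.trans_le (min_le_right _ _)
  have hε0 := hε.1
  rw [setIntegral_pvDomain_singleton hε0 (by linarith) (by linarith) (hint ε hε0),
    H.integral_recip_eq hδ1 (a := yc + ε) (b := 1) (by linarith) (by linarith) le_rfl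
      (fun y hy => H.speed_ne hyc0 ⟨by linarith [hy.1, hyc0.1], hy.2⟩ (by linarith [hy.1])),
    ← intervalIntegral.integral_add_adjacent_intervals (a := 0) (b := δ) (c := yc - ε),
    H.integral_recip_eq hδ1 (a := δ) (b := yc - ε) (by linarith) le_rfl (by linarith [hyc.2])
      (fun y hy => H.speed_ne hyc0 ⟨by linarith [hy.1], by linarith [hy.2, hyc.2]⟩
        (by linarith [hy.2]))]
  · simp only [Function.comp, add_sub_cancel_left, sub_sub_cancel_left, Real.log_neg_eq_log]
    ring
  · refine ContinuousOn.intervalIntegrable_of_Icc hδ.le ?_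
    exact continuousOn_const.div (hU.sub continuous_const).continuousOn fun y hy =>
      H.speed_sub_ne_zero hyc0 ⟨hy.1, hy.2.trans hδ1.2.le⟩ (by linarith [hy.2, hyc.1])
  · refine ContinuousOn.intervalIntegrable_of_Icc (by linarith) ?_
    exact continuousOn_const.div (hU.sub continuous_const).continuousOn fun y hy =>
      H.speed_sub_ne_zero hyc0 ⟨by linarith [hy.1], by linarith [hy.2, hyc.2]⟩
        (by linarith [hy.2])

theorem pvRecip_eq (H : ProfileJet U) (hδ : 0 < δ) (hyc : yc ∈ Ioo δ 1) :
    pvRecip (U 0) (U 0 yc) = (∫ y in (0 : ℝ)..δ, 1 / (U 0 y - U 0 yc)) +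
      (recipPrimitive U δ (U 0 yc) 1 - recipPrimitive U δ (U 0 yc) δ) :=
  (H.hasPV_recip hδ hyc).2.limUnder_eq

/-- The principal value is differentiable in `c`, with derivative the finite part of
`∫₀¹ 1 / (u - c)²`. -/
theorem hasDerivAt_pvRecip (H : ProfileJet U) (hδ : 0 < δ) (hyc : yc ∈ Ioo δ 1) :
    HasDerivAt (fun c => pvRecip (U 0) c) ((∫ y in (0 : ℝ)..δ, 1 / (U 0 y - U 0 yc) ^ 2) +
      (recipSqPrimitive U δ (U 0 yc) 1 - recipSqPrimitive U δ (U 0 yc) δ)) (U 0 yc) := by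
  have hyc0 : yc ∈ Ioo (0 : ℝ) 1 := ⟨hδ.trans hyc.1, hyc.2⟩
  have hδ1 : δ ∈ Ioo (0 : ℝ) 1 := ⟨hδ, hyc.1.trans hyc.2⟩
  have hU := H.continuous (k := 0) (by norm_num)
  have hlo : U 0 δ < U 0 yc :=
    H.strictMonoOn (Ioo_subset_Icc_self hδ1) (Ioo_subset_Icc_self hyc0) hyc.1
  have hhi : U 0 yc < U 0 1 :=
    H.strictMonoOn (Ioo_subset_Icc_self hyc0) ⟨zero_le_one, le_rfl⟩ hyc.2
  have hlt : ∀ x ∈ Icc (U 0 yc - (U 0 yc - U 0 δ) / 2) (U 0 yc + (U 0 yc - U 0 δ) / 2),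
      ∀ t ∈ Icc 0 δ, U 0 t - x ≠ 0 := fun x hx t ht => by
    have : U 0 t ≤ U 0 δ := H.strictMonoOn.monotoneOn ⟨ht.1, ht.2.trans hδ1.2.le⟩
      (Ioo_subset_Icc_self hδ1) ht.2
    have := hx.1
    apply ne_of_lt
    linarith
  have e1 := hasDerivAt_intervalIntegral_of_continuousOn (c := U 0 yc) hδ.le
    (η := (U 0 yc - U 0 δ) / 2) (by linarith)
    (f := fun c t => 1 / (U 0 t - c)) (f' := fun c t => 1 / (U 0 t - c) ^ 2)
    (fun x hx => continuousOn_const.div (hU.sub continuous_const).continuousOn (hlt x hx))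
    (continuousOn_const.div
      (((hU.comp continuous_snd).sub continuous_fst).pow 2).continuousOn
      (fun p hp => pow_ne_zero 2 (hlt p.1 hp.1 p.2 hp.2)))
    (fun x hx t ht => by
      refine ((hasDerivAt_const x (1 : ℝ)).fun_div ((hasDerivAt_id x).const_sub (U 0 t))
        (hlt x hx t ht)).congr_deriv ?_
      simp)
  have e2 := H.hasDerivAt_recipPrimitive_param (c := U 0 yc) hδ1 (y := 1) ⟨hδ1.2.le, le_rfl⟩
    (sub_pos.mpr hhi).ne'
  have e3 := H.hasDerivAt_recipPrimitive_param (c := U 0 yc) hδ1 (y := δ) ⟨le_rfl, hδ1.2.le⟩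
    (sub_neg.mpr hlo).ne
  refine (e1.fun_add (e2.fun_sub e3)).congr_of_eventuallyEq ?_
  filter_upwards [Ioo_mem_nhds hlo hhi] with c hc
  obtain ⟨p, hp, rfl⟩ := intermediate_value_Ioo hδ1.2.le hU.continuousOn hc
  exact H.pvRecip_eq hδ hp

end ProfileJet

/-! ### Solutions on the half channel and the connection formula -/

namespace ProfileJet

variable {U : ℕ → ℝ → ℝ} {yc : ℝ}

/-- A single function `h`, normalized by `h 0 = 0`, that is an antiderivative of `1 / (u - c)²` on
both sides of `yc` with matching regular parts there, and whose value at `1` is the `c`-derivative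
of the principal value. -/
theorem exists_recip_sq_primitive (H : ProfileJet U) (hyc : yc ∈ Ioo (0 : ℝ) 1) :
    ∃ h : ℝ → ℝ, h 0 = 0 ∧ h 1 = deriv (fun c => pvRecip (U 0) c) (U 0 yc) ∧
      (∀ y ∈ Icc (0 : ℝ) 1, y ≠ yc → HasDerivAt h (1 / (U 0 y - U 0 yc) ^ 2) y) ∧
      Tendsto (fun y => (U 0 y - U 0 yc) * h y) (𝓝[≠] yc) (𝓝 (-(1 / U 1 yc))) ∧
      (U 2 yc = 0 → ∃ l, Tendsto (fun y => h y + 1 / ((U 0 y - U 0 yc) * U 1 yc))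
        (𝓝[≠] yc) (𝓝 l)) := by
  set δ := yc / 2 with hδdef
  have hδ : 0 < δ := by have := hyc.1; positivity
  have hycδ : yc ∈ Ioo δ 1 := ⟨by linarith [hyc.1], hyc.2⟩
  have hδ1 : δ ∈ Ioo (0 : ℝ) 1 := ⟨hδ, hycδ.1.trans hyc.2⟩
  have hU := H.continuous (k := 0) (by norm_num)
  rw [(H.hasDerivAt_pvRecip hδ hycδ).deriv]
  set f : ℝ → ℝ := fun y => 1 / (U 0 y - U 0 yc) ^ 2 with hf
  set P := (∫ y in (0 : ℝ)..δ, f y) + (recipSqPrimitive U δ (U 0 yc) 1 -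
    recipSqPrimitive U δ (U 0 yc) δ) with hP
  set h : ℝ → ℝ := fun y => if y < yc then ∫ t in (0 : ℝ)..y, f t else P - ∫ t in y..1, f t with hh
  have hfm : Measurable f := by
    have := hU.measurable
    exact measurable_const.div ((this.sub_const _).pow_const 2)
  have hfc : ∀ y ∈ Icc (0 : ℝ) 1, y ≠ yc → ContinuousAt f y := fun y hy hne =>
    continuousAt_const.div ((hU.sub continuous_const).pow 2).continuousAt
      (pow_ne_zero 2 (H.speed_sub_ne_zero hyc hy hne))
  have hfi : ∀ a b : ℝ, a ≤ b → Icc a b ⊆ Icc 0 1 → yc ∉ Icc a b →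
      IntervalIntegrable f volume a b := fun a b hab hs hn =>
    ContinuousOn.intervalIntegrable_of_Icc hab fun y hy =>
      (hfc y (hs hy) fun e => hn (e ▸ hy)).continuousWithinAt
  -- On both sides of `yc` the function `h` is the same constant plus `recipSqPrimitive`.
  have hnear : ∀ᶠ y in 𝓝[≠] yc, h y = recipSqPrimitive U δ (U 0 yc) y +
      ((∫ t in (0 : ℝ)..δ, f t) - recipSqPrimitive U δ (U 0 yc) δ) := by
    filter_upwards [mem_nhdsWithin_of_mem_nhds (Ioo_mem_nhds hycδ.1 hycδ.2),
      self_mem_nhdsWithin] with y hy hne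
    rcases lt_or_gt_of_ne (show y ≠ yc from hne) with hlt | hgt
    · simp only [hh, if_pos hlt]
      rw [← intervalIntegral.integral_add_adjacent_intervals (b := δ)
        (hfi 0 δ hδ.le (Icc_subset_Icc le_rfl hδ1.2.le) fun e => by linarith [e.2, hycδ.1])
        (hfi δ y hy.1.le (Icc_subset_Icc hδ.le hy.2.le) fun e => by linarith [e.2]),
        H.integral_recip_sq_eq hδ1 hy.1.le le_rfl hy.2.le
        (fun t ht => H.speed_ne hyc ⟨hδ.le.trans ht.1, ht.2.trans hy.2.le⟩ (by linarith [ht.2]))]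
      ring
    · simp only [hh, if_neg hgt.not_gt]
      rw [H.integral_recip_sq_eq hδ1 hy.2.le hy.1.le le_rfl
        (fun t ht => H.speed_ne hyc ⟨by linarith [ht.1, hy.1], ht.2⟩ (by linarith [ht.1]))]
      ring
  refine ⟨h, by simp [hh, hyc.1], by simp [hh, hyc.2.le], fun y hy hne => ?_, ?_, fun h2 => ?_⟩
  · rcases lt_or_gt_of_ne hne with hlt | hgt
    · have hd := intervalIntegral.integral_hasDerivAt_right
        (hfi 0 y hy.1 (Icc_subset_Icc le_rfl hy.2) fun e => by linarith [e.2])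
        hfm.stronglyMeasurable.stronglyMeasurableAtFilter (hfc y hy hne)
      refine hd.congr_of_eventuallyEq ?_
      filter_upwards [Iio_mem_nhds hlt] with z hz
      simp only [hh, if_pos (show z < yc from hz)]
    · have hd := (intervalIntegral.integral_hasDerivAt_left
        (hfi y 1 hy.2 (Icc_subset_Icc hy.1 le_rfl) fun e => by linarith [e.1])
        hfm.stronglyMeasurable.stronglyMeasurableAtFilter (hfc y hy hne)).const_sub P
      rw [neg_neg] at hd
      refine hd.congr_of_eventuallyEq ?_
      filter_upwards [Ioi_mem_nhds hgt] with z hz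
      simp only [hh, if_neg (show yc < z from hz).not_gt]
  · have h0 : Tendsto (fun y => U 0 y - U 0 yc) (𝓝[≠] yc) (𝓝 0) := by
      have := (hU.sub (continuous_const (y := U 0 yc))).tendsto yc
      simp only [Pi.sub_apply, sub_self] at this
      exact this.mono_left nhdsWithin_le_nhds
    have ht := (H.tendsto_speed_mul_recipSqPrimitive hδ1 hyc).add (h0.mul_const
      ((∫ t in (0 : ℝ)..δ, f t) - recipSqPrimitive U δ (U 0 yc) δ))
    rw [zero_mul, add_zero] at ht
    refine ht.congr' ?_
    filter_upwards [hnear] with y hy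
    rw [hy]; ring
  · obtain ⟨l, hl⟩ := H.exists_tendsto_recipSqPrimitive hδ1 hyc h2
    refine ⟨_, (hl.add_const
      ((∫ t in (0 : ℝ)..δ, f t) - recipSqPrimitive U δ (U 0 yc) δ)).congr' ?_⟩
    filter_upwards [hnear] with y hy
    rw [hy]; ring

end ProfileJet

namespace RegularJet

variable {U : ℕ → ℝ → ℝ} {α yc : ℝ} {Φ Φ' Φ'' : ℝ → ℝ}

theorem integrandII3_measurable (R : RegularJet U α yc Φ Φ' Φ'') (H : ProfileJet U) :
    Measurable (integrandII3 (U 0) (U 0 yc) Φ) := by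
  have hU := (H.continuous (k := 0) (by norm_num)).measurable.sub_const (U 0 yc)
  exact (measurable_const.div (hU.pow_const 2)).mul
    ((measurable_const.div ((R.continuous.measurable.div hU).pow_const 2)).sub_const 1)

/-- `II₃` converges: its integrand is bounded, since `1 / φ₁² - 1 = O((y - yc)²)`. -/
theorem integrandII3_integrable (R : RegularJet U α yc Φ Φ' Φ'') (H : ProfileJet U)
    (hyc : yc ∈ Ioo (0 : ℝ) 1) :
    IntervalIntegrable (integrandII3 (U 0) (U 0 yc) Φ) volume 0 1 := by
  obtain ⟨m, M, hm, hM, hb⟩ := H.exists_abs_sub_bounds hyc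
  obtain ⟨B, hB⟩ := isCompact_Icc.exists_bound_of_continuousOn (R.quotient_continuousOn H hyc)
  obtain ⟨C, hC, hq⟩ := R.exists_abs_quotient_sub_one_le H hyc
  have hB0 : 0 ≤ B := (norm_nonneg _).trans (hB 0 ⟨le_rfl, zero_le_one⟩)
  rw [intervalIntegrable_iff_integrableOn_Ioc_of_le zero_le_one]
  -- The bounds: `|q - 1| ≤ C (y - yc)²`, `|q + 1| ≤ B + 1`, `q² ≥ 1`, `|u - c| ≥ m |y - yc|`.
  refine Measure.integrableOn_of_bounded (M := C * (B + 1) / m ^ 2) (by simp)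
    (R.integrandII3_measurable H).aestronglyMeasurable ?_
  filter_upwards [ae_restrict_mem measurableSet_Ioc] with y hy
  have hy' := Ioc_subset_Icc_self hy
  rcases eq_or_ne y yc with rfl | hne
  · simp only [integrandII3, sub_self]
    norm_num
    positivity
  have hs := H.speed_sub_ne_zero hyc hy' hne
  have hone := R.one_le_quotient_sq H hyc hy'
  have hphi : phi1 (U 0) (U 0 yc) Φ y = quotientBySpeed U yc Φ y :=
    (R.quotient_eq_div H hyc hy' hne).symm
  rw [integrandII3, hphi, Real.norm_eq_abs]
  set q := quotientBySpeed U yc Φ y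
  have hq0 : q ≠ 0 := R.quotient_ne_zero H hyc hy'
  have hqB : |q| ≤ B := hB y hy'
  have hpos : 0 < |y - yc| := abs_pos.mpr (sub_ne_zero.mpr hne)
  have e1 : 1 / (U 0 y - U 0 yc) ^ 2 * (1 / q ^ 2 - 1) =
      -((q - 1) * (q + 1)) / ((U 0 y - U 0 yc) ^ 2 * q ^ 2) := by field_simp; ring
  rw [e1, abs_div, abs_neg, abs_mul, abs_mul, abs_pow, abs_of_nonneg (sq_nonneg q)]
  have h1 : |q + 1| ≤ B + 1 := (abs_add_le _ _).trans (by rw [abs_one]; linarith)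
  have h2 : (m * |y - yc|) ^ 2 * 1 ≤ |U 0 y - U 0 yc| ^ 2 * q ^ 2 := by
    gcongr
    exact (hb y hy').1
  calc |q - 1| * |q + 1| / (|U 0 y - U 0 yc| ^ 2 * q ^ 2)
      ≤ (C * |y - yc| ^ 2) * (B + 1) / ((m * |y - yc|) ^ 2 * 1) := by
        gcongr
        exact hq y hy'
    _ = C * (B + 1) / m ^ 2 := by field_simp

/-- An antiderivative `h` of `1 / Φ²` with `h 0 = 0` and matching regular parts at `yc`, so that
`h 1` is the finite part of `∫₀¹ 1 / Φ²`. It follows from the decomposition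
`1 / Φ² = 1 / (u - c)² + (1 / (u - c)²) (1 / φ₁² - 1)`. -/
theorem exists_inv_sq_primitive (R : RegularJet U α yc Φ Φ' Φ'') (H : ProfileJet U)
    (hyc : yc ∈ Ioo (0 : ℝ) 1) :
    ∃ h : ℝ → ℝ, h 0 = 0 ∧
      h 1 = deriv (fun c => pvRecip (U 0) c) (U 0 yc) + quantII3 (U 0) (U 0 yc) Φ ∧
      (∀ y ∈ Icc (0 : ℝ) 1, y ≠ yc → HasDerivAt h (1 / Φ y ^ 2) y) ∧
      Tendsto (fun y => Φ y * h y) (𝓝[≠] yc) (𝓝 (-(1 / U 1 yc))) ∧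
      (U 2 yc = 0 → ∃ l, Tendsto (fun y => h y + 1 / ((U 0 y - U 0 yc) * U 1 yc))
        (𝓝[≠] yc) (𝓝 l)) := by
  obtain ⟨k, k0, k1, kd, kt, kr⟩ := H.exists_recip_sq_primitive hyc
  have hi := R.integrandII3_integrable H hyc
  set g := integrandII3 (U 0) (U 0 yc) Φ with hg
  have hU := H.continuous (k := 0) (by norm_num)
  have hI : ContinuousOn (fun y => ∫ t in (0 : ℝ)..y, g t) (Icc 0 1) := by
    have := intervalIntegral.continuousOn_primitive_interval (a := 0) (b := 1) (μ := volume)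
      (f := g) (by
        rw [uIcc_of_le zero_le_one, integrableOn_Icc_iff_integrableOn_Ioc]
        exact (intervalIntegrable_iff_integrableOn_Ioc_of_le zero_le_one).mp hi)
    rwa [uIcc_of_le zero_le_one] at this
  have hIc : ContinuousAt (fun y => ∫ t in (0 : ℝ)..y, g t) yc :=
    hI.continuousAt (Icc_mem_nhds hyc.1 hyc.2)
  have hIt : Tendsto (fun y => ∫ t in (0 : ℝ)..y, g t) (𝓝[≠] yc) (𝓝 (∫ t in (0 : ℝ)..yc, g t)) :=
    hIc.tendsto.mono_left nhdsWithin_le_nhds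
  refine ⟨fun y => k y + ∫ t in (0 : ℝ)..y, g t, by simp [k0], by simp [k1, quantII3, hg],
    fun y hy hne => ?_, ?_, fun h2 => ?_⟩
  · have hs := H.speed_sub_ne_zero hyc hy hne
    have hΦ := R.ne_zero H hyc hy hne
    have hgc : ContinuousAt g y := by
      have e1 : ContinuousAt (fun y => U 0 y - U 0 yc) y := (hU.sub continuous_const).continuousAt
      have e2 : ContinuousAt (phi1 (U 0) (U 0 yc) Φ) y := R.continuous.continuousAt.div e1 hs
      exact (continuousAt_const.div (e1.pow 2) (pow_ne_zero 2 hs)).mul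
        ((continuousAt_const.div (e2.pow 2) (pow_ne_zero 2 (div_ne_zero hΦ hs))).sub
          continuousAt_const)
    have hd := intervalIntegral.integral_hasDerivAt_right
      (hi.mono_set (by
        rw [uIcc_of_le zero_le_one, uIcc_of_le hy.1]; exact Icc_subset_Icc le_rfl hy.2))
      (R.integrandII3_measurable H).stronglyMeasurable.stronglyMeasurableAtFilter hgc
    refine ((kd y hy hne).fun_add hd).congr_deriv ?_
    simp only [hg, integrandII3, phi1]
    field_simp
    ring
  · have h0 : Tendsto (fun y => U 0 y - U 0 yc) (𝓝[≠] yc) (𝓝 0) := by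
      have := (hU.sub (continuous_const (y := U 0 yc))).tendsto yc
      simp only [Pi.sub_apply, sub_self] at this
      exact this.mono_left nhdsWithin_le_nhds
    have hq : Tendsto (quotientBySpeed U yc Φ) (𝓝[≠] yc) (𝓝 1) := by
      rw [← R.quotient_same H hyc]
      exact ((R.quotient_continuousOn H hyc).continuousAt
        (Icc_mem_nhds hyc.1 hyc.2)).tendsto.mono_left nhdsWithin_le_nhds
    have ht := hq.mul (kt.add (h0.mul hIt))
    rw [zero_mul, add_zero, one_mul] at ht
    refine ht.congr' ?_
    filter_upwards [eventually_mem_Ioo_ne hyc] with y hy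
    rw [R.eq_mul_quotient H hyc (Ioo_subset_Icc_self hy.1)]
    ring
  · obtain ⟨l, hl⟩ := kr h2
    exact ⟨_, (hl.add hIt).congr fun y => by ring⟩

end RegularJet

/-- Second-order Taylor expansion at a point where the function and its derivative vanish. -/
theorem tendsto_div_sq {N N' : ℝ → ℝ} {p d : ℝ} (h0 : N p = 0) (h1 : N' p = 0)
    (hN : ∀ᶠ y in 𝓝 p, HasDerivAt N (N' y) y) (hN' : HasDerivAt N' d p) :
    Tendsto (fun y => N y / (y - p) ^ 2) (𝓝[≠] p) (𝓝 (d / 2)) := by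
  have hc : ContinuousAt N p := hN.self_of_nhds.continuousAt
  refine HasDerivAt.lhopital_zero_nhdsNE (f' := N') (g' := fun y => 2 * (y - p))
    (mem_nhdsWithin_of_mem_nhds hN) ?_ ?_ ?_ ?_ ?_
  · refine Eventually.of_forall fun y => ?_
    refine (((hasDerivAt_id y).sub_const p).fun_pow 2).congr_deriv ?_
    simp
  · filter_upwards [self_mem_nhdsWithin] with y hy
    exact mul_ne_zero two_ne_zero (sub_ne_zero.mpr hy)
  · simpa [h0] using hc.tendsto.mono_left (nhdsWithin_le_nhds (s := {p}ᶜ))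
  · have : ContinuousAt (fun y => (y - p) ^ 2) p := by fun_prop
    simpa using this.tendsto.mono_left (nhdsWithin_le_nhds (s := {p}ᶜ))
  · have := (hasDerivAt_iff_tendsto_slope.mp hN').div_const 2
    refine this.congr' ?_
    filter_upwards [self_mem_nhdsWithin] with y hy
    have : y - p ≠ 0 := sub_ne_zero.mpr hy
    rw [slope_def_field, h1]
    field_simp
    ring

/-- A solution `z` of the Rayleigh equation on `(0, 1)` away from `yc`, with derivatives `z'` and
`z''`. It is continuous across `yc`, where it need not be differentiable, and it is `C¹` at the
centre and continuous up to the wall. -/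
structure HalfSolution (U : ℕ → ℝ → ℝ) (α yc : ℝ) (z z' z'' : ℝ → ℝ) : Prop where
  hasDerivAt : ∀ y ∈ Ioo (0 : ℝ) 1, y ≠ yc → HasDerivAt z (z' y) y
  hasDerivAt' : ∀ y ∈ Ioo (0 : ℝ) 1, y ≠ yc → HasDerivAt z' (z'' y) y
  equation : ∀ y ∈ Ioo (0 : ℝ) 1, y ≠ yc →
    (U 0 y - U 0 yc) * (z'' y - α ^ 2 * z y) - U 2 y * z y = 0
  continuousAt_zero : ContinuousAt z 0
  continuousAt_zero' : ContinuousAt z' 0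
  continuousAt_critical : ContinuousAt z yc
  tendsto_one : Tendsto z (𝓝[<] 1) (𝓝 (z 1))

namespace HalfSolution

variable {U : ℕ → ℝ → ℝ} {α yc : ℝ} {Φ Φ' Φ'' z z' z'' h : ℝ → ℝ}

/-- Reduction of order on one side of `yc`: there `z = Φ (w h + B)`, where `w` is the Wronskian of
`Φ` and `z`. Since `Φ h → -1 / u'(yc)`, continuity of `z` at `yc` determines `w = -u'(yc) z(yc)`. -/
theorem representation (Z : HalfSolution U α yc z z' z'') (R : RegularJet U α yc Φ Φ' Φ'')
    (H : ProfileJet U) (hyc : yc ∈ Ioo (0 : ℝ) 1)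
    (hd : ∀ y ∈ Icc (0 : ℝ) 1, y ≠ yc → HasDerivAt h (1 / Φ y ^ 2) y)
    (ht : Tendsto (fun y => Φ y * h y) (𝓝[≠] yc) (𝓝 (-(1 / U 1 yc))))
    {a b : ℝ} (hab : Ioo a b ⊆ Ioo 0 1) (hn : yc ∉ Ioo a b) {l : Filter ℝ} [l.NeBot]
    (hl : l ≤ 𝓝[≠] yc) (hm : Ioo a b ∈ l) :
    ∃ B, ∀ y ∈ Ioo a b, Φ y * z' y - z y * Φ' y = -(U 1 yc * z yc) ∧
      z y = Φ y * (-(U 1 yc * z yc) * h y + B) := by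
  have hne : ∀ y ∈ Ioo a b, y ≠ yc := fun y hy e => hn (e ▸ hy)
  have hU1 : U 1 yc ≠ 0 := (H.deriv_pos yc (Ioo_subset_Ioc_self hyc)).ne'
  have hW : ∀ y ∈ Ioo a b, HasDerivAt (fun y => Φ y * z' y - z y * Φ' y) 0 y := fun y hy => by
    have hy1 := hab hy
    refine (((R.hasDerivAt y).fun_mul (Z.hasDerivAt' y hy1 (hne y hy))).fun_sub
      ((Z.hasDerivAt y hy1 (hne y hy)).fun_mul (R.hasDerivAt' y))).congr_deriv ?_
    have e1 := R.equation y (Ioo_subset_Icc_self hy1)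
    have e2 := Z.equation y hy1 (hne y hy)
    have hs := H.speed_sub_ne_zero hyc (Ioo_subset_Icc_self hy1) (hne y hy)
    apply mul_left_cancel₀ hs
    linear_combination Φ y * e2 - z y * e1
  obtain ⟨w, hw⟩ := isOpen_Ioo.exists_is_const_of_deriv_eq_zero isPreconnected_Ioo
    (fun y hy => (hW y hy).differentiableAt.differentiableWithinAt)
    (fun y hy => (hW y hy).deriv)
  have hQ : ∀ y ∈ Ioo a b, HasDerivAt (fun y => z y / Φ y - w * h y) 0 y := fun y hy => by
    have hy1 := hab hy
    have hΦ := R.ne_zero H hyc (Ioo_subset_Icc_self hy1) (hne y hy)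
    refine (((Z.hasDerivAt y hy1 (hne y hy)).fun_div (R.hasDerivAt y) hΦ).fun_sub
      ((hd y (Ioo_subset_Icc_self hy1) (hne y hy)).const_mul w)).congr_deriv ?_
    rw [← hw y hy]
    field_simp
    ring
  obtain ⟨B, hB⟩ := isOpen_Ioo.exists_is_const_of_deriv_eq_zero isPreconnected_Ioo
    (fun y hy => (hQ y hy).differentiableAt.differentiableWithinAt)
    (fun y hy => (hQ y hy).deriv)
  have hz : ∀ y ∈ Ioo a b, z y = Φ y * (w * h y + B) := fun y hy => by
    have hΦ := R.ne_zero H hyc (Ioo_subset_Icc_self (hab hy)) (hne y hy)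
    rw [← hB y hy]
    field_simp
    ring
  have hlim : Tendsto z l (𝓝 (w * -(1 / U 1 yc) + 0 * B)) := by
    have hΦ0 : Tendsto Φ l (𝓝 0) := by
      rw [← R.eq_zero]
      exact R.continuous.continuousAt.tendsto.mono_left (hl.trans nhdsWithin_le_nhds)
    refine (((ht.mono_left hl).const_mul w).add (hΦ0.mul_const B)).congr' ?_
    filter_upwards [hm] with y hy
    rw [hz y hy]; ring
  have hweq : w = -(U 1 yc * z yc) := by
    have := tendsto_nhds_unique hlim
      (Z.continuousAt_critical.tendsto.mono_left (hl.trans nhdsWithin_le_nhds))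
    rw [← this]
    field_simp
    ring
  rw [← hweq]
  exact ⟨B, fun y hy => ⟨hw y hy, hz y hy⟩⟩

theorem representation_left (Z : HalfSolution U α yc z z' z'') (R : RegularJet U α yc Φ Φ' Φ'')
    (H : ProfileJet U) (hyc : yc ∈ Ioo (0 : ℝ) 1) (h0 : h 0 = 0)
    (hd : ∀ y ∈ Icc (0 : ℝ) 1, y ≠ yc → HasDerivAt h (1 / Φ y ^ 2) y)
    (ht : Tendsto (fun y => Φ y * h y) (𝓝[≠] yc) (𝓝 (-(1 / U 1 yc)))) :
    ∃ B, (∀ y ∈ Ioo 0 yc, z y = Φ y * (-(U 1 yc * z yc) * h y + B)) ∧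
      z 0 = Φ 0 * B ∧ Φ 0 * z' 0 - z 0 * Φ' 0 = -(U 1 yc * z yc) := by
  obtain ⟨B, hB⟩ := Z.representation R H hyc hd ht (a := 0) (b := yc)
    (Ioo_subset_Ioo le_rfl hyc.2.le) (fun e => lt_irrefl _ e.2) (l := 𝓝[<] yc)
    (nhdsWithin_mono _ fun y hy => ne_of_lt hy) (Ioo_mem_nhdsLT hyc.1)
  have hh := (hd 0 ⟨le_rfl, zero_le_one⟩ hyc.1.ne).continuousAt
  refine ⟨B, fun y hy => (hB y hy).2, ?_, ?_⟩
  · have e1 := (R.continuous.continuousAt (x := 0)).mul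
      ((hh.const_mul (-(U 1 yc * z yc))).add (continuousAt_const (y := B)))
    have e2 := tendsto_nhds_unique (e1.tendsto.mono_left (nhdsWithin_le_nhds (s := Ioi 0)))
      ((Z.continuousAt_zero.tendsto.mono_left nhdsWithin_le_nhds).congr' (by
        filter_upwards [Ioo_mem_nhdsGT hyc.1] with y hy
        exact (hB y hy).2))
    simp only [Pi.mul_apply, Pi.add_apply, h0, mul_zero, zero_add] at e2
    exact e2.symm
  · have e1 := ((R.continuous.continuousAt (x := 0)).mul Z.continuousAt_zero').sub
      (Z.continuousAt_zero.mul (R.continuous'.continuousAt (x := 0)))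
    exact tendsto_nhds_unique (e1.tendsto.mono_left (nhdsWithin_le_nhds (s := Ioi 0)))
      (tendsto_const_nhds.congr' (by
        filter_upwards [Ioo_mem_nhdsGT hyc.1] with y hy
        exact (hB y hy).1.symm))

theorem representation_right (Z : HalfSolution U α yc z z' z'') (R : RegularJet U α yc Φ Φ' Φ'')
    (H : ProfileJet U) (hyc : yc ∈ Ioo (0 : ℝ) 1)
    (hd : ∀ y ∈ Icc (0 : ℝ) 1, y ≠ yc → HasDerivAt h (1 / Φ y ^ 2) y)
    (ht : Tendsto (fun y => Φ y * h y) (𝓝[≠] yc) (𝓝 (-(1 / U 1 yc)))) :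
    ∃ B, (∀ y ∈ Ioo yc 1, z y = Φ y * (-(U 1 yc * z yc) * h y + B)) ∧
      z 1 = Φ 1 * (-(U 1 yc * z yc) * h 1 + B) := by
  obtain ⟨B, hB⟩ := Z.representation R H hyc hd ht (a := yc) (b := 1)
    (Ioo_subset_Ioo hyc.1.le le_rfl) (fun e => lt_irrefl _ e.1) (l := 𝓝[>] yc)
    (nhdsWithin_mono _ fun y hy => ne_of_gt hy) (Ioo_mem_nhdsGT hyc.2)
  have hh := (hd 1 ⟨zero_le_one, le_rfl⟩ hyc.2.ne').continuousAt
  refine ⟨B, fun y hy => (hB y hy).2, ?_⟩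
  have e1 := (R.continuous.continuousAt (x := 1)).mul
    ((hh.const_mul (-(U 1 yc * z yc))).add (continuousAt_const (y := B)))
  exact (tendsto_nhds_unique (e1.tendsto.mono_left (nhdsWithin_le_nhds (s := Iio 1)))
    (Z.tendsto_one.congr' (by
      filter_upwards [Ioo_mem_nhdsLT hyc.2] with y hy
      exact (hB y hy).2))).symm

theorem eq_zero_of_critical (Z : HalfSolution U α yc z z' z'') (R : RegularJet U α yc Φ Φ' Φ'')
    (H : ProfileJet U) (hyc : yc ∈ Ioo (0 : ℝ) 1) (hc : z yc = 0) :
    (z 1 = 0 → ∀ y ∈ Icc yc 1, z y = 0) ∧ (z 0 = 0 → ∀ y ∈ Icc 0 yc, z y = 0) ∧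
      Φ 0 * z' 0 = z 0 * Φ' 0 := by
  obtain ⟨h, h0, -, hd, ht, -⟩ := R.exists_inv_sq_primitive H hyc
  obtain ⟨B, hB, hB0, hW⟩ := Z.representation_left R H hyc h0 hd ht
  obtain ⟨A, hA, hA1⟩ := Z.representation_right R H hyc hd ht
  simp only [hc, mul_zero, neg_zero, zero_mul, zero_add] at hA hA1 hB hW
  refine ⟨fun h1 y hy => ?_, fun hz y hy => ?_, by linarith⟩
  · have hA0 : A = 0 := by
      rw [h1] at hA1
      exact (mul_eq_zero.mp hA1.symm).resolve_left
        (R.ne_zero H hyc ⟨zero_le_one, le_rfl⟩ hyc.2.ne')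
    rcases eq_or_lt_of_le hy.1 with rfl | hl
    · exact hc
    rcases eq_or_lt_of_le hy.2 with rfl | hr
    · exact h1
    rw [hA y ⟨hl, hr⟩, hA0, mul_zero]
  · have hB1 : B = 0 := by
      rw [hz] at hB0
      exact (mul_eq_zero.mp hB0.symm).resolve_left
        (R.ne_zero H hyc ⟨le_rfl, zero_le_one⟩ hyc.1.ne)
    rcases eq_or_lt_of_le hy.1 with rfl | hl
    · exact hz
    rcases eq_or_lt_of_le hy.2 with rfl | hr
    · exact hc
    rw [hB y ⟨hl, hr⟩, hB1, mul_zero]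

/-- The connection formula across a critical point with `u''(yc) = 0`: the constants `B` of the
representations on the two sides agree, because `z / Φ - w h` has a limit at `yc`. The poles of the
two terms cancel, and `h` has no logarithmic term. -/
theorem connection (Z : HalfSolution U α yc z z' z'') (R : RegularJet U α yc Φ Φ' Φ'')
    (H : ProfileJet U) (hyc : yc ∈ Ioo (0 : ℝ) 1) (h2 : U 2 yc = 0)
    (hz : HasDerivAt z (z' yc) yc) (hz' : HasDerivAt z' (z'' yc) yc) :
    Φ 0 * z' 0 - z 0 * Φ' 0 = -(U 1 yc * z yc) ∧
      z 1 / Φ 1 - z 0 / Φ 0 = -(U 1 yc * z yc) *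
        (deriv (fun c => pvRecip (U 0) c) (U 0 yc) + quantII3 (U 0) (U 0 yc) Φ) := by
  obtain ⟨h, h0, h1, hd, ht, hr⟩ := R.exists_inv_sq_primitive H hyc
  obtain ⟨B, hB, hB0, hW⟩ := Z.representation_left R H hyc h0 hd ht
  obtain ⟨A, hA, hA1⟩ := Z.representation_right R H hyc hd ht
  obtain ⟨l, hl⟩ := hr h2
  have hU1 : U 1 yc ≠ 0 := (H.deriv_pos yc (Ioo_subset_Ioc_self hyc)).ne'
  refine ⟨hW, ?_⟩
  set w := -(U 1 yc * z yc) with hw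
  -- With `h ≈ -1 / ((u - c) u'(yc))`, the difference `z / Φ - w h` is, up to a convergent term, the
  -- quotient of `z (u - c) u'(yc) + w Φ` and `Φ (u - c) u'(yc)`; both vanish to second order at
  -- `yc`, the former because `w = -u'(yc) z(yc)` and `Φ'(yc) = u'(yc)`.
  have hev : ∀ᶠ y in 𝓝 yc, HasDerivAt (fun y => z y * ((U 0 y - U 0 yc) * U 1 yc) + w * Φ y)
      (z' y * ((U 0 y - U 0 yc) * U 1 yc) + z y * (U 1 y * U 1 yc) + w * Φ' y) y := by
    filter_upwards [Ioo_mem_nhds hyc.1 hyc.2] with y hy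
    have hzy : HasDerivAt z (z' y) y := by
      rcases eq_or_ne y yc with rfl | hne
      · exact hz
      · exact Z.hasDerivAt y hy hne
    exact (hzy.fun_mul (((H.hasDerivAt 0 (by norm_num) y).sub_const _).mul_const _)).fun_add
      ((R.hasDerivAt y).const_mul w)
  have hN := tendsto_div_sq (by simp [R.eq_zero]) (by rw [R.deriv_eq, hw]; ring) hev
    (((hz'.fun_mul (((H.hasDerivAt 0 (by norm_num) yc).sub_const (U 0 yc)).mul_const
      (U 1 yc))).fun_add
      (hz.fun_mul ((H.hasDerivAt 1 (by norm_num) yc).mul_const (U 1 yc)))).fun_add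
      ((R.hasDerivAt' yc).const_mul w))
  have hD : Tendsto (fun y => dslope Φ yc y * dslope (U 0) yc y * U 1 yc) (𝓝[≠] yc)
      (𝓝 (U 1 yc * U 1 yc * U 1 yc)) := by
    have e := ((continuous_dslope R.continuous (R.hasDerivAt yc)).mul
      (H.continuous_dslope (by norm_num : 0 < 4) yc)).mul (continuous_const (y := U 1 yc))
    have e' := e.tendsto yc
    simp only [Pi.mul_apply] at e'
    rw [dslope_same, dslope_same, (R.hasDerivAt yc).deriv, R.deriv_eq,
      (H.hasDerivAt 0 (by norm_num) yc).deriv] at e'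
    exact e'.mono_left nhdsWithin_le_nhds
  have hlim := (hN.div hD (by positivity)).sub (hl.const_mul w)
  obtain ⟨v, hlim2⟩ : ∃ v, Tendsto (fun y => z y / Φ y - w * h y) (𝓝[≠] yc) (𝓝 v) := by
    refine ⟨_, hlim.congr' ?_⟩
    filter_upwards [eventually_mem_Ioo_ne hyc] with y hy
    have hy' := Ioo_subset_Icc_self hy.1
    have hs := H.speed_sub_ne_zero hyc hy' hy.2
    have hΦ := R.ne_zero H hyc hy' hy.2
    have hyy := sub_ne_zero.mpr hy.2
    have e1 : dslope Φ yc y = Φ y / (y - yc) := by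
      have := sub_eq_mul_dslope Φ yc y
      rw [R.eq_zero, sub_zero] at this
      rw [this]; field_simp
    have e2 : dslope (U 0) yc y = (U 0 y - U 0 yc) / (y - yc) := by
      rw [sub_eq_mul_dslope]; field_simp
    simp only [Pi.div_apply]
    rw [e1, e2]
    field_simp
    ring
  have hAB : A = B := by
    refine (tendsto_nhds_unique (hlim2.mono_left
      (nhdsWithin_mono _ fun y (hy : y ∈ Ioi yc) => ne_of_gt hy))
      (tendsto_const_nhds.congr' ?_)).symm.trans (tendsto_nhds_unique (hlim2.mono_left
      (nhdsWithin_mono _ fun y (hy : y ∈ Iio yc) => ne_of_lt hy))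
      (tendsto_const_nhds.congr' ?_))
    · filter_upwards [Ioo_mem_nhdsGT hyc.2] with y hy
      have hΦ := R.ne_zero H hyc ⟨hyc.1.le.trans hy.1.le, hy.2.le⟩ hy.1.ne'
      rw [hA y hy]
      field_simp
      ring
    · filter_upwards [Ioo_mem_nhdsLT hyc.1] with y hy
      have hΦ := R.ne_zero H hyc ⟨hy.1.le, hy.2.le.trans hyc.2.le⟩ hy.2.ne
      rw [hB y hy]
      field_simp
      ring
  have hΦ0 := R.ne_zero H hyc ⟨le_rfl, zero_le_one⟩ hyc.1.ne
  have hΦ1 := R.ne_zero H hyc ⟨zero_le_one, le_rfl⟩ hyc.2.ne'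
  rw [hA1, hB0, hAB, h1]
  field_simp
  ring

end HalfSolution

/-! ### Existence of solutions, and quantization on the whole channel -/

theorem ContinuousOn.exists_bounded_extension {f : ℝ → ℝ} {a b : ℝ} (hab : a ≤ b)
    (hf : ContinuousOn f (Icc a b)) :
    ∃ (g : ℝ → ℝ) (K : ℝ), Continuous g ∧ (∀ y, |g y| ≤ K) ∧ EqOn g f (Icc a b) := by
  obtain ⟨K, hK⟩ := isCompact_Icc.exists_bound_of_continuousOn hf
  refine ⟨IccExtend hab ((Icc a b).domRestrict f), K,
    (continuousOn_iff_continuous_domRestrict.mp hf).Icc_extend', fun y => ?_, fun y hy => ?_⟩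
  · exact hK _ (projIcc a b hab y).2
  · simp [IccExtend_of_mem hab _ hy]

namespace ProfileJet

variable {U : ℕ → ℝ → ℝ} {yc : ℝ}

/-- The regular solution exists: it solves `f'' = E f / (y - yc)` with
`E = (u'' + α² (u - c)) (y - yc) / (u - c)`, which is continuous on `[0, 1]`. -/
theorem exists_regularJet (H : ProfileJet U) (α : ℝ) (hyc : yc ∈ Ioo (0 : ℝ) 1) :
    ∃ Φ Φ' Φ'' : ℝ → ℝ, RegularJet U α yc Φ Φ' Φ'' := by
  have hU := H.continuous (k := 0) (by norm_num)
  have hU2 := H.continuous (k := 2) (by norm_num)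
  have hc : ContinuousOn (fun y => (U 2 y + α ^ 2 * (U 0 y - U 0 yc)) / dslope (U 0) yc y)
      (Icc 0 1) :=
    ContinuousOn.div (Continuous.continuousOn (by fun_prop))
      (H.continuous_dslope (by norm_num) yc).continuousOn fun y hy => (H.dslope_pos hyc hy).ne'
  obtain ⟨E, K, hE, hK, he⟩ := hc.exists_bounded_extension zero_le_one
  obtain ⟨f, f', g, hg, hf, hfp, hd, hd'⟩ := exists_solution_vanishing_at yc (U 1 yc) hE hK
  refine ⟨f, f', fun y => E y * g y, hd, hd', hE.mul hg, fun y hy => ?_, by simp [hf], hfp⟩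
  have hD := (H.dslope_pos hyc hy).ne'
  simp only [he hy, hf y]
  rw [sub_eq_mul_dslope (U 0) yc y]
  field_simp
  ring

/-- If `u''(yc) = 0`, the potential `α² + u'' / (u - c)` extends continuously across both critical
points. It is built on `[0, 1]` and reflected. -/
theorem exists_regular_potential (H : ProfileJet U) (α : ℝ) (hyc : yc ∈ Ioo (0 : ℝ) 1)
    (h2 : U 2 yc = 0) :
    ∃ (Q : ℝ → ℝ) (K : ℝ), Continuous Q ∧ (∀ y, |Q y| ≤ K) ∧ ∀ y ∈ Ioo (-1 : ℝ) 1,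
      (U 0 y - U 0 yc) * (Q y - α ^ 2) = U 2 y := by
  have hc : ContinuousOn (fun y => α ^ 2 + dslope (U 2) yc y / dslope (U 0) yc y) (Icc 0 1) :=
    continuousOn_const.add ((H.continuous_dslope (by norm_num) yc).continuousOn.div
      (H.continuous_dslope (by norm_num) yc).continuousOn fun y hy => (H.dslope_pos hyc hy).ne')
  obtain ⟨E, K, hE, hK, he⟩ := hc.exists_bounded_extension zero_le_one
  refine ⟨fun y => E |y|, K, hE.comp continuous_abs, fun y => hK _, fun y hy => ?_⟩
  have hy' : |y| ∈ Icc (0 : ℝ) 1 := ⟨abs_nonneg y, abs_le.mpr ⟨hy.1.le, hy.2.le⟩⟩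
  have hD := (H.dslope_pos hyc hy').ne'
  have e0 : U 0 y = U 0 |y| := by
    rcases abs_choice y with h | h <;> rw [h]
    exact (H.even y (Ioo_subset_Icc_self hy)).symm
  have e2 : U 2 y = U 2 |y| := by
    rcases abs_choice y with h | h <;> rw [h]
    exact (H.deriv2_even hy).symm
  have e3 := sub_eq_mul_dslope (U 2) yc |y|
  rw [h2, sub_zero] at e3
  simp only
  rw [e0, e2, e3, he hy', sub_eq_mul_dslope (U 0) yc |y|]
  field_simp
  ring

end ProfileJet

/-- The solutions of `f'' = Q f` on `(-1, 1)` with initial values `(1, 0)` and `(0, 1)` at the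
centre. -/
theorem exists_potential_solutions {Q : ℝ → ℝ} (hQ : Continuous Q) {K : ℝ} (hK : ∀ y, |Q y| ≤ K) :
    (∃ f f' : ℝ → ℝ, f 0 = 1 ∧ f' 0 = 0 ∧ (∀ y, HasDerivAt f (f' y) y) ∧ Continuous f' ∧
      ∀ y ∈ Ioo (-1 : ℝ) 1, HasDerivAt f' (Q y * f y) y) ∧
    ∃ f f' : ℝ → ℝ, f 0 = 0 ∧ f' 0 = 1 ∧ (∀ y, HasDerivAt f (f' y) y) ∧ Continuous f' ∧
      ∀ y ∈ Ioo (-1 : ℝ) 1, HasDerivAt f' (Q y * f y) y := by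
  constructor
  · obtain ⟨f, f', h0, h1, hd, hc, hd'⟩ := exists_solution_eq_one_at 0 hQ hK
    exact ⟨f, f', h0, h1, hd, hc, fun y hy => hd' y (by simpa [abs_lt] using hy)⟩
  · obtain ⟨E, K', hE, hK', he⟩ := (Continuous.continuousOn (s := Icc (-1 : ℝ) 1)
      (continuous_id.mul hQ)).exists_bounded_extension (by norm_num)
    obtain ⟨f, f', g, -, hf, hfp, hd, hd'⟩ := exists_solution_vanishing_at 0 1 hE hK'
    refine ⟨f, f', by simp [hf], hfp, hd,
      continuous_iff_continuousAt.mpr fun y => (hd' y).continuousAt, fun y hy => ?_⟩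
    refine (hd' y).congr_deriv ?_
    rw [he (Ioo_subset_Icc_self hy), hf]
    simp only [Pi.mul_apply, id]
    ring

/-- A continuous function on `[-1, 1]` that solves the Rayleigh equation away from the critical
points `±yc`, with its derivatives `z'` and `z''`. -/
structure ChannelSolution (U : ℕ → ℝ → ℝ) (α yc : ℝ) (z z' z'' : ℝ → ℝ) : Prop where
  continuousOn : ContinuousOn z (Icc (-1) 1)
  hasDerivAt : ∀ y ∈ Ioo (-1 : ℝ) 1, y ≠ yc → y ≠ -yc → HasDerivAt z (z' y) y
  hasDerivAt' : ∀ y ∈ Ioo (-1 : ℝ) 1, y ≠ yc → y ≠ -yc → HasDerivAt z' (z'' y) y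
  equation : ∀ y ∈ Ioo (-1 : ℝ) 1, y ≠ yc → y ≠ -yc →
    (U 0 y - U 0 yc) * (z'' y - α ^ 2 * z y) - U 2 y * z y = 0

namespace ChannelSolution

variable {U : ℕ → ℝ → ℝ} {α yc : ℝ} {Φ Φ' Φ'' z z' z'' : ℝ → ℝ}

theorem reflect (Z : ChannelSolution U α yc z z' z'') (H : ProfileJet U) :
    ChannelSolution U α yc (fun y => z (-y)) (fun y => -z' (-y)) (fun y => z'' (-y)) := by
  have hm : ∀ y ∈ Ioo (-1 : ℝ) 1, -y ∈ Ioo (-1 : ℝ) 1 := fun y hy =>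
    ⟨by linarith [hy.2], by linarith [hy.1]⟩
  refine ⟨Z.continuousOn.comp (by fun_prop) fun y hy => ⟨by linarith [hy.2], by linarith [hy.1]⟩,
    fun y hy h1 h2 => ?_, fun y hy h1 h2 => ?_, fun y hy h1 h2 => ?_⟩
  · exact ((Z.hasDerivAt (-y) (hm y hy) (fun e => h2 (by linarith))
      (fun e => h1 (by linarith))).comp y (hasDerivAt_neg y)).congr_deriv (by ring)
  · exact ((Z.hasDerivAt' (-y) (hm y hy) (fun e => h2 (by linarith))
      (fun e => h1 (by linarith))).comp y (hasDerivAt_neg y)).fun_neg.congr_deriv (by ring)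
  · have := Z.equation (-y) (hm y hy) (fun e => h2 (by linarith)) (fun e => h1 (by linarith))
    rwa [H.even y (Ioo_subset_Icc_self hy), H.deriv2_even hy] at this

theorem toHalf (Z : ChannelSolution U α yc z z' z'') (hyc : yc ∈ Ioo (0 : ℝ) 1) :
    HalfSolution U α yc z z' z'' := by
  have hs : Ioo (0 : ℝ) 1 ⊆ Ioo (-1) 1 := Ioo_subset_Ioo (by norm_num) le_rfl
  have hn : ∀ y ∈ Ioo (0 : ℝ) 1, y ≠ -yc := fun y hy => by linarith [hy.1, hyc.1]
  have h0 : (0 : ℝ) ∈ Ioo (-1 : ℝ) 1 := by norm_num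
  refine ⟨fun y hy h => Z.hasDerivAt y (hs hy) h (hn y hy),
    fun y hy h => Z.hasDerivAt' y (hs hy) h (hn y hy),
    fun y hy h => Z.equation y (hs hy) h (hn y hy),
    (Z.hasDerivAt 0 h0 hyc.1.ne (by linarith [hyc.1])).continuousAt,
    (Z.hasDerivAt' 0 h0 hyc.1.ne (by linarith [hyc.1])).continuousAt,
    Z.continuousOn.continuousAt (Icc_mem_nhds (by linarith [hyc.1]) hyc.2), ?_⟩
  exact (Z.continuousOn 1 (by norm_num)).tendsto.mono_left
    (nhdsWithin_le_of_mem (mem_of_superset (Ioo_mem_nhdsLT (by norm_num : (0 : ℝ) < 1))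
      (fun y hy => ⟨by linarith [hy.1], hy.2.le⟩)))

theorem eq_zero_of_critical (Z : ChannelSolution U α yc z z' z'')
    (R : RegularJet U α yc Φ Φ' Φ'') (H : ProfileJet U) (hα : α ≠ 0) (hyc : yc ∈ Ioo (0 : ℝ) 1)
    (hc : z yc = 0) (hc' : z (-yc) = 0) (h1 : z 1 = 0) (h1' : z (-1) = 0) :
    ∀ y ∈ Icc (-1 : ℝ) 1, z y = 0 := by
  obtain ⟨a1, a2, a3⟩ := (Z.toHalf hyc).eq_zero_of_critical R H hyc hc
  obtain ⟨b1, b2, b3⟩ := ((Z.reflect H).toHalf hyc).eq_zero_of_critical R H hyc hc'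
  simp only [neg_zero] at b2 b3
  have h0 : z 0 = 0 := by
    have : z 0 * Φ' 0 = 0 := by linarith
    exact (mul_eq_zero.mp this).resolve_right (R.deriv_left_ne_zero H hα hyc)
  intro y hy
  rcases le_total 0 y with hp | hp
  · rcases le_total yc y with h | h
    · exact a1 h1 y ⟨h, hy.2⟩
    · exact a2 h0 y ⟨hp, h⟩
  · rcases le_total yc (-y) with h | h
    · simpa using b1 h1' (-y) ⟨h, by linarith [hy.1]⟩
    · simpa using b2 h0 (-y) ⟨by linarith, h⟩

/-- A nonzero solution that is twice differentiable at both critical points and vanishes at the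
walls forces `K = 0` or `Φ 0 * Φ' 0 * K = 1`: the connection formulas for `z` and for its reflection
form a linear system for `z 0` and `z' 0`. -/
theorem quantization (Z : ChannelSolution U α yc z z' z'')
    (R : RegularJet U α yc Φ Φ' Φ'') (H : ProfileJet U) (hα : α ≠ 0) (hyc : yc ∈ Ioo (0 : ℝ) 1)
    (h2 : U 2 yc = 0)
    (hz : HasDerivAt z (z' yc) yc) (hz' : HasDerivAt z' (z'' yc) yc)
    (hzn : HasDerivAt z (z' (-yc)) (-yc)) (hzn' : HasDerivAt z' (z'' (-yc)) (-yc))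
    (h1 : z 1 = 0) (h1' : z (-1) = 0) (hne : ∃ y ∈ Icc (-1 : ℝ) 1, z y ≠ 0)
    {K : ℝ} (hK : K = deriv (fun c => pvRecip (U 0) c) (U 0 yc) + quantII3 (U 0) (U 0 yc) Φ) :
    K = 0 ∨ Φ 0 * Φ' 0 * K = 1 := by
  obtain ⟨a1, a2⟩ := (Z.toHalf hyc).connection R H hyc h2 hz hz'
  obtain ⟨b1, b2⟩ := ((Z.reflect H).toHalf hyc).connection R H hyc h2
    ((hzn.comp yc (hasDerivAt_neg yc)).congr_deriv (by ring))
    ((hzn'.comp yc (hasDerivAt_neg yc)).fun_neg.congr_deriv (by ring))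
  simp only [neg_zero] at b1 b2
  rw [← hK, h1, zero_div, zero_sub] at a2
  rw [← hK, h1', zero_div, zero_sub] at b2
  have hU1 : U 1 yc ≠ 0 := (H.deriv_pos yc (Ioo_subset_Ioc_self hyc)).ne'
  have hΦ0 := R.ne_zero H hyc ⟨le_rfl, zero_le_one⟩ hyc.1.ne
  by_contra! hcon
  obtain ⟨hK0, hK1⟩ := hcon
  -- The wall conditions give `-z 0 / Φ 0 = w K` with both `w = -u'(yc) z(yc)` and
  -- `w = -u'(yc) z(-yc)`. The two Wronskians at the centre then agree, so their mean is
  -- `-(z 0 * Φ' 0)`.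
  have hww : -(U 1 yc * z yc) = -(U 1 yc * z (-yc)) :=
    mul_right_cancel₀ hK0 (a2.symm.trans b2)
  have hw : -(U 1 yc * z yc) = -(z 0 * Φ' 0) := by linarith
  have hz0 : z 0 * (Φ 0 * Φ' 0 * K - 1) = 0 := by
    rw [hw] at a2
    have : -z 0 = -(z 0 * Φ' 0) * K * Φ 0 := by rw [← a2]; field_simp
    linear_combination this
  have hz00 : z 0 = 0 := (mul_eq_zero.mp hz0).resolve_right (sub_ne_zero.mpr hK1)
  have hc : z yc = 0 := by
    rw [hz00, zero_mul, neg_zero, neg_eq_zero] at hw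
    exact (mul_eq_zero.mp hw).resolve_left hU1
  have hc' : z (-yc) = 0 := by
    rw [hc, mul_zero, neg_zero, zero_eq_neg] at hww
    exact (mul_eq_zero.mp hww).resolve_left hU1
  obtain ⟨y, hy, hy0⟩ := hne
  exact hy0 (Z.eq_zero_of_critical R H hα hyc hc hc' h1 h1' y hy)

end ChannelSolution

/-- Conversely, the odd solution of `z'' = Q z` vanishes at the walls if `K = 0`, and the even one
if `Φ 0 * Φ' 0 * K = 1`. Parity is not used as such: the connection formula gives both wall values.
-/
theorem ProfileJet.exists_eigenfunction {U : ℕ → ℝ → ℝ} {α yc : ℝ} {Φ Φ' Φ'' Q : ℝ → ℝ}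
    (H : ProfileJet U) (R : RegularJet U α yc Φ Φ' Φ'')
    (hyc : yc ∈ Ioo (0 : ℝ) 1) (h2 : U 2 yc = 0)
    (hQ : Continuous Q) {B : ℝ} (hB : ∀ y, |Q y| ≤ B)
    (hQU : ∀ y ∈ Ioo (-1 : ℝ) 1, (U 0 y - U 0 yc) * (Q y - α ^ 2) = U 2 y)
    {K : ℝ} (hK : K = deriv (fun c => pvRecip (U 0) c) (U 0 yc) + quantII3 (U 0) (U 0 yc) Φ)
    (h : K = 0 ∨ Φ 0 * Φ' 0 * K = 1) :
    ∃ z z' : ℝ → ℝ, (∀ y, HasDerivAt z (z' y) y) ∧ Continuous z' ∧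
      (∀ y ∈ Ioo (-1 : ℝ) 1, HasDerivAt z' (Q y * z y) y) ∧ z 1 = 0 ∧ z (-1) = 0 ∧
      ∃ y ∈ Icc (-1 : ℝ) 1, z y ≠ 0 := by
  have hΦ0 := R.ne_zero H hyc ⟨le_rfl, zero_le_one⟩ hyc.1.ne
  have hΦ1 := R.ne_zero H hyc ⟨zero_le_one, le_rfl⟩ hyc.2.ne'
  have key : ∀ z z' : ℝ → ℝ, (∀ y, HasDerivAt z (z' y) y) →
      (∀ y ∈ Ioo (-1 : ℝ) 1, HasDerivAt z' (Q y * z y) y) →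
      z 1 / Φ 1 - z 0 / Φ 0 = (Φ 0 * z' 0 - z 0 * Φ' 0) * K ∧
      z (-1) / Φ 1 - z 0 / Φ 0 = (-(Φ 0 * z' 0) - z 0 * Φ' 0) * K := by
    intro z z' hz hz'
    have Z : ChannelSolution U α yc z z' (fun y => Q y * z y) :=
      ⟨fun y _ => (hz y).continuousAt.continuousWithinAt, fun y _ _ _ => hz y,
        fun y hy _ _ => hz' y hy, fun y hy _ _ => by
          linear_combination z y * hQU y hy⟩
    have hm : yc ∈ Ioo (-1 : ℝ) 1 := ⟨by linarith [hyc.1], hyc.2⟩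
    have hm' : -yc ∈ Ioo (-1 : ℝ) 1 := ⟨by linarith [hyc.2], by linarith [hyc.1]⟩
    obtain ⟨a1, a2⟩ := (Z.toHalf hyc).connection R H hyc h2 (hz yc) (hz' yc hm)
    obtain ⟨b1, b2⟩ := ((Z.reflect H).toHalf hyc).connection R H hyc h2
      (((hz (-yc)).comp yc (hasDerivAt_neg yc)).congr_deriv (by ring))
      (((hz' (-yc) hm').comp yc (hasDerivAt_neg yc)).fun_neg.congr_deriv (by ring))
    simp only [neg_zero] at b1 b2
    rw [← hK, ← a1] at a2
    rw [← hK, ← b1] at b2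
    exact ⟨a2, by rw [b2]; ring⟩
  obtain ⟨⟨e, e', e0, e0', he, hec, he'⟩, o, o', o0, o0', ho, hoc, ho'⟩ :=
    exists_potential_solutions hQ hB
  rcases h with h | h
  · obtain ⟨k1, k2⟩ := key o o' ho ho'
    rw [h, mul_zero, o0, zero_div, sub_zero] at k1 k2
    refine ⟨o, o', ho, hoc, ho', (div_eq_zero_iff.mp k1).resolve_right hΦ1,
      (div_eq_zero_iff.mp k2).resolve_right hΦ1, ?_⟩
    -- a function vanishing on the channel has zero derivative at its centre
    by_contra! hcon
    have hev : o =ᶠ[𝓝 0] fun _ => 0 := by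
      filter_upwards [Icc_mem_nhds (by norm_num : (-1 : ℝ) < 0) one_pos] with y hy
      exact hcon y hy
    have := (ho 0).unique ((hasDerivAt_const (0 : ℝ) (0 : ℝ)).congr_of_eventuallyEq hev)
    rw [o0'] at this
    exact one_ne_zero this
  · obtain ⟨k1, k2⟩ := key e e' he he'
    rw [e0, e0'] at k1 k2
    have hs : 1 / Φ 0 + -(Φ' 0 * K) = 0 := by field_simp; linear_combination -h
    have k1' : e 1 / Φ 1 = 0 := by linear_combination k1 + hs
    have k2' : e (-1) / Φ 1 = 0 := by linear_combination k2 + hs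
    exact ⟨e, e', he, hec, he', (div_eq_zero_iff.mp k1').resolve_right hΦ1,
      (div_eq_zero_iff.mp k2').resolve_right hΦ1, 0, by norm_num, by rw [e0]; exact one_ne_zero⟩

/-! ### Principal values of integrable functions, and the du Bois-Reymond lemma -/

/-- For an integrable function the principal value around a finite set is the integral. -/
theorem hasPV_of_integrableOn {E : Type*} [NormedAddCommGroup E] [NormedSpace ℝ E]
    {f : ℝ → E} {a b : ℝ} {S : Set ℝ} (hab : a ≤ b) (hS : S.Finite)
    (hf : IntegrableOn f (Icc a b)) : HasPV f a b S (∫ y in a..b, f y) := by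
  have hsub : ∀ ε, pvDomain a b S ε ⊆ Icc a b := fun ε y hy => hy.1
  have hm : ∀ ε, MeasurableSet (pvDomain a b S ε) := fun ε =>
    (isCompact_pvDomain a b S ε).isClosed.measurableSet
  refine ⟨fun ε _ => hf.mono_set (hsub ε), ?_⟩
  rw [intervalIntegral.integral_of_le hab, ← integral_Icc_eq_integral_Ioc]
  have h1 : ∀ ε, ∫ y in pvDomain a b S ε, f y =
      ∫ y in Icc a b, (pvDomain a b S ε).indicator f y := fun ε => by
    rw [setIntegral_indicator (hm ε), inter_eq_self_of_subset_right (hsub ε)]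
  simp only [h1]
  refine tendsto_integral_filter_of_dominated_convergence (fun y => ‖f y‖)
    (Eventually.of_forall fun ε => hf.1.indicator (hm ε))
    (Eventually.of_forall fun ε => Eventually.of_forall fun y => norm_indicator_le_norm_self _ _)
    hf.norm ?_
  have hae : ∀ᵐ y ∂volume.restrict (Icc a b), y ∉ S :=
    ae_restrict_of_ae (measure_eq_zero_iff_ae_notMem.mp (hS.measure_zero volume))
  filter_upwards [hae, ae_restrict_mem measurableSet_Icc] with y hyS hy
  refine tendsto_const_nhds.congr' ?_
  have hev : ∀ᶠ ε in 𝓝[>] (0 : ℝ), ∀ s ∈ S, ε ≤ |y - s| :=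
    (eventually_all_finite hS).mpr fun s hs => by
      have : 0 < |y - s| := abs_pos.mpr (sub_ne_zero.mpr fun e => hyS (e ▸ hs))
      filter_upwards [Ioo_mem_nhdsGT this] with ε hε
      exact hε.2.le
  filter_upwards [hev] with ε hε
  rw [indicator_of_mem]
  exact ⟨hy, hε⟩

theorem HasPV.unique {E : Type*} [NormedAddCommGroup E] [NormedSpace ℝ E]
    {f : ℝ → E} {a b : ℝ} {S : Set ℝ} {L L' : E} (h : HasPV f a b S L) (h' : HasPV f a b S L') :
    L = L' :=
  tendsto_nhds_unique h.2 h'.2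

/-- Integration by parts for primitives of merely integrable functions, through absolute continuity.
-/
theorem integral_primitive_mul {r w : ℝ → ℝ} {a b : ℝ} (hr : IntervalIntegrable r volume a b)
    (hw : IntervalIntegrable w volume a b) :
    ∫ t in a..b, (∫ s in a..t, r s) * w t =
      (∫ t in a..b, r t) * (∫ t in a..b, w t) - ∫ t in a..b, r t * ∫ s in a..t, w s := by
  have hR := hr.absolutelyContinuousOnInterval_intervalIntegral (c := a) left_mem_uIcc
  have hW := hw.absolutelyContinuousOnInterval_intervalIntegral (c := a) left_mem_uIcc
  have h := hR.integral_mul_deriv_eq_deriv_mul hW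
  have e1 : ∫ t in a..b, (∫ s in a..t, r s) * deriv (fun t => ∫ s in a..t, w s) t =
      ∫ t in a..b, (∫ s in a..t, r s) * w t := by
    refine intervalIntegral.integral_congr_ae ?_
    filter_upwards [hw.ae_hasDerivAt_integral] with t ht hts
    rw [(ht (uIoc_subset_uIcc hts) a left_mem_uIcc).deriv]
  have e2 : ∫ t in a..b, deriv (fun t => ∫ s in a..t, r s) t * (∫ s in a..t, w s) =
      ∫ t in a..b, r t * ∫ s in a..t, w s := by
    refine intervalIntegral.integral_congr_ae ?_
    filter_upwards [hr.ae_hasDerivAt_integral] with t ht hts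
    rw [(ht (uIoc_subset_uIcc hts) a left_mem_uIcc).deriv]
  rw [e1, e2] at h
  simpa using h

theorem continuousOn_primitive_of_integrable {E : Type*} [NormedAddCommGroup E] [NormedSpace ℝ E]
    {w : ℝ → E} {a b : ℝ} (hab : a ≤ b) (hw : IntervalIntegrable w volume a b) :
    ContinuousOn (fun t => ∫ s in a..t, w s) (Icc a b) := by
  have := intervalIntegral.continuousOn_primitive_interval (a := a) (b := b) (μ := volume)
    (f := w) (by
      rw [uIcc_of_le hab, integrableOn_Icc_iff_integrableOn_Ioc]
      exact (intervalIntegrable_iff_integrableOn_Ioc_of_le hab).mp hw)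
  rwa [uIcc_of_le hab] at this

theorem integral_primitive_mul_complex {r : ℝ → ℝ} {w : ℝ → ℂ} {a b : ℝ} (hab : a ≤ b)
    (hr : IntervalIntegrable r volume a b) (hw : IntervalIntegrable w volume a b) :
    ∫ t in a..b, ((∫ s in a..t, r s : ℝ) : ℂ) * w t =
      ((∫ t in a..b, r t : ℝ) : ℂ) * (∫ t in a..b, w t) -
        ∫ t in a..b, (r t : ℂ) * ∫ s in a..t, w s := by
  have hR := continuousOn_primitive_of_integrable hab hr
  have hW := continuousOn_primitive_of_integrable hab hw
  have hrc : IntervalIntegrable (fun t => (r t : ℂ)) volume a b :=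
    ⟨hr.1.ofReal, hr.2.ofReal⟩
  have hRc : ContinuousOn (fun t => ((∫ s in a..t, r s : ℝ) : ℂ)) (Icc a b) :=
    Complex.continuous_ofReal.comp_continuousOn hR
  have key : ∀ L : ℂ →L[ℝ] ℝ, L (∫ t in a..b, ((∫ s in a..t, r s : ℝ) : ℂ) * w t) =
      L (((∫ t in a..b, r t : ℝ) : ℂ) * (∫ t in a..b, w t) -
        ∫ t in a..b, (r t : ℂ) * ∫ s in a..t, w s) := by
    intro L
    have hsm : ∀ (x : ℝ) (z : ℂ), L ((x : ℂ) * z) = x * L z := fun x z => by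
      rw [← Complex.real_smul, map_smul, smul_eq_mul]
    have hi1 : IntervalIntegrable (fun t => ((∫ s in a..t, r s : ℝ) : ℂ) * w t) volume a b :=
      hw.continuousOn_mul (by rwa [uIcc_of_le hab])
    have hi2 : IntervalIntegrable (fun t => (r t : ℂ) * ∫ s in a..t, w s) volume a b :=
      hrc.mul_continuousOn (by rwa [uIcc_of_le hab])
    have hLw : IntervalIntegrable (fun t => L (w t)) volume a b :=
      ⟨L.integrable_comp hw.1, L.integrable_comp hw.2⟩
    rw [map_sub, hsm, ← L.intervalIntegral_comp_comm hi1, ← L.intervalIntegral_comp_comm hi2,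
      ← L.intervalIntegral_comp_comm hw]
    simp only [hsm]
    rw [integral_primitive_mul hr hLw]
    congr 1
    refine intervalIntegral.integral_congr fun t ht => ?_
    rw [L.intervalIntegral_comp_comm (hw.mono_set (uIcc_subset_uIcc left_mem_uIcc ht))]
  apply Complex.ext
  · exact key Complex.reCLM
  · exact key Complex.imCLM

/-- The fundamental lemma of the calculus of variations, in du Bois-Reymond's form: if
`∫ p w + ∫ r W = 0` for every square integrable `w` of mean zero with primitive `W`, then `p` is, up
to a constant, the primitive of `r`. -/
theorem du_bois_reymond {p r : ℝ → ℝ} {a b : ℝ} (hab : a < b)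
    (hp : MemLp p 2 (volume.restrict (Ioc a b))) (hr : ContinuousOn r (Icc a b))
    (h : ∀ w : ℝ → ℝ, MemLp w 2 volume → (∀ t ∉ Ioc a b, w t = 0) → ∫ t in a..b, w t = 0 →
      (∫ t in a..b, p t * w t) + ∫ t in a..b, r t * ∫ s in a..t, w s = 0) :
    ∃ C, ∀ᵐ t ∂volume.restrict (Ioc a b), p t = C + ∫ s in a..t, r s := by
  have hri : IntervalIntegrable r volume a b := hr.intervalIntegrable_of_Icc hab.le
  have hRc := continuousOn_primitive_of_integrable hab.le hri
  have hRm : MemLp (fun t => ∫ s in a..t, r s) 2 (volume.restrict (Ioc a b)) := by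
    obtain ⟨B, hB⟩ := isCompact_Icc.exists_bound_of_continuousOn hRc
    refine MemLp.of_bound
      ((hRc.mono Ioc_subset_Icc_self).aestronglyMeasurable measurableSet_Ioc) B ?_
    filter_upwards [ae_restrict_mem measurableSet_Ioc] with t ht
    exact hB t (Ioc_subset_Icc_self ht)
  set f : ℝ → ℝ := fun t => p t - ∫ s in a..t, r s with hf
  have hfm : MemLp f 2 (volume.restrict (Ioc a b)) := hp.sub hRm
  have hfi : IntervalIntegrable f volume a b := by
    rw [intervalIntegrable_iff_integrableOn_Ioc_of_le hab.le]
    exact hfm.integrable one_le_two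
  set C := (∫ t in a..b, f t) / (b - a) with hC
  have hgm : MemLp (fun t => f t - C) 2 (volume.restrict (Ioc a b)) := hfm.sub (memLp_const C)
  -- The test function is the deviation of `p - ∫ r` from its mean, and the identity reads
  -- `∫ w² = 0`.
  set w := (Ioc a b).indicator (fun t => f t - C) with hw
  have hwm : MemLp w 2 volume := (memLp_indicator_iff_restrict measurableSet_Ioc).mpr hgm
  have hwi : IntervalIntegrable w volume a b := by
    rw [intervalIntegrable_iff_integrableOn_Ioc_of_le hab.le]
    exact (hwm.restrict _).integrable one_le_two
  have hweq : ∀ t ∈ Ioc a b, w t = f t - C := fun t ht => indicator_of_mem ht _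
  have hcongr : ∀ F G : ℝ → ℝ, (∀ t ∈ Ioc a b, F t = G t) →
      ∫ t in a..b, F t = ∫ t in a..b, G t := fun F G hFG =>
    intervalIntegral.integral_congr_ae (Eventually.of_forall fun t ht => by
      rw [uIoc_of_le hab.le] at ht; exact hFG t ht)
  have hw0 : ∫ t in a..b, w t = 0 := by
    rw [hcongr w _ hweq, intervalIntegral.integral_sub hfi intervalIntegrable_const,
      intervalIntegral.integral_const, smul_eq_mul, hC]
    have : b - a ≠ 0 := (sub_pos.mpr hab).ne'
    field_simp
    ring
  have h1 := h w hwm (fun t ht => indicator_of_notMem ht _) hw0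
  have h2 := integral_primitive_mul hri hwi
  rw [hw0, mul_zero, zero_sub] at h2
  have hpw : IntervalIntegrable (fun t => p t * w t) volume a b := by
    rw [intervalIntegrable_iff_integrableOn_Ioc_of_le hab.le]
    exact hp.integrable_mul (hwm.restrict _)
  have hRw : IntervalIntegrable (fun t => (∫ s in a..t, r s) * w t) volume a b := by
    rw [intervalIntegrable_iff_integrableOn_Ioc_of_le hab.le]
    exact hRm.integrable_mul (hwm.restrict _)
  have h3 : ∫ t in a..b, w t ^ 2 = 0 := by
    have e : ∫ t in a..b, w t ^ 2 =
        ∫ t in a..b, ((p t * w t - (∫ s in a..t, r s) * w t) - C * w t) :=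
      hcongr _ _ fun t ht => by
        have := hweq t ht
        simp only [hf] at this
        linear_combination w t * this
    rw [e, intervalIntegral.integral_sub (hpw.sub hRw) (hwi.const_mul C),
      intervalIntegral.integral_sub hpw hRw, intervalIntegral.integral_const_mul, hw0]
    linarith
  rw [intervalIntegral.integral_of_le hab.le, setIntegral_eq_zero_iff_of_nonneg_ae
    (Eventually.of_forall fun t => sq_nonneg (w t)) (hwm.restrict _).integrable_sq] at h3
  refine ⟨C, ?_⟩
  filter_upwards [h3, ae_restrict_mem measurableSet_Ioc] with t ht hmem
  have h4 : w t = 0 := by simpa using ht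
  rw [hweq t hmem] at h4
  simp only [hf] at h4
  linarith

/-- A primitive of a function that agrees almost everywhere with a primitive of a continuous `r` is
twice differentiable, with second derivative `r`. -/
theorem hasDerivAt_of_primitive_of_ae_eq {z p r : ℝ → ℝ} {a b C : ℝ} (hab : a < b)
    (hr : ContinuousOn r (Icc a b))
    (hz : ∀ y ∈ Icc a b, z y = z a + ∫ t in a..y, p t)
    (hp : ∀ᵐ t ∂volume.restrict (Ioc a b), p t = C + ∫ s in a..t, r s) :
    ∀ y ∈ Ioo a b, HasDerivAt z (deriv z y) y ∧ HasDerivAt (deriv z) (r y) y := by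
  have hri : IntervalIntegrable r volume a b := hr.intervalIntegrable_of_Icc hab.le
  have hRc := continuousOn_primitive_of_integrable hab.le hri
  have hR' : ∀ y ∈ Ioo a b, HasDerivAt (fun t => ∫ s in a..t, r s) (r y) y := fun y hy =>
    intervalIntegral.integral_hasDerivAt_right
      (hri.mono_set (by
        rw [uIcc_of_le hab.le, uIcc_of_le hy.1.le]; exact Icc_subset_Icc le_rfl hy.2.le))
      ((hr.mono Ioo_subset_Icc_self).stronglyMeasurableAtFilter isOpen_Ioo y hy)
      (hr.continuousAt (Icc_mem_nhds hy.1 hy.2))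
  set g : ℝ → ℝ := fun t => C + ∫ s in a..t, r s with hg
  have hgc : ContinuousOn g (Icc a b) := continuousOn_const.add hRc
  have hzg : ∀ y ∈ Icc a b, z y = z a + ∫ t in a..y, g t := fun y hy => by
    rw [hz y hy]
    congr 1
    rw [intervalIntegral.integral_of_le hy.1, intervalIntegral.integral_of_le hy.1]
    exact setIntegral_congr_ae measurableSet_Ioc
      ((ae_restrict_iff' measurableSet_Ioc).mp
        (ae_restrict_of_ae_restrict_of_subset (Ioc_subset_Ioc_right hy.2) hp))
  have hz' : ∀ y ∈ Ioo a b, HasDerivAt z (g y) y := fun y hy => by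
    have hd := (intervalIntegral.integral_hasDerivAt_right
      ((hgc.intervalIntegrable_of_Icc hab.le).mono_set (by
        rw [uIcc_of_le hab.le, uIcc_of_le hy.1.le]; exact Icc_subset_Icc le_rfl hy.2.le))
      ((hgc.mono Ioo_subset_Icc_self).stronglyMeasurableAtFilter isOpen_Ioo y hy)
      (hgc.continuousAt (Icc_mem_nhds hy.1 hy.2))).const_add (z a)
    refine hd.congr_of_eventuallyEq ?_
    filter_upwards [Icc_mem_nhds hy.1 hy.2] with t ht
    exact hzg t ht
  intro y hy
  refine ⟨(hz' y hy).differentiableAt.hasDerivAt, ?_⟩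
  refine ((hR' y hy).const_add C).congr_of_eventuallyEq ?_
  filter_upwards [Ioo_mem_nhds hy.1 hy.2] with t ht
  exact (hz' t ht).deriv

/-! ### Weak solutions -/

theorem intervalIntegral_eq_of_forall_notMem_eq_zero {E : Type*} [NormedAddCommGroup E]
    [NormedSpace ℝ E] {f : ℝ → E} {a b c d : ℝ} (hab : a ≤ b) (hca : c ≤ a) (hbd : b ≤ d)
    (hf : ∀ t ∈ Ioc c d, t ∉ Ioc a b → f t = 0) : ∫ t in c..d, f t = ∫ t in a..b, f t := by
  rw [intervalIntegral.integral_of_le (hca.trans (hab.trans hbd)),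
    intervalIntegral.integral_of_le hab]
  exact (setIntegral_eq_of_subset_of_forall_sdiff_eq_zero measurableSet_Ioc
    (Ioc_subset_Ioc hca hbd) fun t ht => hf t ht.1 ht.2)

/-- A function supported in `(a, b]` with mean zero has a primitive supported in `(a, b]`; this
turns the test functions of an interval into test functions of the channel. -/
theorem primitive_eq_of_forall_notMem_eq_zero {w : ℝ → ℝ} {a b : ℝ} (ha : -1 ≤ a)
    (hw : ∀ t ∉ Ioc a b, w t = 0) (hw0 : ∫ t in a..b, w t = 0) (hab : a ≤ b) :
    (∀ y ∈ Icc a b, ∫ t in (-1 : ℝ)..y, w t = ∫ t in a..y, w t) ∧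
      ∀ y, -1 ≤ y → y ∉ Ioc a b → ∫ t in (-1 : ℝ)..y, w t = 0 := by
  refine ⟨fun y hy => ?_, fun y hy hn => ?_⟩
  · exact intervalIntegral_eq_of_forall_notMem_eq_zero hy.1 ha le_rfl fun t ht hn =>
      hw t fun h => hn ⟨h.1, ht.2⟩
  · rcases le_or_gt y a with h | h
    · rw [intervalIntegral.integral_of_le hy]
      refine setIntegral_eq_zero_of_forall_eq_zero fun t ht => hw t fun h' => ?_
      linarith [ht.2, h'.1]
    · have hb : b ≤ y := by
        by_contra! hlt
        exact hn ⟨h, hlt.le⟩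
      rw [intervalIntegral_eq_of_forall_notMem_eq_zero hab ha hb fun t _ hn => hw t hn, hw0]

namespace IsH10

variable {ψ ψ' : ℝ → ℂ}

theorem intervalIntegrable (h : IsH10 ψ ψ') : IntervalIntegrable ψ' volume (-1) 1 := by
  rw [intervalIntegrable_iff_integrableOn_Ioc_of_le (by norm_num)]
  exact IntegrableOn.mono_set (h.memLp.integrable one_le_two) Ioc_subset_Icc_self

theorem continuousOn (h : IsH10 ψ ψ') : ContinuousOn ψ (Icc (-1) 1) :=
  (continuousOn_primitive_of_integrable (by norm_num) h.intervalIntegrable).congr h.eq_integral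

theorem left_eq_zero (h : IsH10 ψ ψ') : ψ (-1) = 0 := by
  simpa using h.eq_integral (-1) (by norm_num)

theorem ofReal {z w : ℝ → ℝ} (hw : MemLp w 2 (volume.restrict (Icc (-1 : ℝ) 1)))
    (hz : ∀ y ∈ Icc (-1 : ℝ) 1, z y = ∫ t in (-1 : ℝ)..y, w t) (h1 : z 1 = 0) :
    IsH10 (fun y => (z y : ℂ)) (fun y => (w y : ℂ)) :=
  ⟨hw.ofReal, fun y hy => by rw [hz y hy, intervalIntegral.integral_ofReal],
    by simp [h1]⟩

theorem conj (h : IsH10 ψ ψ') :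
    IsH10 (fun y => (starRingEnd ℂ) (ψ y)) (fun y => (starRingEnd ℂ) (ψ' y)) := by
  refine ⟨?_, fun y hy => ?_, by simp [h.right_eq_zero]⟩
  · exact (Complex.conjCLE.toContinuousLinearMap).comp_memLp' h.memLp
  · rw [h.eq_integral y hy]
    have := (Complex.conjCLE.toContinuousLinearMap).intervalIntegral_comp_comm
      (h.intervalIntegrable.mono_set (a := -1) (b := 1) (c := -1) (d := y) (by
        rw [uIcc_of_le hy.1, uIcc_of_le (by norm_num)]; exact Icc_subset_Icc le_rfl hy.2))
    simpa using this.symm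

end IsH10

/-- The weak form of the eigenvalue equation, for a fixed candidate `ψ` with weak derivative `ψ'`.
-/
def IsWeakSolution (u : ℝ → ℝ) (α c : ℝ) (ψ ψ' : ℝ → ℂ) : Prop :=
  ∀ φ φ' : ℝ → ℂ, IsH10 φ φ' →
      ∃ P : ℂ,
        HasPV (fun y : ℝ => (flowDeriv2 u y : ℂ) * ψ y * φ y / ((u y - c : ℝ) : ℂ)) (-1) 1
          {y | y ∈ Icc (-1 : ℝ) 1 ∧ u y = c} P ∧
        (∫ y in (-1 : ℝ)..1, (ψ' y * φ' y + (α : ℂ) ^ 2 * ψ y * φ y)) + P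
          + Complex.I * (Real.pi : ℂ) *
            (∑ᶠ y ∈ {y : ℝ | y ∈ Icc (-1 : ℝ) 1 ∧ u y = c ∧ flowDeriv u y ≠ 0},
              (flowDeriv2 u y : ℂ) * ψ y * φ y / ((|flowDeriv u y| : ℝ) : ℂ)) = 0

/-- The jet `U` represents the flow `u` and its first two one-sided derivatives on the channel. -/
structure IsProfile (u : ℝ → ℝ) (U : ℕ → ℝ → ℝ) : Prop extends ProfileJet U where
  eqOn : EqOn u (U 0) (Icc (-1) 1)
  eqOn_deriv : EqOn (flowDeriv u) (U 1) (Icc (-1) 1)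
  eqOn_deriv2 : EqOn (flowDeriv2 u) (U 2) (Icc (-1) 1)

namespace IsProfile

variable {u : ℝ → ℝ} {U : ℕ → ℝ → ℝ} {α yc : ℝ} {ψ ψ' : ℝ → ℂ}

theorem crit_eq (hu : IsProfile u U) (hyc : yc ∈ Ioo (0 : ℝ) 1) :
    {y | y ∈ Icc (-1 : ℝ) 1 ∧ u y = U 0 yc} = {yc, -yc} := by
  have hyc' := Ioo_subset_Icc_self hyc
  ext y
  simp only [mem_ofPred_eq, mem_insert_iff, mem_singleton_iff]
  constructor
  · rintro ⟨hy, h⟩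
    rw [hu.eqOn hy] at h
    rcases le_total 0 y with hp | hp
    · exact Or.inl (hu.injOn ⟨hp, hy.2⟩ hyc' h)
    · rw [← hu.even y hy] at h
      have := hu.injOn (x₁ := -y) ⟨by linarith, by linarith [hy.1]⟩ hyc' h
      right; linarith
  · have h1 : yc ∈ Icc (-1 : ℝ) 1 := ⟨by linarith [hyc.1], hyc.2.le⟩
    have h2 : -yc ∈ Icc (-1 : ℝ) 1 := ⟨by linarith [hyc.2], by linarith [hyc.1]⟩
    rintro (rfl | rfl)
    · exact ⟨h1, hu.eqOn h1⟩
    · exact ⟨h2, by rw [hu.eqOn h2, hu.even yc h1]⟩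

theorem crit_deriv_eq (hu : IsProfile u U) (hyc : yc ∈ Ioo (0 : ℝ) 1) :
    {y | y ∈ Icc (-1 : ℝ) 1 ∧ u y = U 0 yc ∧ flowDeriv u y ≠ 0} = {yc, -yc} := by
  have h1 : yc ∈ Ioo (-1 : ℝ) 1 := ⟨by linarith [hyc.1], hyc.2⟩
  have h2 : -yc ∈ Ioo (-1 : ℝ) 1 := ⟨by linarith [hyc.2], by linarith [hyc.1]⟩
  have hU1 : U 1 yc ≠ 0 := (hu.deriv_pos yc (Ioo_subset_Ioc_self hyc)).ne'
  rw [← hu.crit_eq hyc]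
  ext y
  simp only [mem_ofPred_eq]
  refine ⟨fun h => ⟨h.1, h.2.1⟩, fun h => ⟨h.1, h.2, ?_⟩⟩
  have : y ∈ ({yc, -yc} : Set ℝ) := by rw [← hu.crit_eq hyc]; exact h
  rw [hu.eqOn_deriv h.1]
  rcases this with rfl | rfl
  · exact hU1
  · rw [hu.deriv_odd h1]; exact neg_ne_zero.mpr hU1

/-- The critical-layer sum vanishes if `u''(±yc) = 0` or if the test function vanishes at both
critical points. -/
theorem finsum_eq_zero (hu : IsProfile u U) (hyc : yc ∈ Ioo (0 : ℝ) 1) {φ : ℝ → ℂ}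
    (h : U 2 yc = 0 ∨ φ yc = 0 ∧ φ (-yc) = 0) :
    ∑ᶠ y ∈ {y : ℝ | y ∈ Icc (-1 : ℝ) 1 ∧ u y = U 0 yc ∧ flowDeriv u y ≠ 0},
      (flowDeriv2 u y : ℂ) * ψ y * φ y / ((|flowDeriv u y| : ℝ) : ℂ) = 0 := by
  have h1 : yc ∈ Ioo (-1 : ℝ) 1 := ⟨by linarith [hyc.1], hyc.2⟩
  have h2 : -yc ∈ Ioo (-1 : ℝ) 1 := ⟨by linarith [hyc.2], by linarith [hyc.1]⟩
  rw [hu.crit_deriv_eq hyc, finsum_mem_pair (by linarith [hyc.1]),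
    hu.eqOn_deriv2 (Ioo_subset_Icc_self h1), hu.eqOn_deriv2 (Ioo_subset_Icc_self h2),
    hu.deriv2_even h1]
  rcases h with h | ⟨h, h'⟩
  · simp [h]
  · simp [h, h']

/-- Regularity: on an interval where `α² + u'' / (u - c)` has a continuous version `q`, a
real-linear functional `L` of a weak solution (in practice its real or imaginary part) solves
`z'' = q z` in the classical sense. -/
theorem ode_of_weak (hu : IsProfile u U) (hyc : yc ∈ Ioo (0 : ℝ) 1) (hψ : IsH10 ψ ψ')
    (hweak : IsWeakSolution u α (U 0 yc) ψ ψ') {a b : ℝ} (hab : a < b) (ha : -1 ≤ a) (hb : b ≤ 1)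
    {q : ℝ → ℝ} (hqc : ContinuousOn q (Icc a b))
    (hq : ∀ y ∈ Ioo a b, y ≠ yc → y ≠ -yc → (U 0 y - U 0 yc) * (q y - α ^ 2) = U 2 y)
    (hcrit : U 2 yc = 0 ∨ yc ∉ Ioc a b ∧ -yc ∉ Ioc a b) (L : ℂ →L[ℝ] ℝ) :
    ∀ y ∈ Ioo a b, HasDerivAt (fun y => L (ψ y)) (deriv (fun y => L (ψ y)) y) y ∧
      HasDerivAt (deriv (fun y => L (ψ y))) (q y * L (ψ y)) y := by
  have hsub : Icc a b ⊆ Icc (-1) 1 := Icc_subset_Icc ha hb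
  have hψc : ContinuousOn ψ (Icc a b) := hψ.continuousOn.mono hsub
  have hzc : ContinuousOn (fun y => L (ψ y)) (Icc a b) := L.continuous.comp_continuousOn hψc
  have hm : MemLp ψ' 2 (volume.restrict (Ioc a b)) :=
    hψ.memLp.mono_measure (Measure.restrict_mono (Ioc_subset_Icc_self.trans hsub) le_rfl)
  have hsm : ∀ (x : ℝ) (z : ℂ), L (z * (x : ℂ)) = L z * x := fun x z => by
    rw [mul_comm, ← Complex.real_smul, map_smul, smul_eq_mul, mul_comm]
  have hint : ∀ y ∈ Icc a b, IntervalIntegrable ψ' volume a y := fun y hy =>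
    hψ.intervalIntegrable.mono_set (by
      rw [uIcc_of_le hy.1, uIcc_of_le (by norm_num)]
      exact Icc_subset_Icc ha (hy.2.trans hb))
  have hprim : ∀ y ∈ Icc a b, L (ψ y) = L (ψ a) + ∫ t in a..y, L (ψ' t) := by
    intro y hy
    rw [L.intervalIntegral_comp_comm (hint y hy), ← map_add, hψ.eq_integral y (hsub hy),
      hψ.eq_integral a (hsub ⟨le_rfl, hab.le⟩), intervalIntegral.integral_add_adjacent_intervals
      (hψ.intervalIntegrable.mono_set (by
        rw [uIcc_of_le ha, uIcc_of_le (by norm_num)]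
        exact Icc_subset_Icc le_rfl (hab.le.trans hb))) (hint y hy)]
  have hdbr := du_bois_reymond (p := fun y => L (ψ' y)) (r := fun y => q y * L (ψ y)) hab
    (L.comp_memLp' hm) (hqc.mul hzc) ?_
  · obtain ⟨C, hC⟩ := hdbr
    exact hasDerivAt_of_primitive_of_ae_eq hab (hqc.mul hzc) hprim hC
  intro w hwm hw hw0
  -- Real test functions supported in `(a, b]` suffice.
  set W : ℝ → ℝ := fun y => ∫ t in (-1 : ℝ)..y, w t with hW
  obtain ⟨hWin, hWout⟩ := primitive_eq_of_forall_notMem_eq_zero ha hw hw0 hab.le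
  have hW1 : W 1 = 0 := by
    rcases hb.eq_or_lt with rfl | hlt
    · exact (hWin _ ⟨hab.le, le_rfl⟩).trans hw0
    · exact hWout 1 (by norm_num) fun h => by linarith [h.2]
  have hwi : IntervalIntegrable w volume a b := by
    rw [intervalIntegrable_iff_integrableOn_Ioc_of_le hab.le]
    exact (hwm.restrict _).integrable one_le_two
  have hWc : ContinuousOn W (Icc a b) :=
    (continuousOn_primitive_of_integrable hab.le hwi).congr hWin
  obtain ⟨P, hP, heq⟩ := hweak _ _ (IsH10.ofReal (z := W) (hwm.restrict _) (fun y _ => rfl) hW1)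
  rw [hu.finsum_eq_zero hyc (hcrit.imp_right fun h =>
    ⟨by rw [Complex.ofReal_eq_zero]; exact hWout _ (by linarith [hyc.1]) h.1,
      by rw [Complex.ofReal_eq_zero]; exact hWout _ (by linarith [hyc.2]) h.2⟩),
    mul_zero, add_zero] at heq
  set f : ℝ → ℂ := fun y => (flowDeriv2 u y : ℂ) * ψ y * (W y : ℂ) / ((u y - U 0 yc : ℝ) : ℂ)
    with hf
  set g : ℝ → ℂ := fun y => ((q y - α ^ 2 : ℝ) : ℂ) * ψ y * (W y : ℂ) with hg
  have hgc : ContinuousOn g (Icc a b) :=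
    ((Complex.continuous_ofReal.comp_continuousOn (hqc.sub continuousOn_const)).mul hψc).mul
      (Complex.continuous_ofReal.comp_continuousOn hWc)
  have hgi : IntegrableOn g (Ioc a b) :=
    (hgc.integrableOn_compact isCompact_Icc).mono_set Ioc_subset_Icc_self
  -- The quotient `0 / 0 = 0` at the critical points, and the endpoint `b` where `hq` says nothing,
  -- are excluded as a null set.
  have hfg : f =ᵐ[volume.restrict (Icc (-1) 1)] (Ioc a b).indicator g := by
    have hfin : ({b, yc, -yc} : Set ℝ).Finite := by simp
    filter_upwards [ae_restrict_of_ae (measure_eq_zero_iff_ae_notMem.mp (hfin.measure_zero volume)),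
      ae_restrict_mem measurableSet_Icc] with y hyn hy
    simp only [mem_insert_iff, mem_singleton_iff, not_or] at hyn
    by_cases hyab : y ∈ Ioc a b
    · have hne : u y - U 0 yc ≠ 0 := fun h0 => by
        have : y ∈ ({yc, -yc} : Set ℝ) := by
          rw [← hu.crit_eq hyc]; exact ⟨hy, sub_eq_zero.mp h0⟩
        rcases this with h | h
        · exact hyn.2.1 h
        · exact hyn.2.2 h
      have e := hq y ⟨hyab.1, lt_of_le_of_ne hyab.2 hyn.1⟩ hyn.2.1 hyn.2.2
      have hne' : ((u y - U 0 yc : ℝ) : ℂ) ≠ 0 := Complex.ofReal_ne_zero.mpr hne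
      rw [indicator_of_mem hyab, hf, hg]
      simp only
      rw [div_eq_iff hne', hu.eqOn_deriv2 hy, ← e, ← hu.eqOn hy]
      push_cast
      ring
    · rw [indicator_of_notMem hyab, hf]
      simp only
      rw [hW]
      simp only
      rw [hWout y hy.1 hyab]
      simp
  have hfi : IntegrableOn f (Icc (-1) 1) := by
    refine Integrable.congr ?_ hfg.symm
    exact ((integrable_indicator_iff measurableSet_Ioc).mpr hgi).restrict
  have hPf : P = ∫ y in a..b, g y := by
    rw [hP.unique (hasPV_of_integrableOn (by norm_num)
      (by rw [hu.crit_eq hyc]; simp) hfi), intervalIntegral.integral_of_le (by norm_num),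
      ← integral_Icc_eq_integral_Ioc, integral_congr_ae hfg,
      setIntegral_indicator measurableSet_Ioc,
      inter_eq_self_of_subset_right (Ioc_subset_Icc_self.trans hsub),
      intervalIntegral.integral_of_le hab.le]
  have hfirst : ∫ y in (-1 : ℝ)..1, (ψ' y * (w y : ℂ) + (α : ℂ) ^ 2 * ψ y * (W y : ℂ)) =
      ∫ y in a..b, (ψ' y * (w y : ℂ) + (α : ℂ) ^ 2 * ψ y * (W y : ℂ)) :=
    intervalIntegral_eq_of_forall_notMem_eq_zero hab.le ha hb fun t ht hn => by
      rw [hw t hn, hW]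
      simp only
      rw [hWout t ht.1.le hn]
      simp
  have hi1 : IntervalIntegrable (fun y => ψ' y * (w y : ℂ)) volume a b := by
    rw [intervalIntegrable_iff_integrableOn_Ioc_of_le hab.le]
    exact hm.integrable_mul ((hwm.restrict _).ofReal)
  have hi2 : IntervalIntegrable (fun y => (α : ℂ) ^ 2 * ψ y * (W y : ℂ)) volume a b :=
    ContinuousOn.intervalIntegrable_of_Icc hab.le ((continuousOn_const.mul hψc).mul
      (Complex.continuous_ofReal.comp_continuousOn hWc))
  have hi3 : IntervalIntegrable g volume a b := hgc.intervalIntegrable_of_Icc hab.le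
  rw [hfirst, hPf, intervalIntegral.integral_add hi1 hi2, add_assoc,
    ← intervalIntegral.integral_add hi2 hi3] at heq
  have hL := congrArg L heq
  rw [map_add, map_zero, ← L.intervalIntegral_comp_comm hi1,
    ← L.intervalIntegral_comp_comm (hi2.add hi3)] at hL
  rw [← hL]
  congr 1
  · exact intervalIntegral.integral_congr fun y _ => (hsm _ _).symm
  · refine intervalIntegral.integral_congr fun y hy => ?_
    rw [uIcc_of_le hab.le] at hy
    have : (α : ℂ) ^ 2 * ψ y * (W y : ℂ) + g y = ψ y * ((q y * W y : ℝ) : ℂ) := by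
      rw [hg]; push_cast; ring
    rw [this, hsm, ← hWin y hy]
    ring

/-- Testing with the conjugate of `ψ` makes the Dirichlet integral and the principal value real, so
the critical-layer sum, whose terms all have the sign of `u''(yc)`, has to vanish. -/
theorem critical_values_eq_zero (hu : IsProfile u U) (hyc : yc ∈ Ioo (0 : ℝ) 1)
    (hψ : IsH10 ψ ψ') (hweak : IsWeakSolution u α (U 0 yc) ψ ψ') (h2 : U 2 yc ≠ 0) :
    ψ yc = 0 ∧ ψ (-yc) = 0 := by
  have h1 : yc ∈ Ioo (-1 : ℝ) 1 := ⟨by linarith [hyc.1], hyc.2⟩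
  have h1' : -yc ∈ Ioo (-1 : ℝ) 1 := ⟨by linarith [hyc.2], by linarith [hyc.1]⟩
  have hU1 : 0 < U 1 yc := hu.deriv_pos yc (Ioo_subset_Ioc_self hyc)
  obtain ⟨P, hP, heq⟩ := hweak _ _ hψ.conj
  have hi : (∫ y in (-1 : ℝ)..1, (ψ' y * (starRingEnd ℂ) (ψ' y) +
      (α : ℂ) ^ 2 * ψ y * (starRingEnd ℂ) (ψ y))).im = 0 := by
    have : ∀ y, ψ' y * (starRingEnd ℂ) (ψ' y) + (α : ℂ) ^ 2 * ψ y * (starRingEnd ℂ) (ψ y) =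
        ((Complex.normSq (ψ' y) + α ^ 2 * Complex.normSq (ψ y) : ℝ) : ℂ) := fun y => by
      rw [mul_assoc, Complex.mul_conj, Complex.mul_conj]; push_cast; ring
    simp only [this]
    rw [intervalIntegral.integral_ofReal, Complex.ofReal_im]
  have hPim : P.im = 0 := by
    have e : ∀ y, (flowDeriv2 u y : ℂ) * ψ y * (starRingEnd ℂ) (ψ y) / ((u y - U 0 yc : ℝ) : ℂ) =
        ((flowDeriv2 u y * Complex.normSq (ψ y) / (u y - U 0 yc) : ℝ) : ℂ) := fun y => by
      rw [mul_assoc, Complex.mul_conj]; push_cast; ring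
    have ht := (Complex.continuous_im.tendsto P).comp hP.2
    simp only [Function.comp_def, e, integral_complex_ofReal, Complex.ofReal_im] at ht
    exact tendsto_nhds_unique ht tendsto_const_nhds
  rw [hu.crit_deriv_eq hyc, finsum_mem_pair (by linarith [hyc.1]),
    hu.eqOn_deriv2 (Ioo_subset_Icc_self h1), hu.eqOn_deriv2 (Ioo_subset_Icc_self h1'),
    hu.eqOn_deriv (Ioo_subset_Icc_self h1), hu.eqOn_deriv (Ioo_subset_Icc_self h1'),
    hu.deriv2_even h1, hu.deriv_odd h1, abs_neg, abs_of_pos hU1, mul_assoc,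
    mul_assoc (U 2 yc : ℂ) (ψ yc), mul_assoc (U 2 yc : ℂ) (ψ (-yc)), Complex.mul_conj,
    Complex.mul_conj] at heq
  have hs : (U 2 yc : ℂ) * (Complex.normSq (ψ yc) : ℂ) / (U 1 yc : ℂ) +
      (U 2 yc : ℂ) * (Complex.normSq (ψ (-yc)) : ℂ) / (U 1 yc : ℂ) =
      ((U 2 yc / U 1 yc * (Complex.normSq (ψ yc) + Complex.normSq (ψ (-yc))) : ℝ) : ℂ) := by
    push_cast; ring
  rw [hs] at heq
  have him := congrArg Complex.im heq
  rw [Complex.add_im, Complex.add_im, hi, hPim, ← Complex.ofReal_mul, Complex.I_mul_im,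
    Complex.ofReal_re, Complex.zero_im] at him
  have hne : Real.pi * (U 2 yc / U 1 yc) ≠ 0 :=
    mul_ne_zero Real.pi_ne_zero (div_ne_zero h2 hU1.ne')
  have hsum : Complex.normSq (ψ yc) + Complex.normSq (ψ (-yc)) = 0 := by
    apply mul_left_cancel₀ hne
    linarith
  have n1 := Complex.normSq_nonneg (ψ yc)
  have n2 := Complex.normSq_nonneg (ψ (-yc))
  exact ⟨Complex.normSq_eq_zero.mp (by linarith), Complex.normSq_eq_zero.mp (by linarith)⟩

end IsProfile

/-! ### The dispersion relation -/

theorem IsSymmetricFlow.exists_isProfile {u : ℝ → ℝ} (hu : IsSymmetricFlow u) :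
    ∃ U : ℕ → ℝ → ℝ, IsProfile u U := by
  obtain ⟨U, H, h0, h1, h2⟩ := hu.exists_jet
  exact ⟨U, H, h0, h1, h2⟩

theorem RegularJet.isRegular {u : ℝ → ℝ} {U : ℕ → ℝ → ℝ} {α yc : ℝ} {Φ Φ' Φ'' : ℝ → ℝ}
    (R : RegularJet U α yc Φ Φ' Φ'') (hu : IsProfile u U) (hyc : yc ∈ Ioo (0 : ℝ) 1) :
    IsRegularRayleighSolution u α (U 0 yc) yc Φ := by
  have hs : Icc (0 : ℝ) 1 ⊆ Icc (-1) 1 := Icc_subset_Icc (by norm_num) le_rfl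
  have hun : UniqueDiffOn ℝ (Icc (0 : ℝ) 1) := uniqueDiffOn_Icc zero_lt_one
  have hd : deriv Φ = Φ' := funext fun y => (R.hasDerivAt y).deriv
  have hd' : deriv Φ' = Φ'' := funext fun y => (R.hasDerivAt' y).deriv
  have hc1 : ContDiff ℝ 1 Φ' := contDiff_one_iff_deriv.mpr
    ⟨fun y => (R.hasDerivAt' y).differentiableAt, by rw [hd']; exact R.continuous''⟩
  have hc2 : ContDiff ℝ 2 Φ := by
    rw [show (2 : WithTop ℕ∞) = 1 + 1 by norm_num, contDiff_succ_iff_deriv]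
    exact ⟨fun y => (R.hasDerivAt y).differentiableAt, by simp, by rw [hd]; exact hc1⟩
  refine ⟨hc2.contDiffOn, fun y hy => ?_, R.eq_zero, ?_⟩
  · rw [iteratedDerivWithin_eq_iteratedDeriv hun hc2.contDiffAt hy, iteratedDeriv_succ,
      iteratedDeriv_one, hd, hd', hu.eqOn (hs hy), hu.eqOn_deriv2 (hs hy)]
    exact R.equation y hy
  · rw [(R.hasDerivAt yc).hasDerivWithinAt.derivWithin (hun yc (Ioo_subset_Icc_self hyc)),
      R.deriv_eq, hu.eqOn_deriv (hs (Ioo_subset_Icc_self hyc))]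

theorem IsRegularRayleighSolution.exists_jet {u φ : ℝ → ℝ} {U : ℕ → ℝ → ℝ} {α yc : ℝ}
    (h : IsRegularRayleighSolution u α (U 0 yc) yc φ) (hu : IsProfile u U)
    (hyc : yc ∈ Ioo (0 : ℝ) 1) :
    ∃ Φ Φ' Φ'' : ℝ → ℝ, RegularJet U α yc Φ Φ' Φ'' ∧ EqOn φ Φ (Icc 0 1) := by
  have hs : Icc (0 : ℝ) 1 ⊆ Icc (-1) 1 := Icc_subset_Icc (by norm_num) le_rfl
  obtain ⟨F, hF, hc, he⟩ := ContDiffOn.exists_jet zero_lt_one 2 h.contDiffOn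
  have h0 : EqOn φ (F 0) (Icc 0 1) := fun y hy => by simpa using he 0 (by norm_num) hy
  have hyc' := Ioo_subset_Icc_self hyc
  refine ⟨F 0, F 1, F 2, ⟨hF 0 (by norm_num), hF 1 (by norm_num), hc, fun y hy => ?_, ?_, ?_⟩, h0⟩
  · have := h.equation y hy
    rwa [he 2 le_rfl hy, h0 hy, hu.eqOn (hs hy), hu.eqOn_deriv2 (hs hy)] at this
  · rw [← h0 hyc', h.eq_zero]
  · rw [← he 1 (by norm_num) hyc', iteratedDerivWithin_one, h.deriv_eq,
      hu.eqOn_deriv (hs hyc')]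

namespace IsProfile

variable {u : ℝ → ℝ} {U : ℕ → ℝ → ℝ} {α yc : ℝ} {Φ Φ' Φ'' φ : ℝ → ℝ}

theorem critSet_congr (hu : IsProfile u U) (c : ℝ) : critSet u c = critSet (U 0) c := by
  ext y
  simp only [critSet, mem_ofPred_eq]
  refine and_congr_right fun hy => ?_
  rw [hu.eqOn ⟨by linarith [hy.1], hy.2⟩]

theorem setIntegral_recip_congr (hu : IsProfile u U) (c ε : ℝ) :
    ∫ y in pvDomain 0 1 (critSet u c) ε, 1 / (u y - c) =
      ∫ y in pvDomain 0 1 (critSet (U 0) c) ε, 1 / (U 0 y - c) := by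
  rw [hu.critSet_congr]
  refine setIntegral_congr_fun (isCompact_pvDomain _ _ _ _).isClosed.measurableSet fun y hy => ?_
  rw [hu.eqOn ⟨by linarith [hy.1.1], hy.1.2⟩]

theorem pvRecip_congr (hu : IsProfile u U) (c : ℝ) : pvRecip u c = pvRecip (U 0) c := by
  simp only [pvRecip, hu.setIntegral_recip_congr]

theorem hasPV_pvRecip (hu : IsProfile u U) {c : ℝ} (hc : c ∈ Ioo (U 0 0) (U 0 1)) :
    HasPV (fun y => 1 / (u y - c)) 0 1 (critSet u c) (pvRecip u c) := by
  obtain ⟨p, hp, rfl⟩ := intermediate_value_Ioo zero_le_one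
    (hu.continuous (k := 0) (by norm_num)).continuousOn hc
  have hp2 : p ∈ Ioo (p / 2) 1 := ⟨by linarith [hp.1], hp.2⟩
  have h := hu.hasPV_recip (half_pos hp.1) hp2
  rw [← hu.pvRecip_eq (half_pos hp.1) hp2] at h
  refine ⟨fun ε hε => ?_, ?_⟩
  · rw [hu.critSet_congr]
    refine (h.1 ε hε).congr_fun (fun y hy => ?_) (isCompact_pvDomain _ _ _ _).isClosed.measurableSet
    simp only
    rw [hu.eqOn ⟨by linarith [hy.1.1], hy.1.2⟩]
  · simp only [hu.setIntegral_recip_congr, hu.pvRecip_congr]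
    exact h.2

theorem integrandII3_congr (hu : IsProfile u U) (hφ : EqOn φ Φ (Icc 0 1)) (c : ℝ) :
    EqOn (integrandII3 u c φ) (integrandII3 (U 0) c Φ) (Icc 0 1) := fun y hy => by
  simp only [integrandII3, phi1]
  rw [hu.eqOn ⟨by linarith [hy.1], hy.2⟩, hφ hy]

theorem quantII3_congr (hu : IsProfile u U) (hφ : EqOn φ Φ (Icc 0 1)) (c : ℝ) :
    quantII3 u c φ = quantII3 (U 0) c Φ :=
  intervalIntegral.integral_congr fun y hy => by
    rw [uIcc_of_le zero_le_one] at hy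
    exact hu.integrandII3_congr hφ c hy

theorem phi1_hasDerivWithinAt_zero (hu : IsProfile u U) (R : RegularJet U α yc Φ Φ' Φ'')
    (hφ : EqOn φ Φ (Icc 0 1)) (hyc : yc ∈ Ioo (0 : ℝ) 1) :
    HasDerivWithinAt (phi1 u (U 0 yc) φ) (Φ' 0 / (U 0 0 - U 0 yc)) (Icc 0 1) 0 := by
  have hz : (0 : ℝ) ∈ Icc (0 : ℝ) 1 := ⟨le_rfl, zero_le_one⟩
  have hs := hu.speed_sub_ne_zero hyc hz hyc.1.ne
  have hd := (R.hasDerivAt 0).fun_div ((hu.hasDerivAt 0 (by norm_num) 0).sub_const (U 0 yc)) hs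
  refine (hd.congr_deriv ?_).hasDerivWithinAt.congr_of_mem (fun y hy => ?_) hz
  · rw [zero_add, hu.deriv_zero]
    field_simp
    ring
  · rw [phi1, hu.eqOn ⟨by linarith [hy.1], hy.2⟩, hφ hy]

theorem phi1_zero (hu : IsProfile u U) (hφ : EqOn φ Φ (Icc 0 1)) :
    phi1 u (U 0 yc) φ 0 = Φ 0 / (U 0 0 - U 0 yc) := by
  rw [phi1, hu.eqOn (by norm_num), hφ ⟨le_rfl, zero_le_one⟩]

theorem phi1Deriv0_eq (hu : IsProfile u U) (R : RegularJet U α yc Φ Φ' Φ'')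
    (hφ : EqOn φ Φ (Icc 0 1)) (hyc : yc ∈ Ioo (0 : ℝ) 1) :
    phi1Deriv0 u (U 0 yc) φ = Φ' 0 / (U 0 0 - U 0 yc) :=
  (hu.phi1_hasDerivWithinAt_zero R hφ hyc).derivWithin
    (uniqueDiffOn_Icc zero_lt_one 0 ⟨le_rfl, zero_le_one⟩)

theorem quantitiesWellDefined (hu : IsProfile u U) (R : RegularJet U α yc Φ Φ' Φ'')
    (hφ : EqOn φ Φ (Icc 0 1)) (hα : α ≠ 0) (hyc : yc ∈ Ioo (0 : ℝ) 1) :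
    QuantitiesWellDefined u (U 0 yc) φ := by
  have hz : (0 : ℝ) ∈ Icc (0 : ℝ) 1 := ⟨le_rfl, zero_le_one⟩
  have hs := hu.speed_sub_ne_zero hyc hz hyc.1.ne
  refine ⟨fun c hc => ?_, ?_, ?_, (hu.phi1_hasDerivWithinAt_zero R hφ hyc).differentiableWithinAt,
    ?_, ?_⟩
  · rw [hu.eqOn (by norm_num), hu.eqOn (by norm_num)] at hc
    exact hu.hasPV_pvRecip hc
  · simp only [hu.pvRecip_congr]
    exact (hu.hasDerivAt_pvRecip (half_pos hyc.1)
      ⟨by linarith [hyc.1], hyc.2⟩).differentiableAt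
  · refine (R.integrandII3_integrable hu.toProfileJet hyc).congr fun y hy => ?_
    rw [uIoc_of_le zero_le_one] at hy
    exact (hu.integrandII3_congr hφ _ (Ioc_subset_Icc_self hy)).symm
  · rw [hu.phi1_zero hφ]
    exact div_ne_zero (R.ne_zero hu.toProfileJet hyc hz hyc.1.ne) hs
  · rw [hu.phi1Deriv0_eq R hφ hyc]
    exact div_ne_zero (R.deriv_left_ne_zero hu.toProfileJet hα hyc) hs

/-- In terms of `K = ∂_c p.v. ∫₀¹ 1 / (u - c) + II₃`, the quantity `A` is a nonzero multiple of `K`,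
`A₂` is a nonzero multiple of `φ(0) φ'(0) K - 1`, and `B`, `B₂` are nonzero multiples of `u''(yc)`.
-/
theorem dispersion_iff (hu : IsProfile u U) (R : RegularJet U α yc Φ Φ' Φ'')
    (hφ : EqOn φ Φ (Icc 0 1)) (hα : α ≠ 0) (hyc : yc ∈ Ioo (0 : ℝ) 1) {K : ℝ}
    (hK : K = deriv (fun c => pvRecip (U 0) c) (U 0 yc) + quantII3 (U 0) (U 0 yc) Φ) :
    (quantA u (U 0 yc) yc φ ^ 2 + quantB u (U 0 yc) yc ^ 2 = 0 ∨
      quantA2 u (U 0 yc) yc φ ^ 2 + quantB2 u (U 0 yc) yc ^ 2 = 0) ↔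
      U 2 yc = 0 ∧ (K = 0 ∨ Φ 0 * Φ' 0 * K = 1) := by
  have H := hu.toProfileJet
  have hz : (0 : ℝ) ∈ Icc (0 : ℝ) 1 := ⟨le_rfl, zero_le_one⟩
  have hyc' := Ioo_subset_Icc_self hyc
  have hycm : yc ∈ Icc (-1 : ℝ) 1 := ⟨by linarith [hyc.1], hyc.2.le⟩
  have hl : U 0 yc - U 0 0 ≠ 0 := (sub_pos.mpr (H.strictMonoOn hz hyc' hyc.1)).ne'
  have hl' : U 0 0 - U 0 yc ≠ 0 := H.speed_sub_ne_zero hyc hz hyc.1.ne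
  have hr : U 0 1 - U 0 yc ≠ 0 :=
    (sub_pos.mpr (H.strictMonoOn hyc' ⟨zero_le_one, le_rfl⟩ hyc.2)).ne'
  have hU1 : U 1 yc ≠ 0 := (H.deriv_pos yc (Ioo_subset_Ioc_self hyc)).ne'
  have hΦ := R.ne_zero H hyc hz hyc.1.ne
  have hΦ' := R.deriv_left_ne_zero H hα hyc
  have hu0 : u 0 = U 0 0 := hu.eqOn (by norm_num)
  have hu1 : u 1 = U 0 1 := hu.eqOn (by norm_num)
  have hA : quantA u (U 0 yc) yc φ =
      (U 0 yc - U 0 0) * (U 0 1 - U 0 yc) * U 1 yc * K := by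
    simp only [quantA, quantA1, rho, hu.pvRecip_congr, hu.quantII3_congr hφ, hu0, hu1,
      hu.eqOn_deriv hycm, hK]
    ring
  have hB : quantB u (U 0 yc) yc =
      Real.pi * ((U 0 yc - U 0 0) * (U 0 1 - U 0 yc)) * (U 2 yc / U 1 yc ^ 2) := by
    simp only [quantB, rho, hu0, hu1, hu.eqOn_deriv hycm, hu.eqOn_deriv2 hycm]
  have hA2 : quantA2 u (U 0 yc) yc φ =
      -((U 0 0 - U 0 yc) ^ 2 * (U 0 1 - U 0 yc) * U 1 yc / (Φ 0 * Φ' 0)) *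
        (Φ 0 * Φ' 0 * K - 1) := by
    simp only [quantA2, quantJ, hA, hu.phi1_zero hφ, hu.phi1Deriv0_eq R hφ hyc, hu0, hu1,
      hu.eqOn_deriv hycm]
    field_simp
    ring
  have hB0 : quantB u (U 0 yc) yc = 0 ↔ U 2 yc = 0 := by
    rw [hB]
    simp [hl, hr, hU1, Real.pi_ne_zero]
  have hB20 : quantB2 u (U 0 yc) yc = 0 ↔ U 2 yc = 0 := by
    rw [quantB2, ← hB0, mul_eq_zero, hu0]
    simp [hl']
  have hA0 : quantA u (U 0 yc) yc φ = 0 ↔ K = 0 := by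
    rw [hA]
    simp [hl, hr, hU1]
  have hA20 : quantA2 u (U 0 yc) yc φ = 0 ↔ Φ 0 * Φ' 0 * K = 1 := by
    rw [hA2, mul_eq_zero, neg_eq_zero, sub_eq_zero]
    simp [hl', hr, hU1, hΦ, hΦ']
  have hsq : ∀ x y : ℝ, x ^ 2 + y ^ 2 = 0 ↔ x = 0 ∧ y = 0 := fun x y => by
    refine ⟨fun h => ⟨?_, ?_⟩, fun h => by simp [h.1, h.2]⟩
    · exact pow_eq_zero_iff two_ne_zero |>.mp (by nlinarith [sq_nonneg x, sq_nonneg y])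
    · exact pow_eq_zero_iff two_ne_zero |>.mp (by nlinarith [sq_nonneg x, sq_nonneg y])
  rw [hsq, hsq, hA0, hB0, hA20, hB20]
  tauto

/-- Away from the critical points weak solutions are classical, by applying `ode_of_weak` on small
intervals. -/
theorem channelSolution_of_weak (hu : IsProfile u U) (hyc : yc ∈ Ioo (0 : ℝ) 1) {ψ ψ' : ℝ → ℂ}
    (hψ : IsH10 ψ ψ') (hweak : IsWeakSolution u α (U 0 yc) ψ ψ') (L : ℂ →L[ℝ] ℝ) :
    ChannelSolution U α yc (fun y => L (ψ y)) (deriv fun y => L (ψ y))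
      (fun y => (α ^ 2 + U 2 y / (U 0 y - U 0 yc)) * L (ψ y)) := by
  have hU := hu.continuous (k := 0) (by norm_num)
  have hU2 := hu.continuous (k := 2) (by norm_num)
  have hne : ∀ y ∈ Icc (-1 : ℝ) 1, y ≠ yc → y ≠ -yc → U 0 y - U 0 yc ≠ 0 := fun y hy h1 h2 h0 => by
    have : y ∈ ({yc, -yc} : Set ℝ) := by
      rw [← hu.crit_eq hyc]
      exact ⟨hy, by rw [hu.eqOn hy]; exact sub_eq_zero.mp h0⟩
    rcases this with h | h
    · exact h1 h
    · exact h2 h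
  have key : ∀ y ∈ Ioo (-1 : ℝ) 1, y ≠ yc → y ≠ -yc →
      HasDerivAt (fun y => L (ψ y)) (deriv (fun y => L (ψ y)) y) y ∧
      HasDerivAt (deriv (fun y => L (ψ y)))
        ((α ^ 2 + U 2 y / (U 0 y - U 0 yc)) * L (ψ y)) y := by
    intro y hy h1 h2
    have hopen : IsOpen (Ioo (-1 : ℝ) 1 ∩ {yc}ᶜ ∩ {-yc}ᶜ) :=
      (isOpen_Ioo.inter isOpen_compl_singleton).inter isOpen_compl_singleton
    obtain ⟨ε, hε, hball⟩ := Metric.nhds_basis_closedBall.mem_iff.mp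
      (hopen.mem_nhds ⟨⟨hy, h1⟩, h2⟩)
    rw [Real.closedBall_eq_Icc] at hball
    have hlt : y - ε < y + ε := by linarith
    refine hu.ode_of_weak hyc hψ hweak hlt (hball ⟨le_rfl, hlt.le⟩).1.1.1.le
      (hball ⟨hlt.le, le_rfl⟩).1.1.2.le (q := fun y => α ^ 2 + U 2 y / (U 0 y - U 0 yc)) ?_ ?_ ?_
      L y ⟨by linarith, by linarith⟩
    · exact continuousOn_const.add (hU2.continuousOn.div (hU.sub continuous_const).continuousOn
        fun t ht => hne t (Ioo_subset_Icc_self (hball ht).1.1) (hball ht).1.2 (hball ht).2)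
    · intro t ht ht1 ht2
      have := hne t (Ioo_subset_Icc_self (hball (Ioo_subset_Icc_self ht)).1.1) ht1 ht2
      field_simp
      ring
    · exact Or.inr ⟨fun h => (hball (Ioc_subset_Icc_self h)).1.2 rfl,
        fun h => (hball (Ioc_subset_Icc_self h)).2 rfl⟩
  refine ⟨L.continuous.comp_continuousOn hψ.continuousOn, fun y hy h1 h2 => (key y hy h1 h2).1,
    fun y hy h1 h2 => (key y hy h1 h2).2, fun y hy h1 h2 => ?_⟩
  have := hne y (Ioo_subset_Icc_self hy) h1 h2
  field_simp
  ring

theorem dispersion_of_eigenvalue (hu : IsProfile u U) (R : RegularJet U α yc Φ Φ' Φ'')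
    (hα : α ≠ 0) (hyc : yc ∈ Ioo (0 : ℝ) 1) {K : ℝ}
    (hK : K = deriv (fun c => pvRecip (U 0) c) (U 0 yc) + quantII3 (U 0) (U 0 yc) Φ)
    (h : IsEmbeddingEigenvalue u α (U 0 yc)) :
    U 2 yc = 0 ∧ (K = 0 ∨ Φ 0 * Φ' 0 * K = 1) := by
  have H := hu.toProfileJet
  obtain ⟨-, ψ, ψ', hψ, ⟨y, hy, hy0⟩, hweak⟩ := h
  have hweak : IsWeakSolution u α (U 0 yc) ψ ψ' := hweak
  obtain ⟨L, hL⟩ : ∃ L : ℂ →L[ℝ] ℝ, L (ψ y) ≠ 0 := by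
    by_contra! hcon
    exact hy0 (Complex.ext (hcon Complex.reCLM) (hcon Complex.imCLM))
  have Z := hu.channelSolution_of_weak hyc hψ hweak L
  have h1 : L (ψ 1) = 0 := by rw [hψ.right_eq_zero, map_zero]
  have h1' : L (ψ (-1)) = 0 := by rw [hψ.left_eq_zero, map_zero]
  have h2 : U 2 yc = 0 := by
    by_contra hne
    obtain ⟨c1, c2⟩ := hu.critical_values_eq_zero hyc hψ hweak hne
    exact hL (Z.eq_zero_of_critical R H hα hyc (by rw [c1, map_zero])
      (by rw [c2, map_zero]) h1 h1' y hy)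
  refine ⟨h2, ?_⟩
  obtain ⟨Q, B, hQ, -, hQU⟩ := H.exists_regular_potential α hyc h2
  have key := hu.ode_of_weak hyc hψ hweak (by norm_num) le_rfl le_rfl hQ.continuousOn
    (fun y hy _ _ => hQU y hy) (Or.inl h2) L
  have Z' : ChannelSolution U α yc (fun y => L (ψ y)) (deriv fun y => L (ψ y))
      (fun y => Q y * L (ψ y)) :=
    ⟨Z.continuousOn, fun y hy _ _ => (key y hy).1, fun y hy _ _ => (key y hy).2,
      fun y hy _ _ => by linear_combination L (ψ y) * hQU y hy⟩
  have hm : yc ∈ Ioo (-1 : ℝ) 1 := ⟨by linarith [hyc.1], hyc.2⟩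
  have hm' : -yc ∈ Ioo (-1 : ℝ) 1 := ⟨by linarith [hyc.2], by linarith [hyc.1]⟩
  exact Z'.quantization R H hα hyc h2 (key _ hm).1 (key _ hm).2 (key _ hm').1 (key _ hm').2
    h1 h1' ⟨y, hy, hL⟩ hK

theorem eigenvalue_of_dispersion (hu : IsProfile u U) (R : RegularJet U α yc Φ Φ' Φ'')
    (hyc : yc ∈ Ioo (0 : ℝ) 1) {K : ℝ}
    (hK : K = deriv (fun c => pvRecip (U 0) c) (U 0 yc) + quantII3 (U 0) (U 0 yc) Φ)
    (h2 : U 2 yc = 0) (h : K = 0 ∨ Φ 0 * Φ' 0 * K = 1) :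
    IsEmbeddingEigenvalue u α (U 0 yc) := by
  have H := hu.toProfileJet
  obtain ⟨Q, B, hQ, hB, hQU⟩ := H.exists_regular_potential α hyc h2
  obtain ⟨z, z', hz, hz'c, hz', h1, h1', hne⟩ :=
    H.exists_eigenfunction R hyc h2 hQ hB hQU hK h
  have hm : yc ∈ Icc (-1 : ℝ) 1 := ⟨by linarith [hyc.1], hyc.2.le⟩
  have hzc : Continuous z := continuous_iff_continuousAt.mpr fun y => (hz y).continuousAt
  have hle : (-1 : ℝ) ≤ 1 := by norm_num
  have hH : IsH10 (fun y => (z y : ℂ)) (fun y => (z' y : ℂ)) := by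
    refine IsH10.ofReal ?_ (fun y _ => ?_) h1
    · obtain ⟨C, hC⟩ := isCompact_Icc.exists_bound_of_continuousOn
        (hz'c.continuousOn (s := Icc (-1 : ℝ) 1))
      refine MemLp.of_bound hz'c.aestronglyMeasurable C ?_
      filter_upwards [ae_restrict_mem measurableSet_Icc] with y hy
      exact hC y hy
    · rw [intervalIntegral.integral_eq_sub_of_hasDerivAt (fun t _ => hz t)
        (hz'c.intervalIntegrable _ _), h1', sub_zero]
  refine ⟨⟨yc, hm, hu.eqOn hm⟩, fun y => (z y : ℂ), fun y => (z' y : ℂ), hH, ?_, ?_⟩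
  · obtain ⟨y, hy, hy0⟩ := hne
    exact ⟨y, hy, Complex.ofReal_ne_zero.mpr hy0⟩
  intro φ φ' hφ
  set f : ℝ → ℂ := fun y => (flowDeriv2 u y : ℂ) * (z y : ℂ) * φ y / ((u y - U 0 yc : ℝ) : ℂ)
    with hf
  set g : ℝ → ℂ := fun y => ((Q y - α ^ 2 : ℝ) : ℂ) * (z y : ℂ) * φ y with hg
  have hgc : ContinuousOn g (Icc (-1) 1) :=
    (Continuous.continuousOn (by fun_prop)).mul hφ.continuousOn
  have hfg : f =ᵐ[volume.restrict (Icc (-1) 1)] g := by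
    -- `hQU` holds in the open channel only, and `f` takes a junk value at the critical points.
    have hfin : ({-1, 1, yc, -yc} : Set ℝ).Finite := by simp
    filter_upwards [ae_restrict_of_ae (measure_eq_zero_iff_ae_notMem.mp (hfin.measure_zero volume)),
      ae_restrict_mem measurableSet_Icc] with y hyn hy
    simp only [mem_insert_iff, mem_singleton_iff, not_or] at hyn
    have hne : u y - U 0 yc ≠ 0 := fun h0 => by
      have : y ∈ ({yc, -yc} : Set ℝ) := by
        rw [← hu.crit_eq hyc]; exact ⟨hy, sub_eq_zero.mp h0⟩
      rcases this with h | h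
      · exact hyn.2.2.1 h
      · exact hyn.2.2.2 h
    have e := hQU y ⟨lt_of_le_of_ne hy.1 (Ne.symm hyn.1), lt_of_le_of_ne hy.2 hyn.2.1⟩
    have hne' : ((u y - U 0 yc : ℝ) : ℂ) ≠ 0 := Complex.ofReal_ne_zero.mpr hne
    rw [hf, hg]
    simp only
    rw [div_eq_iff hne', hu.eqOn_deriv2 hy, ← e, ← hu.eqOn hy]
    push_cast
    ring
  have hfi : IntegrableOn f (Icc (-1) 1) :=
    (hgc.integrableOn_compact isCompact_Icc).congr hfg.symm
  refine ⟨_, hasPV_of_integrableOn hle (by rw [hu.crit_eq hyc]; simp) hfi, ?_⟩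
  rw [hu.finsum_eq_zero hyc (Or.inl h2), mul_zero, add_zero]
  have hfint : ∫ y in (-1 : ℝ)..1, f y = ∫ y in (-1 : ℝ)..1, g y := by
    rw [intervalIntegral.integral_of_le hle, intervalIntegral.integral_of_le hle,
      ← integral_Icc_eq_integral_Ioc, ← integral_Icc_eq_integral_Ioc, integral_congr_ae hfg]
  have hφi := hφ.intervalIntegrable
  have hQz : Continuous (fun y => Q y * z y) := hQ.mul hzc
  have hi1 : IntervalIntegrable (fun y => (z' y : ℂ) * φ' y) volume (-1) 1 :=
    hφi.continuousOn_mul (Complex.continuous_ofReal.comp hz'c).continuousOn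
  have hi2 : IntervalIntegrable (fun y => (α : ℂ) ^ 2 * (z y : ℂ) * φ y) volume (-1) 1 :=
    ContinuousOn.intervalIntegrable_of_Icc hle
      ((Continuous.continuousOn (by fun_prop)).mul hφ.continuousOn)
  have hi3 : IntervalIntegrable g volume (-1) 1 := hgc.intervalIntegrable_of_Icc hle
  rw [hfint, intervalIntegral.integral_add hi1 hi2, add_assoc,
    ← intervalIntegral.integral_add hi2 hi3]
  have hφ1 : ∫ t in (-1 : ℝ)..1, φ' t = 0 := by
    rw [← hφ.eq_integral 1 (by norm_num), hφ.right_eq_zero]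
  have hz'eq : ∀ y ∈ Icc (-1 : ℝ) 1, z' y = z' (-1) + ∫ t in (-1 : ℝ)..y, Q t * z t := by
    intro y hy
    rw [intervalIntegral.integral_eq_sub_of_hasDerivAt_of_le hy.1 hz'c.continuousOn
      (fun t ht => hz' t ⟨ht.1, ht.2.trans_le hy.2⟩) (hQz.intervalIntegrable _ _)]
    ring
  have e1 : ∫ y in (-1 : ℝ)..1, (z' y : ℂ) * φ' y =
      -∫ y in (-1 : ℝ)..1, ((Q y * z y : ℝ) : ℂ) * φ y := by
    have hc : IntervalIntegrable
        (fun y => ((∫ t in (-1 : ℝ)..y, Q t * z t : ℝ) : ℂ) * φ' y) volume (-1) 1 :=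
      hφi.continuousOn_mul (Complex.continuous_ofReal.comp
        (continuous_primitive_of_continuous hQz (-1))).continuousOn
    -- Only `φ` is weakly differentiable, so `z'` is written as a primitive of `Q z` and the parts
    -- formula for primitives is applied; the constant `z'(-1)` integrates to `0` against `φ'`.
    calc ∫ y in (-1 : ℝ)..1, (z' y : ℂ) * φ' y
        = ∫ y in (-1 : ℝ)..1, ((z' (-1) : ℂ) * φ' y +
            ((∫ t in (-1 : ℝ)..y, Q t * z t : ℝ) : ℂ) * φ' y) := by
          refine intervalIntegral.integral_congr fun y hy => ?_
          rw [uIcc_of_le hle] at hy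
          rw [hz'eq y hy]
          push_cast
          ring
      _ = -∫ y in (-1 : ℝ)..1, ((Q y * z y : ℝ) : ℂ) * ∫ t in (-1 : ℝ)..y, φ' t := by
          rw [intervalIntegral.integral_add (hφi.const_mul _) hc,
            intervalIntegral.integral_const_mul, hφ1,
            integral_primitive_mul_complex hle (hQz.intervalIntegrable _ _) hφi, hφ1]
          ring
      _ = _ := by
          congr 1
          refine intervalIntegral.integral_congr fun y hy => ?_
          rw [uIcc_of_le hle] at hy
          rw [hφ.eq_integral y hy]
  have e2 : ∫ y in (-1 : ℝ)..1, ((α : ℂ) ^ 2 * (z y : ℂ) * φ y + g y) =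
      ∫ y in (-1 : ℝ)..1, ((Q y * z y : ℝ) : ℂ) * φ y :=
    intervalIntegral.integral_congr fun y _ => by
      simp only [hg]
      push_cast
      ring
  rw [e1, e2, neg_add_cancel]

end IsProfile

/-- For a symmetric flow `u`, a wave number `α ≠ 0` and `c = u(y_c) ∈ (u(0), u(1))`: the regular
solution `φ` of the homogeneous Rayleigh equation exists, the quantities built from it are well
defined, and `c` is an embedding eigenvalue iff `A² + B² = 0` or `A₂² + B₂² = 0`. -/
theorem proposition5p3 (u : ℝ → ℝ) (hu : IsSymmetricFlow u) (α : ℝ) (hα : α ≠ 0)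
    (c : ℝ) (hc : c ∈ Set.Ioo (u 0) (u 1))
    (yc : ℝ) (hyc : yc ∈ Set.Icc (0 : ℝ) 1) (huyc : u yc = c) :
    (∃ φ : ℝ → ℝ, IsRegularRayleighSolution u α c yc φ) ∧
    ∀ φ : ℝ → ℝ, IsRegularRayleighSolution u α c yc φ →
      QuantitiesWellDefined u c φ ∧
      (IsEmbeddingEigenvalue u α c ↔
        quantA u c yc φ ^ 2 + quantB u c yc ^ 2 = 0 ∨
        quantA2 u c yc φ ^ 2 + quantB2 u c yc ^ 2 = 0) := by
  obtain ⟨U, hU⟩ := hu.exists_isProfile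
  have hyc' : yc ∈ Ioo (0 : ℝ) 1 := by
    refine ⟨lt_of_le_of_ne hyc.1 ?_, lt_of_le_of_ne hyc.2 ?_⟩
    · rintro rfl
      exact hc.1.ne huyc
    · rintro rfl
      exact hc.2.ne' huyc
  obtain rfl : U 0 yc = c := by rw [← huyc, hU.eqOn ⟨by linarith [hyc.1], hyc.2⟩]
  refine ⟨?_, fun φ hφ => ?_⟩
  · obtain ⟨Φ, Φ', Φ'', R⟩ := hU.exists_regularJet α hyc'
    exact ⟨Φ, R.isRegular hU hyc'⟩
  · obtain ⟨Φ, Φ', Φ'', R, he⟩ := hφ.exists_jet hU hyc'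
    refine ⟨hU.quantitiesWellDefined R he hα hyc', ?_⟩
    rw [hU.dispersion_iff R he hα hyc' rfl]
    exact ⟨hU.dispersion_of_eigenvalue R hα hyc' rfl,
      fun h => hU.eigenvalue_of_dispersion R hyc' rfl h.1 h.2⟩
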